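/- Let $T>0$, $\alpha\in(\tfrac13,\tfrac12)$, $d,k\in\mathbb N$, and let $(\Omega,\mathcal F,(\mathcal F_t)_{t\in[0,T]},\mathbb P)$ be a complete filtered probability space ($\mathcal F_0$ contains all $\mathbb P$-null sets). Let $\boldsymbol\eta=(\eta,\eta^{(2)})$ be a deterministic $\alpha$-Hölder rough path on $[0,T]$ over $\mathbb R^d$: $\eta:[0,T]\to\mathbb R^d$ and $\eta^{(2)}:\{s\le t\}\to\mathbb R^{d\times d}$ are continuous with $|\eta_t-\eta_s|\lesssim|t-s|^\alpha$, $|\eta^{(2)}_{s,t}|\lesssim|t-s|^{2\alpha}$ and $\eta^{(2)}_{s,t}-\eta^{(2)}_{s,u}-\eta^{(2)}_{u,t}=(\eta_u-\eta_s)\otimes(\eta_t-\eta_u)$ for $s\le u\le t$. For $p\in[2,\infty]$, $\kappa>0$ and a random two-parameter function $A$ put $\|A\|_{\kappa,p}=\sup_{0\le s<t\le T}\|A_{s,t}\|_{L_p}/(t-s)^\kappa$. For exponents $\gamma,\gamma'>0$ and progressively measurable processes $Z$ ($V$-valued, $V$ a Euclidean space) and $Z'$ ($\mathcal L(\mathbb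 R^d;V)$-valued) let $R^Z_{s,t}=Z_t-Z_s-Z'_s(\eta_t-\eta_s)$. Write $(Z,Z')\in\mathbf D^{\gamma,\gamma'}_\eta L_p$ if $Z_0,Z'_0\in L_p$ and $\|\delta Z\|_{\gamma,p}$, $\|\delta Z'\|_{\gamma',p}$ and $\|(\mathbb E[R^Z_{s,t}\mid\mathcal F_s])_{s<t}\|_{\gamma+\gamma',p}$ are finite, where $\delta Z_{s,t}=Z_t-Z_s$. Write $(Z,Z')\in\mathscr D^{\gamma,\gamma'}_\eta L_p$ if in addition $\|R^Z\|_{\gamma+\gamma',p}<\infty$. When $Z$ is $\mathcal L(\mathbb R^d;V)$-valued, $\int_0^t Z_r\,d\boldsymbol\eta_r$ denotes the limit in probability, as the mesh of the partition $\Pi$ of $[0,t]$ tends to $0$, of $\sum_{[u,v]\in\Pi}\big(Z_u(\eta_v-\eta_u)+Z'_u\eta^{(2)}_{u,v}\big)$. Let $\beta\in(\tfrac14,\alpha]$ and $\beta'\in(0,\beta]$ with $\alpha+\beta+\beta'>1$, and let $(F,F')\in\mathscr D^{\beta,\beta'}_\eta L_\infty$ with $F$ taking values in $\mathcal L(\mathbb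 R^k;\mathcal L(\mathbb R^d;\mathbb R^k))$. Let $b:[0,T]\times\Omega\times\mathbb R^k\to\mathbb R^k$ be progressively measurable, and suppose that there is a constant $C$ such that almost surely, for all $t\in[0,T]$ and $x,\bar x\in\mathbb R^k$, $$|b(t,\omega,x)|\le C(1+|x|),\qquad |b(t,\omega,x)-b(t,\omega,\bar x)|\le C|x-\bar x|.$$ Let $\xi\in L_\infty$ be $\mathcal F_0$-measurable with values in $\mathbb R^k$. Consider $$X_t=\xi+\int_0^t b_r(X_r)\,dr+\int_0^t F_rX_r\,d\boldsymbol\eta_r,\qquad t\in[0,T].\tag{$*$}$$ A solution of $(*)$ in the space $\mathbf D^{\gamma,\gamma'}_\eta L_p$, where $p\in[2,\infty]$, $\gamma\in(0,\alpha]$, $\gamma'\in(0,\gamma]$, $\alpha+\gamma>\frac12$ and $\alpha+\gamma+\gamma'>1$, is a continuous adapted process $X$ such that $\int_0^T|b_r(X_r)|\,dr<\infty$ a.s., $(FX,\;F'X+F(FX))\in\mathbf D^{\gamma,\gamma'}_\eta L_p$, and almost surely $(*)$ holds for all $t\in[0,T]$; the rough integral is that of the pair $(FX,\;F'X+F(FX))$.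 Then there is a solution $X$ of $(*)$ in the space $\mathbf D^{\beta,\beta'}_\eta L_\infty$ with $(X,FX)\in\mathscr D^{\alpha,\beta}_\eta L_\infty$. In particular $X$ is uniformly bounded: there is a constant $C$ such that almost surely $|X_t|\le C$ for all $t\in[0,T]$. The solution is unique: every solution of $(*)$, in any of the spaces $\mathbf D^{\gamma,\gamma'}_\eta L_p$ with $p,\gamma,\gamma'$ as above, is indistinguishable from $X$. -/

import Mathlib

open MeasureTheory
open scoped ENNReal NNReal

noncomputable section

namespace RoughRDE

/-- The time interval `[0, T]`. -/
abbrev Time (T : ℝ) : Type := Set.Icc (0 : ℝ) T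

/-- Lebesgue measure on `[0, T]`. -/
def timeMeasure (T : ℝ) : Measure (Time T) :=
  Measure.comap (Subtype.val : Time T → ℝ) volume

/-- An `α`-Hölder rough path on `[0, T]` over `ℝ^d`: a path together with a second level,
both Hölder continuous, that satisfy Chen's relation. The values `level2 s t` are relevant only
for `s ≤ t`. -/
structure RoughPath (α T : ℝ) (d : ℕ) where
  path : Time T → EuclideanSpace ℝ (Fin d)
  level2 : Time T → Time T → Matrix (Fin d) (Fin d) ℝ
  continuous_path : Continuous path
  continuous_level2 : ∀ i j, ContinuousOn
    (fun p : Time T × Time T => level2 p.1 p.2 i j) {p | p.1 ≤ p.2}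
  holder_path : ∃ C : ℝ, ∀ s t : Time T, s ≤ t →
    ‖path t - path s‖ ≤ C * ((t : ℝ) - s) ^ α
  holder_level2 : ∃ C : ℝ, ∀ s t : Time T, s ≤ t → ∀ i j,
    |level2 s t i j| ≤ C * ((t : ℝ) - s) ^ (2 * α)
  chen : ∀ s u t : Time T, s ≤ u → u ≤ t → ∀ i j,
    level2 s t i j - level2 s u i j - level2 u t i j
      = (path u - path s) i * (path t - path u) j

section Controlled

variable {α T : ℝ} {d : ℕ} {Ω : Type*} {mΩ : MeasurableSpace Ω}
  {V : Type*} [NormedAddCommGroup V] [NormedSpace ℝ V]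

/-- A random two-parameter function `A` belongs to `C₂^κ L_p`:
`sup_{s < t} ‖A_{s,t}‖_{L_p} / (t - s)^κ < ∞`. -/
def HolderLp (μ : Measure Ω) (κ : ℝ) (p : ℝ≥0∞) (A : Time T → Time T → Ω → V) : Prop :=
  ∃ C : ℝ≥0, ∀ s t : Time T, s < t →
    eLpNorm (A s t) p μ ≤ C * ENNReal.ofReal (((t : ℝ) - s) ^ κ)

/-- The remainder `R^Z_{s,t} = Z_t - Z_s - Z'_s (η_t - η_s)`. -/
def remainder (η : RoughPath α T d) (Z : Time T → Ω → V)
    (Z' : Time T → Ω → (EuclideanSpace ℝ (Fin d) →L[ℝ] V)) (s t : Time T) (ω : Ω) : V :=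
  Z t ω - Z s ω - Z' s ω (η.path t - η.path s)

/-- `(Z, Z')` is an `η`-stochastic controlled rough path of `p`-integrability and
`(β, β')`-Hölder regularity, i.e. it belongs to the space `𝐃_η^{β,β'} L_p` in which only the
conditional expectations `𝔼[R^Z_{s,t} | ℱ_s]` of the remainder are required to be of order
`β + β'`. -/
structure IsStochControlled (ℱ : Filtration (Time T) mΩ) (μ : Measure Ω)
    (η : RoughPath α T d) (β β' : ℝ) (p : ℝ≥0∞) (Z : Time T → Ω → V)
    (Z' : Time T → Ω → (EuclideanSpace ℝ (Fin d) →L[ℝ] V)) : Prop where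
  progressive : IsStronglyProgressive ℱ Z
  progressive' : IsStronglyProgressive ℱ Z'
  memLp_zero : ∀ t : Time T, (t : ℝ) = 0 → MemLp (Z t) p μ
  memLp_zero' : ∀ t : Time T, (t : ℝ) = 0 → MemLp (Z' t) p μ
  holder : HolderLp μ β p (fun s t ω => Z t ω - Z s ω)
  holder' : HolderLp μ β' p (fun s t ω => Z' t ω - Z' s ω)
  condExp_remainder : HolderLp μ (β + β') p (fun s t => μ[remainder η Z Z' s t | ℱ s])

/-- `(Z, Z')` belongs to the smaller space `𝒟_η^{β,β'} L_p`: it lies in `𝐃_η^{β,β'} L_p` and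
the remainder itself (not only its conditional expectation) is of order `β + β'` in `L_p`. -/
structure IsStrongControlled (ℱ : Filtration (Time T) mΩ) (μ : Measure Ω)
    (η : RoughPath α T d) (β β' : ℝ) (p : ℝ≥0∞) (Z : Time T → Ω → V)
    (Z' : Time T → Ω → (EuclideanSpace ℝ (Fin d) →L[ℝ] V)) : Prop extends
    IsStochControlled ℱ μ η β β' p Z Z' where
  remainder : HolderLp μ (β + β') p (RoughRDE.remainder η Z Z')

/-- `π 0 < π 1 < ⋯ < π n` is a partition of `[0, t]`. -/
def IsPartition (t : Time T) (n : ℕ) (π : ℕ → Time T) : Prop :=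
  (π 0 : ℝ) = 0 ∧ π n = t ∧ ∀ i < n, π i < π (i + 1)

/-- The compensated Riemann summand `Z_u (η_v - η_u) + Z'_u η⁽²⁾_{u,v}`, where
`Z'_u η⁽²⁾_{u,v} = ∑_{i,j} η⁽²⁾_{u,v}(i,j) Z'_u(e_i)(e_j)`: the first slot of `Z'` is the
direction of the derivative, the second slot is the one that is integrated. -/
def germ (η : RoughPath α T d) (Z : Time T → Ω → (EuclideanSpace ℝ (Fin d) →L[ℝ] V))
    (Z' : Time T → Ω →
      (EuclideanSpace ℝ (Fin d) →L[ℝ] EuclideanSpace ℝ (Fin d) →L[ℝ] V))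
    (u v : Time T) (ω : Ω) : V :=
  Z u ω (η.path v - η.path u)
    + ∑ i, ∑ j, η.level2 u v i j •
        Z' u ω (EuclideanSpace.single i (1 : ℝ)) (EuclideanSpace.single j (1 : ℝ))

/-- `I` is (a version of) the rough stochastic integral `∫_0^· (Z, Z') dη`: for every `t`, the
compensated Riemann sums along partitions of `[0, t]` converge to `I t` in probability as the
mesh tends to `0`. -/
def IsRoughIntegral (μ : Measure Ω) (η : RoughPath α T d)
    (Z : Time T → Ω → (EuclideanSpace ℝ (Fin d) →L[ℝ] V))
    (Z' : Time T → Ω →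
      (EuclideanSpace ℝ (Fin d) →L[ℝ] EuclideanSpace ℝ (Fin d) →L[ℝ] V))
    (I : Time T → Ω → V) : Prop :=
  ∀ t : Time T, ∀ ε : ℝ, 0 < ε → ∀ κ : ℝ≥0∞, 0 < κ → ∃ δ : ℝ, 0 < δ ∧
    ∀ (n : ℕ) (π : ℕ → Time T), IsPartition t n π →
      (∀ i < n, (π (i + 1) : ℝ) - π i < δ) →
      μ {ω | ε ≤ ‖∑ i ∈ Finset.range n, germ η Z Z' (π i) (π (i + 1)) ω - I t ω‖} ≤ κ

end Controlled

section Equation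

variable {α T : ℝ} {d k : ℕ} {Ω : Type*} {mΩ : MeasurableSpace Ω}

/-- A random vector field `b : [0,T] × Ω × ℝ^k → ℝ^k` is progressively measurable: for every `t`
its restriction to `[0,t] × Ω × ℝ^k` is measurable for `ℬ([0,t]) ⊗ ℱ_t ⊗ ℬ(ℝ^k)`. -/
def ProgressiveField (ℱ : Filtration (Time T) mΩ)
    (b : Time T → Ω → EuclideanSpace ℝ (Fin k) → EuclideanSpace ℝ (Fin k)) : Prop :=
  ∀ t : Time T, Measurable[
    (inferInstance : MeasurableSpace (Set.Iic t)).prod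
      ((ℱ t).prod (inferInstance : MeasurableSpace (EuclideanSpace ℝ (Fin k)))),
    (inferInstance : MeasurableSpace (EuclideanSpace ℝ (Fin k)))]
    (fun q : Set.Iic t × Ω × EuclideanSpace ℝ (Fin k) => b q.1 q.2.1 q.2.2)

/-- The integrand `F X`. -/
def integrand
    (F : Time T → Ω → (EuclideanSpace ℝ (Fin k) →L[ℝ]
      EuclideanSpace ℝ (Fin d) →L[ℝ] EuclideanSpace ℝ (Fin k)))
    (X : Time T → Ω → EuclideanSpace ℝ (Fin k)) :
    Time T → Ω → (EuclideanSpace ℝ (Fin d) →L[ℝ] EuclideanSpace ℝ (Fin k)) :=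
  fun t ω => F t ω (X t ω)

/-- The Gubinelli derivative `F' X + F (F X)` of the integrand `F X`, that is the map
`h ↦ F'(h)(X) + F((F X) h)`. -/
def integrand'
    (F : Time T → Ω → (EuclideanSpace ℝ (Fin k) →L[ℝ]
      EuclideanSpace ℝ (Fin d) →L[ℝ] EuclideanSpace ℝ (Fin k)))
    (F' : Time T → Ω → (EuclideanSpace ℝ (Fin d) →L[ℝ] EuclideanSpace ℝ (Fin k) →L[ℝ]
      EuclideanSpace ℝ (Fin d) →L[ℝ] EuclideanSpace ℝ (Fin k)))
    (X : Time T → Ω → EuclideanSpace ℝ (Fin k)) :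
    Time T → Ω → (EuclideanSpace ℝ (Fin d) →L[ℝ]
      EuclideanSpace ℝ (Fin d) →L[ℝ] EuclideanSpace ℝ (Fin k)) :=
  fun t ω => (F' t ω).flip (X t ω) + (F t ω).comp (F t ω (X t ω))

/-- `X` is a `p`-integrable solution, in the space `𝐃_η^{γ,γ'} L_p`, to
`X_t = ξ + ∫_0^t b_r(X_r) dr + ∫_0^t F_r X_r dη_r`, `t ∈ [0, T]`. -/
structure IsSolution (ℱ : Filtration (Time T) mΩ) (μ : Measure Ω) (η : RoughPath α T d)
    (b : Time T → Ω → EuclideanSpace ℝ (Fin k) → EuclideanSpace ℝ (Fin k))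
    (F : Time T → Ω → (EuclideanSpace ℝ (Fin k) →L[ℝ]
      EuclideanSpace ℝ (Fin d) →L[ℝ] EuclideanSpace ℝ (Fin k)))
    (F' : Time T → Ω → (EuclideanSpace ℝ (Fin d) →L[ℝ] EuclideanSpace ℝ (Fin k) →L[ℝ]
      EuclideanSpace ℝ (Fin d) →L[ℝ] EuclideanSpace ℝ (Fin k)))
    (ξ : Ω → EuclideanSpace ℝ (Fin k)) (γ γ' : ℝ) (p : ℝ≥0∞)
    (X : Time T → Ω → EuclideanSpace ℝ (Fin k)) : Prop where
  two_le : 2 ≤ p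
  gamma_mem : γ ∈ Set.Ioc 0 α
  gamma'_mem : γ' ∈ Set.Ioc 0 γ
  half_lt : 1 / 2 < α + γ
  one_lt : 1 < α + γ + γ'
  continuous : ∀ ω, Continuous (fun t => X t ω)
  adapted : StronglyAdapted ℱ X
  integrable_drift : ∀ᵐ ω ∂μ, Integrable (fun r => b r ω (X r ω)) (timeMeasure T)
  controlled : IsStochControlled ℱ μ η γ γ' p (integrand F X) (integrand' F F' X)
  equation : ∃ I : Time T → Ω → EuclideanSpace ℝ (Fin k),
    IsRoughIntegral μ η (integrand F X) (integrand' F F' X) I ∧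
    ∀ᵐ ω ∂μ, ∀ t : Time T,
      X t ω = ξ ω + (∫ r in Set.Iic t, b r ω (X r ω) ∂(timeMeasure T)) + I t ω

end Equation

end RoughRDE

end

noncomputable section

open Filter Topology

set_option maxSynthPendingDepth 3

/-! The rough part of the equation is linear, so it can be solved once and for all by a random
operator, and the drift is then handled by variation of constants.

Flow. First `(F, F')` is replaced by a modification whose controlled-path bounds hold for every `ω`
and all times with one constant (`exists_uniformControlled_modification`). The one-step operators,
namely `1` plus the germ of the linear rough integral, are then multiplicative up to an error of
order `θ = α + β + β' > 1`, uniformly in `ω` (`exists_almostMul_flowStep`). A multiplicative sewing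
lemma (`exists_multiplicative_primitive`) turns their time-ordered products into a bounded flow `U`.
With `x = m - 1`, the approximate inverses `1 - x + x²` of the steps `m` are almost multiplicative
in the opposite ring, because the cubic error has order `3α ≥ θ`; sewing them gives `V`. Increments
of `V U` have order `θ > 1`, so `V U = 1`, and `U V = 1` by finite dimension (`exists_linearFlow`).

Existence. Picard iteration solves the ordinary integral equation `M = ξ + ∫ V b(U M) dr`, and `X =
U M`. On `[s, t]` the increment of `X` equals drift plus germ up to order `θ`. This local expansion
yields both the controlled-path bounds for `X` and `F X` and the convergence of the compensated
Riemann sums. Boundedness of `X` comes from that of `U`, `V` and `ξ`.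

Uniqueness. A competitor `Y` lies only in the weak space, where the remainder is good merely after
conditioning. It suffices that `V Y` solves the integral equation `V Y = ξ + ∫ V b(Y) dr`; Grönwall
then compares two solutions. Telescoping `V Y` along dyadic partitions leaves a flow error of order
`θ`, a drift error of order `1 + α`, and a sum of `V_v (I_v - I_u - germ_{u,v})`, where `I` is the
rough integral. The last summands are of order `α + γ` in `L²`, perhaps below `1`, but their
conditional means have order `α + γ + γ' > 1`. As in stochastic sewing, orthogonality of the
martingale parts makes `α + γ > 1/2` enough. The weight sits at the right endpoint and is not
adapted; moving it to the left costs order `α + (α + γ) > 1` (`DefectBound.exists_subseq_tendsto`).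
-/

namespace RoughRDE

/-! ### Multiplicative sewing in a normed ring. -/

section MultiplicativeSewing

variable {T : ℝ} {𝔸 : Type*} [NormedRing 𝔸]

/-- The time-ordered product `m (c (n-1)) (c n) * ⋯ * m (c 0) (c 1)`. -/
def stepProd (m : Time T → Time T → 𝔸) (c : ℕ → Time T) : ℕ → 𝔸
  | 0 => 1
  | n + 1 => m (c n) (c (n + 1)) * stepProd m c n

theorem stepProd_add (m : Time T → Time T → 𝔸) (c : ℕ → Time T) (p q : ℕ) :
    stepProd m c (p + q) = stepProd m (fun i => c (p + i)) q * stepProd m c p := by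
  induction q with
  | zero => simp [stepProd]
  | succ q ih => rw [← add_assoc, stepProd, ih, stepProd, mul_assoc]; rfl

theorem stepProd_congr (m : Time T → Time T → 𝔸) {c c' : ℕ → Time T} {n : ℕ}
    (h : ∀ i ≤ n, c i = c' i) : stepProd m c n = stepProd m c' n := by
  induction n with
  | zero => rfl
  | succ n ih =>
    rw [stepProd, stepProd, ih fun i hi => h i (hi.trans n.le_succ), h n n.le_succ, h _ le_rfl]

/-- A two-parameter family `m` that is multiplicative up to an error of order `θ` and that is
close to `1` up to an error of order `a`. -/
structure AlmostMul (m : Time T → Time T → 𝔸) (a θ C : ℝ) : Prop where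
  refl : ∀ s, m s s = 1
  small : ∀ s t, s ≤ t → ‖m s t - 1‖ ≤ C * ((t : ℝ) - s) ^ a
  mul : ∀ s u t, s ≤ u → u ≤ t → ‖m u t * m s u - m s t‖ ≤ C * ((t : ℝ) - s) ^ θ

theorem stepProd_const {m : Time T → Time T → 𝔸} (hm : ∀ s, m s s = 1) (s : Time T) (n : ℕ) :
    stepProd m (fun _ => s) n = 1 := by
  induction n with
  | zero => rfl
  | succ n ih => rw [stepProd, ih, hm, one_mul]

/-- Only the single step from `j` to `j + 1` can cross the level `x`. The search stops at `n - 1`,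
so that this step is among the first `n`; `p = 0` covers the case that `x` is never passed. -/
theorem exists_split {c : ℕ → Time T} (n : ℕ) (hn : n ≠ 0) {x : ℝ}
    (hx : (c 0 : ℝ) ≤ x) : ∃ j p, n = j + 1 + p ∧ (c j : ℝ) ≤ x ∧
      (p = 0 ∨ x < c (j + 1)) := by
  classical
  set j := Nat.findGreatest (fun j => (c j : ℝ) ≤ x) (n - 1) with hj
  have hjn : j ≤ n - 1 := Nat.findGreatest_le _
  refine ⟨j, n - (j + 1), by omega, ?_, ?_⟩
  · exact Nat.findGreatest_spec (P := fun j => (c j : ℝ) ≤ x) (Nat.zero_le _) hx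
  · by_cases h : n - (j + 1) = 0
    · exact Or.inl h
    · right
      have := Nat.findGreatest_is_greatest (P := fun j => (c j : ℝ) ≤ x) (n := n - 1) (k := j + 1)
        (by omega) (by omega)
      exact not_le.1 this

theorem time_sub_nonneg {s t : Time T} (h : s ≤ t) : 0 ≤ (t : ℝ) - s := sub_nonneg.2 h

theorem time_sub_le (s t : Time T) : (t : ℝ) - s ≤ T := by
  linarith [t.2.2, s.2.1]

theorem AlmostMul.norm_le {m : Time T → Time T → 𝔸} {a θ C : ℝ} (hm : AlmostMul m a θ C)
    (h1 : ‖(1 : 𝔸)‖ ≤ 1) (ha : 0 < a) (hC : 0 ≤ C) {h : ℝ} {s t : Time T} (hst : s ≤ t)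
    (hh : (t : ℝ) - s ≤ h) : ‖m s t‖ ≤ 1 + C * h ^ a := by
  have := norm_le_insert' (m s t) 1
  have h2 := hm.small s t hst
  have h3 : ((t : ℝ) - s) ^ a ≤ h ^ a :=
    Real.rpow_le_rpow (time_sub_nonneg hst) hh ha.le
  nlinarith

/-- Products of an almost multiplicative family over short intervals stay close to the family. -/
theorem exists_local_stepProd_bound (h1 : ‖(1 : 𝔸)‖ ≤ 1) {a θ C : ℝ} (ha : 0 < a) (hθ : 1 < θ)
    (hC : 0 ≤ C) : ∃ h > 0, ∃ K ≥ 0, ∃ M ≥ 1, ∀ m : Time T → Time T → 𝔸, AlmostMul m a θ C →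
      ∀ (n : ℕ) (c : ℕ → Time T), Monotone c → (c n : ℝ) - c 0 ≤ h →
        ‖stepProd m c n - m (c 0) (c n)‖ ≤ K * ((c n : ℝ) - c 0) ^ θ ∧
        ‖stepProd m c n‖ ≤ M := by
  set r : ℝ := 2 ^ (1 - θ) with hr
  have hr0 : 0 < r := by positivity
  have hr1 : r < 1 := Real.rpow_lt_one_of_one_lt_of_neg one_lt_two (by linarith)
  -- Halving an interval gains the factor `r < 1`, while each half is multiplied by two factors of
  -- norm at most `M`. With `r * M ^ 2 < 1` the recursion for the constant has the fixed point `K`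
  -- below, and `h` is then taken so small that all products stay below `M`.
  obtain ⟨M, hM1, hMr⟩ : ∃ M : ℝ, 1 < M ∧ r * M ^ 2 < 1 := by
    have hev : ∀ᶠ M in 𝓝[>] (1 : ℝ), r * M ^ 2 < 1 := by
      have : Tendsto (fun M : ℝ => r * M ^ 2) (𝓝[>] 1) (𝓝 (r * 1 ^ 2)) :=
        ((continuous_const.mul (continuous_pow 2)).tendsto 1).mono_left nhdsWithin_le_nhds
      exact this.eventually_lt_const (by simpa using hr1)
    obtain ⟨M, h1, h2⟩ := (hev.and self_mem_nhdsWithin).exists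
    exact ⟨M, h2, h1⟩
  set K : ℝ := C * (M + 1) / (1 - r * M ^ 2) with hK
  have hK0 : 0 ≤ K := by
    have : 0 < 1 - r * M ^ 2 := by linarith
    positivity
  have hKeq : r * M ^ 2 * K + C * (M + 1) = K := by
    rw [hK]; field_simp [show (1 - r * M ^ 2) ≠ 0 by linarith]; ring
  obtain ⟨h, hh0, hhM⟩ : ∃ h : ℝ, 0 < h ∧ C * h ^ a + K * h ^ θ ≤ M - 1 := by
    have hev : ∀ᶠ h in 𝓝[>] (0 : ℝ), C * h ^ a + K * h ^ θ < M - 1 := by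
      have hc : Continuous (fun h : ℝ => C * h ^ a + K * h ^ θ) :=
        (continuous_const.mul (Real.continuous_rpow_const ha.le)).add
          (continuous_const.mul (Real.continuous_rpow_const (by linarith)))
      have := (hc.tendsto 0).mono_left (nhdsWithin_le_nhds (s := Set.Ioi 0))
      refine this.eventually_lt_const ?_
      rw [Real.zero_rpow ha.ne', Real.zero_rpow (by linarith)]
      linarith
    obtain ⟨h, h1, h2⟩ := (hev.and self_mem_nhdsWithin).exists
    exact ⟨h, h2, h1.le⟩
  refine ⟨h, hh0, K, hK0, M, hM1.le, fun m hm => ?_⟩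
  have hmM : ∀ s t : Time T, s ≤ t → (t : ℝ) - s ≤ h → ‖m s t‖ ≤ M := fun s t hst hl => by
    have := hm.norm_le h1 ha hC hst hl
    have : 0 ≤ K * h ^ θ := by positivity
    linarith
  have key : ∀ (n : ℕ) (c : ℕ → Time T), Monotone c → (c n : ℝ) - c 0 ≤ h →
        ‖stepProd m c n - m (c 0) (c n)‖ ≤ K * ((c n : ℝ) - c 0) ^ θ →
        ‖stepProd m c n‖ ≤ M := fun n c hc hl hb => by
    have h2 := hm.norm_le h1 ha hC (hc (Nat.zero_le n)) hl
    have h3 := norm_le_insert' (stepProd m c n) (m (c 0) (c n))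
    have h4 : ((c n : ℝ) - c 0) ^ θ ≤ h ^ θ :=
      Real.rpow_le_rpow (time_sub_nonneg (hc (Nat.zero_le n))) hl (by linarith)
    have h5 := mul_le_mul_of_nonneg_left h4 hK0
    linarith
  suffices H : ∀ (n : ℕ) (c : ℕ → Time T), Monotone c → (c n : ℝ) - c 0 ≤ h →
        ‖stepProd m c n - m (c 0) (c n)‖ ≤ K * ((c n : ℝ) - c 0) ^ θ from
    fun n c hc hl => ⟨H n c hc hl, key n c hc hl (H n c hc hl)⟩
  intro n
  induction n using Nat.strong_induction_on with
  | _ n ih =>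
  intro c hc hl
  set ℓ : ℝ := (c n : ℝ) - c 0 with hℓ
  have hℓ0 : 0 ≤ ℓ := time_sub_nonneg (hc (Nat.zero_le n))
  rcases Nat.eq_zero_or_pos n with hn | hn
  · subst hn
    simp only [stepProd, hm.refl, sub_self, norm_zero]
    positivity
  -- Cut at the midpoint in length, not in index: the blocks before `c j` and after `c (j + 1)` each
  -- have length at most `ℓ / 2`, and the crossing step is a single factor of the family, so it
  -- needs no estimate.
  obtain ⟨j, p, hjp, hj1, hj2⟩ := exists_split (c := c) n hn.ne' (x := (c 0 : ℝ) + ℓ / 2)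
    (by linarith)
  have hshift : Monotone fun i => c (j + 1 + i) := fun x y hxy => hc (by omega)
  have hD := ih j (by omega) c hc (by linarith)
  have hDM := key j c hc (by linarith) hD
  have hl2 : ((c n : ℝ) - c (j + 1)) ≤ ℓ / 2 := by
    rcases hj2 with h0 | h0
    · have : n = j + 1 := by omega
      rw [← this]; rw [sub_self]; linarith
    · linarith
  have hA := ih p (by omega) _ hshift (by simp only [← hjp, add_zero]; linarith)
  have hAM := key p _ hshift (by simp only [← hjp, add_zero]; linarith) hA
  simp only [← hjp, add_zero] at hA
  have hsplit : stepProd m c n = stepProd m (fun i => c (j + 1 + i)) p *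
      (m (c j) (c (j + 1)) * stepProd m c j) := by
    conv_lhs => rw [hjp, stepProd_add, stepProd]
  have c0j : c 0 ≤ c j := hc (Nat.zero_le _)
  have cj1 : c j ≤ c (j + 1) := hc (Nat.le_succ _)
  have cj1n : c (j + 1) ≤ c n := hc (by omega)
  have c0j' : (c 0 : ℝ) ≤ c j := c0j
  have cj1' : (c j : ℝ) ≤ c (j + 1) := cj1
  have cj1n' : (c (j + 1) : ℝ) ≤ c n := cj1n
  have hBM := hmM (c j) (c (j + 1)) cj1 (by linarith)
  have hA0M := hmM (c (j + 1)) (c n) cj1n (by linarith)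
  have e1 := hm.mul (c 0) (c j) (c (j + 1)) c0j cj1
  have e2 := hm.mul (c 0) (c (j + 1)) (c n) (c0j.trans cj1) cj1n
  set A := stepProd m (fun i => c (j + 1 + i)) p
  set B := m (c j) (c (j + 1))
  set D := stepProd m c j
  set A0 := m (c (j + 1)) (c n)
  set D0 := m (c 0) (c j)
  have hθ0 : 0 ≤ θ := by linarith
  have hhalf : 2 * (ℓ / 2) ^ θ = r * ℓ ^ θ := by
    rw [Real.div_rpow hℓ0 two_pos.le, hr, Real.rpow_sub two_pos, Real.rpow_one]; ring
  have f1 : ‖A - A0‖ ≤ K * (ℓ / 2) ^ θ := hA.trans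
    (mul_le_mul_of_nonneg_left (Real.rpow_le_rpow (by linarith) hl2 hθ0) hK0)
  have f2 : ‖D - D0‖ ≤ K * (ℓ / 2) ^ θ := hD.trans
    (mul_le_mul_of_nonneg_left (Real.rpow_le_rpow (by linarith) (by linarith) hθ0) hK0)
  have f3 : ‖B * D0 - m (c 0) (c (j + 1))‖ ≤ C * ℓ ^ θ := e1.trans
    (mul_le_mul_of_nonneg_left (Real.rpow_le_rpow (by linarith) (by linarith) hθ0) hC)
  have f4 : ‖A0 * m (c 0) (c (j + 1)) - m (c 0) (c n)‖ ≤ C * ℓ ^ θ := e2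
  have hx0 : 0 ≤ K * (ℓ / 2) ^ θ := by positivity
  have hM0 : 0 ≤ M := by linarith
  rw [hsplit]
  calc ‖A * (B * D) - m (c 0) (c n)‖
      = ‖(A - A0) * (B * D) + A0 * (B * (D - D0)) + A0 * (B * D0 - m (c 0) (c (j + 1)))
          + (A0 * m (c 0) (c (j + 1)) - m (c 0) (c n))‖ := by congr 1; noncomm_ring
    _ ≤ ‖A - A0‖ * (‖B‖ * ‖D‖) + ‖A0‖ * (‖B‖ * ‖D - D0‖)
          + ‖A0‖ * ‖B * D0 - m (c 0) (c (j + 1))‖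
          + ‖A0 * m (c 0) (c (j + 1)) - m (c 0) (c n)‖ := by
        refine (norm_add_le _ _).trans (add_le_add ((norm_add_le _ _).trans
          (add_le_add ((norm_add_le _ _).trans (add_le_add ?_ ?_)) (norm_mul_le _ _))) le_rfl)
        · exact (norm_mul_le _ _).trans (by gcongr; exact norm_mul_le _ _)
        · exact (norm_mul_le _ _).trans (by gcongr; exact norm_mul_le _ _)
    _ ≤ (K * (ℓ / 2) ^ θ) * (M * M) + M * (M * (K * (ℓ / 2) ^ θ)) + M * (C * ℓ ^ θ)
          + C * ℓ ^ θ := by gcongr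
    _ = (M ^ 2 * K) * (2 * (ℓ / 2) ^ θ) + C * (M + 1) * ℓ ^ θ := by ring
    _ = (r * M ^ 2 * K + C * (M + 1)) * ℓ ^ θ := by rw [hhalf]; ring
    _ = K * ℓ ^ θ := by rw [hKeq]

/-- Products of an almost multiplicative family are uniformly bounded and stay close to the
family, with constants that depend only on the constants of the family. -/
theorem exists_stepProd_bound (hT : 0 < T) (h1 : ‖(1 : 𝔸)‖ ≤ 1) {a θ C : ℝ} (ha : 0 < a)
    (hθ : 1 < θ) (hC : 0 ≤ C) : ∃ K ≥ 1, ∀ m : Time T → Time T → 𝔸, AlmostMul m a θ C →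
      ∀ (n : ℕ) (c : ℕ → Time T), Monotone c →
        ‖stepProd m c n - m (c 0) (c n)‖ ≤ K * ((c n : ℝ) - c 0) ^ θ ∧
        ‖stepProd m c n‖ ≤ K := by
  obtain ⟨h, hh, K, hK, M, hM, H⟩ :=
    exists_local_stepProd_bound (T := T) h1 ha hθ hC
  -- Boundedness is propagated from length `N h` to `(N + 1) h` by peeling off a first block of
  -- length at most `h` and the one step that crosses its end.
  have bound : ∀ N : ℕ, ∃ B : ℝ, 1 ≤ B ∧ ∀ m : Time T → Time T → 𝔸, AlmostMul m a θ C →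
      ∀ (n : ℕ) (c : ℕ → Time T), Monotone c → (c n : ℝ) - c 0 ≤ N * h →
        ‖stepProd m c n‖ ≤ B := by
    intro N
    induction N with
    | zero =>
      exact ⟨M, hM, fun m hm n c hc hl => (H m hm n c hc (by
        simp only [Nat.cast_zero, zero_mul] at hl; linarith)).2⟩
    | succ N ih =>
      obtain ⟨B, hB, ih⟩ := ih
      have hL : 1 ≤ 1 + C * T ^ a := by
        have : 0 ≤ C * T ^ a := by positivity
        linarith
      refine ⟨B * ((1 + C * T ^ a) * M), ?_, fun m hm n c hc hl => ?_⟩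
      · nlinarith [mul_le_mul hL hM zero_le_one (by linarith : (0:ℝ) ≤ 1 + C * T ^ a)]
      · rcases Nat.eq_zero_or_pos n with hn | hn
        · subst hn
          refine h1.trans ?_
          nlinarith [mul_le_mul hL hM zero_le_one (by linarith : (0:ℝ) ≤ 1 + C * T ^ a)]
        obtain ⟨j, p, hjp, hj1, hj2⟩ := exists_split (c := c) n hn.ne' (x := (c 0 : ℝ) + h)
          (by linarith)
        have hshift : Monotone fun i => c (j + 1 + i) := fun x y hxy => hc (by omega)
        have hA := ih m hm p _ hshift (by
          simp only [← hjp, add_zero]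
          rcases hj2 with h0 | h0
          · have : n = j + 1 := by omega
            rw [← this]; simp; positivity
          · push_cast at hl; linarith)
        have hD := (H m hm j c hc (by linarith)).2
        have hB' := hm.norm_le h1 ha hC (hc (Nat.le_succ j)) (time_sub_le _ _)
        rw [hjp, stepProd_add, stepProd]
        refine (norm_mul_le _ _).trans ?_
        gcongr
        refine (norm_mul_le _ _).trans ?_
        gcongr
  obtain ⟨N, hN⟩ := exists_nat_ge (T / h)
  rw [div_le_iff₀ hh] at hN
  obtain ⟨B, hB, hbound⟩ := bound N
  -- On intervals longer than `h` the closeness estimate is trivial: both terms are bounded and the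
  -- power of the length is at least `h ^ θ`. This quotient is the resulting constant.
  have hx : 0 ≤ (B + (1 + C * T ^ a)) / h ^ θ := by positivity
  refine ⟨K + B + (B + (1 + C * T ^ a)) / h ^ θ, by linarith, fun m hm n c hc => ?_⟩
  have hP := hbound m hm n c hc ((time_sub_le _ _).trans hN)
  have h0 : 0 ≤ (c n : ℝ) - c 0 := time_sub_nonneg (hc (Nat.zero_le n))
  refine ⟨?_, by linarith⟩
  by_cases hl : (c n : ℝ) - c 0 ≤ h
  · refine ((H m hm n c hc hl).1).trans ?_
    gcongr
    linarith
  · push Not at hl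
    have hm' := hm.norm_le h1 ha hC (hc (Nat.zero_le n)) (time_sub_le _ _)
    have hpow : h ^ θ ≤ ((c n : ℝ) - c 0) ^ θ := Real.rpow_le_rpow hh.le hl.le (by linarith)
    have hh' : 0 < h ^ θ := by positivity
    calc ‖stepProd m c n - m (c 0) (c n)‖ ≤ B + (1 + C * T ^ a) :=
          (norm_sub_le _ _).trans (add_le_add hP hm')
      _ = (B + (1 + C * T ^ a)) / h ^ θ * h ^ θ := by field_simp
      _ ≤ (B + (1 + C * T ^ a)) / h ^ θ * ((c n : ℝ) - c 0) ^ θ := by gcongr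
      _ ≤ _ := by gcongr; linarith

/-- The dyadic points `i T / 2 ^ n`, stopped at time `t`. -/
def gridPoint (n : ℕ) (t : Time T) (i : ℕ) : Time T :=
  ⟨min (i * T / 2 ^ n) t, le_min (by have := t.2.1.trans t.2.2; positivity) t.2.1,
    (min_le_right _ _).trans t.2.2⟩

theorem gridPoint_le (n : ℕ) (t : Time T) (i : ℕ) : gridPoint n t i ≤ t :=
  Subtype.coe_le_coe.1 (min_le_right _ _)

theorem monotone_gridPoint (n : ℕ) (t : Time T) : Monotone (gridPoint n t) := fun i j hij => by
  have hT : 0 ≤ T := t.2.1.trans t.2.2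
  refine Subtype.coe_le_coe.1 (min_le_min ?_ le_rfl)
  gcongr

theorem gridPoint_two_mul (n : ℕ) (t : Time T) (i : ℕ) :
    gridPoint (n + 1) t (2 * i) = gridPoint n t i := by
  refine Subtype.ext ?_
  simp only [gridPoint]
  congr 1
  push_cast
  rw [pow_succ]; field_simp

theorem gridPoint_zero (n : ℕ) (t : Time T) : (gridPoint n t 0 : ℝ) = 0 := by
  simp [gridPoint, t.2.1]

theorem gridPoint_last (n : ℕ) (t : Time T) : gridPoint n t (2 ^ n) = t := by
  refine Subtype.ext ?_
  simp [gridPoint, t.2.2]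

theorem gridPoint_sub_le (n : ℕ) (t : Time T) (i : ℕ) :
    (gridPoint n t (i + 1) : ℝ) - gridPoint n t i ≤ T / 2 ^ n := by
  have hT : 0 ≤ T := t.2.1.trans t.2.2
  have h2 : ((i + 1 : ℕ) : ℝ) * T / 2 ^ n = i * T / 2 ^ n + T / 2 ^ n := by push_cast; ring
  have h3 : 0 ≤ T / 2 ^ n := by positivity
  simp only [gridPoint, h2]
  rcases min_cases (i * T / 2 ^ n : ℝ) (t : ℝ) with h | h <;>
  rcases min_cases (i * T / 2 ^ n + T / 2 ^ n : ℝ) (t : ℝ) with h' | h' <;> linarith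

/-- The product of the family `m` along the dyadic points of level `n` of `[0, t]`. -/
def gridProd (m : Time T → Time T → 𝔸) (n : ℕ) (t : Time T) : 𝔸 :=
  stepProd m (gridPoint n t) (2 ^ n)

/-- Coarse steps are replaced by pairs of fine steps one at a time, each at the price of one defect
between two bounded products. The fine product on the left is carried along because the induction
hypothesis has to be applied with the two new fine steps already multiplied in. -/
theorem norm_stepProd_refine_sub_le {m : Time T → Time T → 𝔸} {a θ C B δ : ℝ}
    (hm : AlmostMul m a θ C) (hC : 0 ≤ C) (hθ : 0 ≤ θ)
    (hB : ∀ (n : ℕ) (c : ℕ → Time T), Monotone c → ‖stepProd m c n‖ ≤ B)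
    {c c' : ℕ → Time T} (hc : Monotone c) (hc' : Monotone c') (hcc : ∀ i, c' (2 * i) = c i)
    (hδ : ∀ i, (c (i + 1) : ℝ) - c i ≤ δ) (n q : ℕ) :
    ‖stepProd m (fun i => c' (2 * n + i)) q * (stepProd m c' (2 * n) - stepProd m c n)‖
      ≤ n * (B * (C * δ ^ θ) * B) := by
  induction n generalizing q with
  | zero => simp [stepProd]
  | succ n ih =>
    have e1 : stepProd m c' (2 * (n + 1)) = m (c' (2 * n + 1)) (c' (2 * n + 2)) *
        (m (c' (2 * n)) (c' (2 * n + 1)) * stepProd m c' (2 * n)) := rfl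
    have e2 := stepProd_add m (fun i => c' (2 * n + i)) 2 q
    have e3 : stepProd m (fun i => c' (2 * n + i)) 2 = m (c' (2 * n + 1)) (c' (2 * n + 2)) *
        m (c' (2 * n)) (c' (2 * n + 1)) := by simp [stepProd]
    have e4 : (fun i => c' (2 * n + (2 + i))) = fun i => c' (2 * (n + 1) + i) := by
      funext i; congr 1; ring
    rw [e4, e3] at e2
    have e5 : stepProd m c (n + 1) = m (c' (2 * n)) (c' (2 * n + 2)) * stepProd m c n := by
      rw [stepProd, ← hcc, ← hcc]; rfl
    have hq := ih (2 + q)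
    rw [e2] at hq
    have hL := hB q (fun i => c' (2 * (n + 1) + i)) fun x y hxy => hc' (by omega)
    have hR := hB n c hc
    have hmul := hm.mul (c' (2 * n)) (c' (2 * n + 1)) (c' (2 * n + 2)) (hc' (by omega))
      (hc' (by omega))
    have hd : ((c' (2 * n + 2) : Time T) : ℝ) - c' (2 * n) ≤ δ := by
      have := hδ n
      rw [← hcc, ← hcc] at this; exact this
    have hmul' := hmul.trans (mul_le_mul_of_nonneg_left (Real.rpow_le_rpow
      (time_sub_nonneg (hc' (by omega))) hd hθ) hC)
    have hB0 : 0 ≤ B := (norm_nonneg _).trans hR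
    rw [e1, e5]
    set L := stepProd m (fun i => c' (2 * (n + 1) + i)) q
    set x := m (c' (2 * n + 1)) (c' (2 * n + 2))
    set y := m (c' (2 * n)) (c' (2 * n + 1))
    set z := m (c' (2 * n)) (c' (2 * n + 2))
    set P' := stepProd m c' (2 * n)
    set P := stepProd m c n
    calc ‖L * (x * (y * P') - z * P)‖
        = ‖L * (x * y) * (P' - P) + L * (x * y - z) * P‖ := by congr 1; noncomm_ring
      _ ≤ n * (B * (C * δ ^ θ) * B) + B * (C * δ ^ θ) * B := by
          refine (norm_add_le _ _).trans (add_le_add hq ?_)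
          exact (norm_mul_le _ _).trans (mul_le_mul ((norm_mul_le _ _).trans
            (mul_le_mul hL hmul' (norm_nonneg _) hB0)) hR (norm_nonneg _)
            (mul_nonneg hB0 ((norm_nonneg _).trans hmul')))
      _ = _ := by push_cast; ring

/-- The grid is absolute, so the products up to `s` and up to `t` share all steps before the cell
that contains `s`. Inserting `s` into that cell costs one defect of mesh size, which disappears as
`n → ∞`; the product from `s` to `t` is compared with `m s t` by the uniform bound. -/
theorem norm_gridProd_sub_le {m : Time T → Time T → 𝔸} {a θ C K : ℝ} (hC : 0 ≤ C) (hθ : 0 ≤ θ)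
    (hm : AlmostMul m a θ C) (hK0 : 1 ≤ K)
    (hK : ∀ (n : ℕ) (c : ℕ → Time T), Monotone c →
        ‖stepProd m c n - m (c 0) (c n)‖ ≤ K * ((c n : ℝ) - c 0) ^ θ ∧
        ‖stepProd m c n‖ ≤ K) (n : ℕ) {s t : Time T} (hst : s ≤ t) :
    ‖gridProd m n t - m s t * gridProd m n s‖
      ≤ K * K * ((t : ℝ) - s) ^ θ + K * (C * (T / 2 ^ n) ^ θ) * K := by
  have hT : 0 ≤ T := t.2.1.trans t.2.2
  obtain ⟨s0, hs⟩ : ∃ s0 : Time T, (s0 : ℝ) = 0 := ⟨⟨0, le_rfl, hT⟩, rfl⟩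
  obtain ⟨j, p, hjp, hj1, hj2⟩ := exists_split
    (c := gridPoint n (⟨T, hT, le_rfl⟩ : Time T)) (2 ^ n)
    (by positivity) (x := s) (by rw [gridPoint_zero]; exact s.2.1)
  have hst' : (s : ℝ) ≤ t := hst
  have hTj : ∀ i ≤ 2 ^ n, ((gridPoint n (⟨T, hT, le_rfl⟩ : Time T) i : Time T) : ℝ)
      = i * T / 2 ^ n := fun i hi => by
    simp only [gridPoint]
    refine min_eq_left ?_
    rw [div_le_iff₀ (by positivity), mul_comm]
    have : (i : ℝ) ≤ 2 ^ n := by exact_mod_cast hi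
    gcongr
  rw [hTj j (by omega)] at hj1
  have hcs : ∀ i, j + 1 ≤ i → gridPoint n s i = s := fun i hi => by
    refine Subtype.ext (min_eq_right ?_)
    have h2 : (s : ℝ) ≤ ((j + 1 : ℕ) : ℝ) * T / 2 ^ n := by
      rcases hj2 with h | h
      · have : ((j + 1 : ℕ) : ℝ) = 2 ^ n := by
          have : j + 1 = 2 ^ n := by omega
          rw [this]; push_cast; rfl
        rw [this]; simpa using s.2.2
      · rw [hTj _ (by omega)] at h; exact h.le
    refine h2.trans ?_
    gcongr
  have hcst : ∀ i ≤ j, gridPoint n s i = gridPoint n t i := fun i hi => by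
    have : (i * T / 2 ^ n : ℝ) ≤ s := le_trans (by gcongr) hj1
    refine Subtype.ext ?_
    simp only [gridPoint]
    rw [min_eq_left this, min_eq_left (this.trans hst')]
  -- Beyond the cell of `s` the stopped grid stays at `s`, and these repeated points contribute
  -- factors `m s s = 1`.
  have hPs : gridProd m n s = m (gridPoint n s j) s * stepProd m (gridPoint n s) j := by
    rw [gridProd]
    conv_lhs => rw [hjp, stepProd_add]
    have : (fun i => gridPoint n s (j + 1 + i)) = fun _ => s := by
      funext i; exact hcs _ (by omega)
    rw [this, stepProd_const hm.refl, one_mul, stepProd, hcs _ le_rfl]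
  have hPt : gridProd m n t = stepProd m (fun i => gridPoint n t (j + 1 + i)) p *
      (m (gridPoint n s j) (gridPoint n t (j + 1)) * stepProd m (gridPoint n s) j) := by
    rw [gridProd]
    conv_lhs => rw [hjp, stepProd_add, stepProd]
    rw [stepProd_congr m hcst, hcst j le_rfl]
  have hst1 : s ≤ gridPoint n t (j + 1) := by
    refine Subtype.coe_le_coe.1 ?_
    have h := congrArg (Subtype.val) (hcs (j + 1) le_rfl)
    simp only [gridPoint] at h ⊢
    exact le_min (min_eq_right_iff.1 h) hst'
  have hmono : Monotone (fun i => gridPoint n t (j + 1 + i)) := fun x y hxy =>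
    monotone_gridPoint n t (by omega)
  set A := stepProd m (fun i => gridPoint n t (j + 1 + i)) p with hA
  -- The grid of `t` after `s`, with `s` itself prepended.
  set e : ℕ → Time T := fun i => Nat.casesOn i s (fun i => gridPoint n t (j + 1 + i)) with he
  have hemono : Monotone e := monotone_nat_of_le_succ fun i => by
    cases i with
    | zero => exact hst1
    | succ i => exact hmono (Nat.le_succ i)
  have heA : stepProd m e (1 + p) = A * m s (gridPoint n t (j + 1)) := by
    rw [stepProd_add, stepProd, stepProd, mul_one, hA]
    congr 1
    have : (fun i => e (1 + i)) = fun i => gridPoint n t (j + 1 + i) := by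
      funext i; rw [add_comm]
    rw [this]
  have hee : e (1 + p) = t := by
    rw [add_comm]
    change gridPoint n t (j + 1 + p) = t
    rw [← hjp, gridPoint_last]
  have hQ := (hK (1 + p) e hemono).1
  rw [heA, hee, show e 0 = s from rfl] at hQ
  have hAK := (hK p _ hmono).2
  have hDK := (hK j _ (monotone_gridPoint n s)).2
  have hPK := (hK (2 ^ n) _ (monotone_gridPoint n s)).2
  have hgs : gridPoint n s j ≤ s := gridPoint_le _ _ _
  have hmul := hm.mul _ _ _ hgs hst1
  have hlen : ((gridPoint n t (j + 1) : Time T) : ℝ) - gridPoint n s j ≤ T / 2 ^ n := by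
    rw [hcst j le_rfl]; exact gridPoint_sub_le _ _ _
  have hmul' := hmul.trans (mul_le_mul_of_nonneg_left (Real.rpow_le_rpow
      (time_sub_nonneg (hgs.trans hst1)) hlen hθ) hC)
  change ‖gridProd m n s‖ ≤ K at hPK
  have hK00 : 0 ≤ K := by linarith
  have h0 : 0 ≤ (t : ℝ) - s := time_sub_nonneg hst
  calc ‖gridProd m n t - m s t * gridProd m n s‖
      = ‖(A * m s (gridPoint n t (j + 1)) - m s t) * gridProd m n s
          - A * (m s (gridPoint n t (j + 1)) * m (gridPoint n s j) s
            - m (gridPoint n s j) (gridPoint n t (j + 1))) * stepProd m (gridPoint n s) j‖ := by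
        rw [hPt]; congr 1
        rw [hPs]; noncomm_ring
    _ ≤ K * ((t : ℝ) - s) ^ θ * K + K * (C * (T / 2 ^ n) ^ θ) * K := by
        refine (norm_sub_le _ _).trans (add_le_add ?_ ?_)
        · refine (norm_mul_le _ _).trans ?_
          gcongr
        · refine (norm_mul_le _ _).trans ?_
          gcongr
          refine (norm_mul_le _ _).trans ?_
          gcongr
    _ = _ := by ring

/-- Multiplicative sewing: a uniformly almost multiplicative family has, for every parameter, a
multiplicative primitive. -/
theorem exists_multiplicative_primitive [CompleteSpace 𝔸] (hT : 0 < T) (h1 : ‖(1 : 𝔸)‖ ≤ 1)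
    {ι : Type*} {a θ C : ℝ} (ha : 0 < a) (hθ : 1 < θ) (hC : 0 ≤ C)
    (m : ι → Time T → Time T → 𝔸) (hm : ∀ w, AlmostMul (m w) a θ C) :
    ∃ (U : ι → Time T → 𝔸) (K : ℝ), 0 ≤ K ∧
      (∀ w t, Tendsto (fun n => gridProd (m w) n t) atTop (𝓝 (U w t))) ∧
      (∀ w (t : Time T), (t : ℝ) = 0 → U w t = 1) ∧ (∀ w t, ‖U w t‖ ≤ K) ∧
      ∀ w s t, s ≤ t → ‖U w t - m w s t * U w s‖ ≤ K * ((t : ℝ) - s) ^ θ := by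
  obtain ⟨K, hK1, hK⟩ := exists_stepProd_bound (𝔸 := 𝔸) hT h1 ha hθ hC
  have hθ0 : 0 ≤ θ := by linarith
  have hr1 : (2 : ℝ) ^ (1 - θ) < 1 :=
    Real.rpow_lt_one_of_one_lt_of_neg one_lt_two (by linarith)
  have hcauchy : ∀ w t, CauchySeq (fun n => gridProd (m w) n t) := fun w t => by
    -- Passing to the next level replaces `2 ^ n` steps, each with a defect of order `(T / 2 ^ n) ^
    -- θ`, so the ratio is `2 ^ (1 - θ) < 1`.
    refine cauchySeq_of_le_geometric ((2 : ℝ) ^ (1 - θ)) (K * (C * T ^ θ) * K) hr1 fun n => ?_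
    have := norm_stepProd_refine_sub_le (hm w) hC hθ0 (fun n c hc => (hK _ (hm w) n c hc).2)
      (monotone_gridPoint n t) (monotone_gridPoint (n + 1) t) (gridPoint_two_mul n t)
      (gridPoint_sub_le n t) (2 ^ n) 0
    rw [stepProd, one_mul] at this
    rw [dist_comm, dist_eq_norm, gridProd, gridProd, pow_succ, mul_comm (2 ^ n)]
    refine this.trans (le_of_eq ?_)
    rw [Real.div_rpow hT.le (by positivity), ← Real.rpow_natCast 2 n, ← Real.rpow_mul two_pos.le,
      ← Real.rpow_natCast _ n, ← Real.rpow_mul two_pos.le, sub_mul, one_mul,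
      Real.rpow_sub two_pos, mul_comm θ]
    push_cast
    rw [Real.rpow_natCast]
    ring
  choose U hU using fun w t => cauchySeq_tendsto_of_complete (hcauchy w t)
  refine ⟨U, K * K, by positivity, hU, fun w t ht => ?_, fun w t => ?_, fun w s t hst => ?_⟩
  · have : ∀ n, gridProd (m w) n t = 1 := fun n => by
      have h2 : ∀ i, gridPoint n t i = t := fun i => by
        refine Subtype.ext (min_eq_right ?_)
        rw [ht]; positivity
      rw [gridProd, show gridPoint n t = fun _ => t from funext h2, stepProd_const (hm w).refl]
    refine tendsto_nhds_unique (hU w t) ?_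
    simp only [this]; exact tendsto_const_nhds
  · refine le_of_tendsto (hU w t).norm (Eventually.of_forall fun n => ?_)
    exact ((hK _ (hm w) _ _ (monotone_gridPoint n t)).2).trans (by nlinarith)
  · have hlim : Tendsto (fun n : ℕ => K * K * ((t : ℝ) - s) ^ θ + K * (C * (T / 2 ^ n) ^ θ) * K)
        atTop (𝓝 (K * K * ((t : ℝ) - s) ^ θ + K * (C * 0 ^ θ) * K)) := by
      have h0 : Tendsto (fun n : ℕ => T / (2 : ℝ) ^ n) atTop (𝓝 0) :=
        Tendsto.div_atTop tendsto_const_nhds (tendsto_pow_atTop_atTop_of_one_lt one_lt_two)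
      have := h0.rpow_const (p := θ) (Or.inr hθ0)
      exact tendsto_const_nhds.add (((this.const_mul C).const_mul K).mul_const K)
    rw [Real.zero_rpow (by linarith), mul_zero, mul_zero, zero_mul, add_zero] at hlim
    exact le_of_tendsto_of_tendsto ((hU w t).sub ((hU w s).const_mul (m w s t))).norm hlim
      (Eventually.of_forall fun n =>
        norm_gridProd_sub_le hC hθ0 (hm w) hK1 (fun n c hc => hK _ (hm w) n c hc) n hst)

end MultiplicativeSewing

/-! ### A calculus of uniform bounds by powers of the interval length. -/

section Order

variable {J X Y Z : Type*} [NormedAddCommGroup X] [NormedAddCommGroup Y] [NormedAddCommGroup Z]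
  {S : Set J} {h : J → ℝ} {T : ℝ}

/-- `f` is of order `h ^ κ`, uniformly on `S`. -/
abbrev Ord (S : Set J) (h : J → ℝ) (κ : ℝ) (f : J → X) : Prop :=
  f =O[𝓟 S] fun x => h x ^ κ

theorem ord_of_le {κ C : ℝ} {f : J → X} (hf : ∀ x ∈ S, ‖f x‖ ≤ C * h x ^ κ) : Ord S h κ f :=
  Asymptotics.isBigO_principal.2 ⟨|C|, fun x hx => (hf x hx).trans <| by
    rw [Real.norm_eq_abs, ← abs_mul]; exact le_abs_self _⟩

theorem Ord.exists_bound {κ : ℝ} {f : J → X} (hh : ∀ x ∈ S, 0 ≤ h x) (hf : Ord S h κ f) :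
    ∃ C : ℝ, 0 ≤ C ∧ ∀ x ∈ S, ‖f x‖ ≤ C * h x ^ κ := by
  obtain ⟨C, hC⟩ := Asymptotics.isBigO_principal.1 hf
  refine ⟨|C|, abs_nonneg C, fun x hx => (hC x hx).trans ?_⟩
  rw [Real.norm_of_nonneg (Real.rpow_nonneg (hh x hx) _)]
  exact mul_le_mul_of_nonneg_right (le_abs_self C) (Real.rpow_nonneg (hh x hx) _)

theorem rpow_le_const_mul_rpow {x T a b : ℝ} (hx : 0 ≤ x) (hxT : x ≤ T) (ha : 0 ≤ a)
    (hab : a ≤ b) : x ^ b ≤ T ^ (b - a) * x ^ a := by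
  have : x ^ b = x ^ (b - a) * x ^ a := by
    rw [← Real.rpow_add_of_nonneg hx (by linarith) ha]; congr 1; ring
  rw [this]
  have := Real.rpow_le_rpow hx hxT (sub_nonneg.2 hab)
  gcongr

theorem Ord.mono {a b : ℝ} {f : J → X} (hh : ∀ x ∈ S, 0 ≤ h x ∧ h x ≤ T) (hf : Ord S h b f)
    (ha : 0 ≤ a) (hab : a ≤ b) : Ord S h a f :=
  hf.trans <| ord_of_le (C := T ^ (b - a)) fun x hx => by
    rw [Real.norm_of_nonneg (Real.rpow_nonneg (hh x hx).1 _)]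
    exact rpow_le_const_mul_rpow (hh x hx).1 (hh x hx).2 ha hab

/-- Orders add under any bounded pairing, and surplus exponent may be dropped because lengths are at
most `T`. All exponent bookkeeping below reduces to this. -/
theorem Ord.of_le_mul {a b κ C : ℝ} {f : J → X} {g : J → Y} {p : J → Z}
    (hf : Ord S h a f) (hg : Ord S h b g)
    (hh : ∀ x ∈ S, 0 ≤ h x ∧ h x ≤ T)
    (hp : ∀ x ∈ S, ‖p x‖ ≤ C * (‖f x‖ * ‖g x‖)) (ha : 0 ≤ a) (hb : 0 ≤ b) (hκ : 0 ≤ κ)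
    (hab : κ ≤ a + b) : Ord S h κ p := by
  have h1 : Ord S h (a + b) (fun x => ‖f x‖ * ‖g x‖) := by
    refine (hf.norm_left.mul hg.norm_left).trans (ord_of_le (C := 1) fun x hx => ?_)
    rw [Real.rpow_add_of_nonneg (hh x hx).1 ha hb, one_mul, Real.norm_of_nonneg]
    have := (hh x hx).1
    positivity
  refine Ord.mono hh (Asymptotics.IsBigO.trans ?_ h1) hκ hab
  exact Asymptotics.isBigO_principal.2 ⟨C, fun x hx => (hp x hx).trans (le_of_eq (by simp))⟩

theorem Ord.const_zero (f : J → X) {C : ℝ} (hC : ∀ x ∈ S, ‖f x‖ ≤ C) : Ord S h 0 f :=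
  ord_of_le (C := C) fun x hx => by simpa using hC x hx

end Order

section OrdRing

variable {J 𝔸 : Type*} [NormedRing 𝔸] {S : Set J} {h : J → ℝ} {T : ℝ}

theorem Ord.mul {a b κ : ℝ} {f g : J → 𝔸} (hf : Ord S h a f) (hg : Ord S h b g)
    (hh : ∀ x ∈ S, 0 ≤ h x ∧ h x ≤ T) (ha : 0 ≤ a) (hb : 0 ≤ b) (hκ : 0 ≤ κ)
    (hab : κ ≤ a + b) : Ord S h κ (fun x => f x * g x) :=
  hf.of_le_mul (C := 1) hg hh (fun x _ => by rw [one_mul]; exact norm_mul_le _ _) ha hb hκ hab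

end OrdRing

/-! ### Bounds on triples `s ≤ u ≤ t`, uniform in the random parameter. -/

section Triples

variable {T : ℝ} {ι : Type*}

/-- The triples `s ≤ u ≤ t` of times. -/
def triples (ι : Type*) (T : ℝ) : Set (ι × Time T × Time T × Time T) :=
  {x | x.2.1 ≤ x.2.2.1 ∧ x.2.2.1 ≤ x.2.2.2}

/-- The length `t - s` of the triple `s ≤ u ≤ t`. -/
def span (x : ι × Time T × Time T × Time T) : ℝ := (x.2.2.2 : ℝ) - x.2.1

theorem span_mem : ∀ x ∈ triples ι T, 0 ≤ span x ∧ span x ≤ T := fun _ hx =>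
  ⟨time_sub_nonneg (hx.1.trans hx.2), time_sub_le _ _⟩

variable {X : Type*} [NormedAddCommGroup X] {κ C : ℝ} {f : ι → Time T → Time T → X}

theorem ord_left (hC : 0 ≤ C) (hκ : 0 ≤ κ)
    (hf : ∀ w s t, s ≤ t → ‖f w s t‖ ≤ C * ((t : ℝ) - s) ^ κ) :
    Ord (triples ι T) span κ (fun x => f x.1 x.2.1 x.2.2.1) :=
  ord_of_le fun _ hx => (hf _ _ _ hx.1).trans <| mul_le_mul_of_nonneg_left
    (Real.rpow_le_rpow (time_sub_nonneg hx.1)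
      (sub_le_sub_right (Subtype.coe_le_coe.2 hx.2) _) hκ) hC

theorem ord_right (hC : 0 ≤ C) (hκ : 0 ≤ κ)
    (hf : ∀ w s t, s ≤ t → ‖f w s t‖ ≤ C * ((t : ℝ) - s) ^ κ) :
    Ord (triples ι T) span κ (fun x => f x.1 x.2.2.1 x.2.2.2) :=
  ord_of_le fun _ hx => (hf _ _ _ hx.2).trans <| mul_le_mul_of_nonneg_left
    (Real.rpow_le_rpow (time_sub_nonneg hx.2)
      (sub_le_sub_left (Subtype.coe_le_coe.2 hx.1) _) hκ) hC

theorem ord_outer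
    (hf : ∀ w s t, s ≤ t → ‖f w s t‖ ≤ C * ((t : ℝ) - s) ^ κ) :
    Ord (triples ι T) span κ (fun x => f x.1 x.2.1 x.2.2.2) :=
  ord_of_le fun _ hx => hf _ _ _ (hx.1.trans hx.2)

theorem exists_bound_of_ord_outer (hf : Ord (triples ι T) span κ (fun x => f x.1 x.2.1 x.2.2.2)) :
    ∃ C : ℝ, 0 ≤ C ∧ ∀ w s t, s ≤ t → ‖f w s t‖ ≤ C * ((t : ℝ) - s) ^ κ := by
  obtain ⟨C, hC, h⟩ := hf.exists_bound fun x hx => (span_mem x hx).1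
  exact ⟨C, hC, fun w s t hst => h (w, s, s, t) ⟨le_rfl, hst⟩⟩

end Triples

/-! ### Approximate inverses of an almost multiplicative family. -/

section Inverse

variable {T : ℝ} {𝔸 : Type*} [NormedRing 𝔸] {ι : Type*}

/-- A polynomial approximation of the inverse of `x` near `1`. -/
def approxInv (x : 𝔸) : 𝔸 := 1 - (x - 1) + (x - 1) * (x - 1)

/-- A Neumann series cut after the quadratic term leaves exactly a cube, of order `3a ≥ θ`. Cutting
after the linear term would leave order `2a`, which is too large in the application since `2α < 1 <
θ`. -/
theorem approxInv_mul (x : 𝔸) : approxInv x * x = 1 + (x - 1) * (x - 1) * (x - 1) := by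
  rw [approxInv]; noncomm_ring

theorem mul_approxInv (x : 𝔸) : x * approxInv x = 1 + (x - 1) * (x - 1) * (x - 1) := by
  rw [approxInv]; noncomm_ring

/-- Algebraic form of the fact that inverses multiply in reverse order: every term contains either a
cube or the defect `b * a - c`, so each has order `θ`. -/
theorem approxInv_mul_sub (a b c : 𝔸) : approxInv a * approxInv b - approxInv c
    = (a - 1) * (a - 1) * (a - 1) * approxInv c
      + approxInv a * ((b - 1) * (b - 1) * (b - 1)) * (a * approxInv c)
      - approxInv a * approxInv b * ((b * a - c) * approxInv c)
      - approxInv a * approxInv b * ((c - 1) * (c - 1) * (c - 1)) := by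
  have h1 : (a - 1) * (a - 1) * (a - 1) = approxInv a * a - 1 := by rw [approxInv_mul]; abel
  have h2 : (b - 1) * (b - 1) * (b - 1) = approxInv b * b - 1 := by rw [approxInv_mul]; abel
  have h3 : (c - 1) * (c - 1) * (c - 1) = c * approxInv c - 1 := by rw [mul_approxInv]; abel
  rw [h1, h2, h3]
  noncomm_ring

/-- The approximate inverses of an almost multiplicative family are almost multiplicative in the
opposite ring. -/
theorem exists_almostMul_op_approxInv {a θ C : ℝ} (ha : 0 ≤ a) (hθ : 0 ≤ θ) (hθa : θ ≤ 3 * a)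
    (hC : 0 ≤ C) (h1 : ‖(1 : 𝔸)‖ ≤ 1)
    (m : ι → Time T → Time T → 𝔸) (hm : ∀ w, AlmostMul (m w) a θ C) :
    ∃ C' : ℝ, 0 ≤ C' ∧
      ∀ w, AlmostMul (fun s t => MulOpposite.op (approxInv (m w s t))) a θ C' := by
  have hsmall : ∀ w s t, s ≤ t → ‖m w s t - 1‖ ≤ C * ((t : ℝ) - s) ^ a :=
    fun w => (hm w).small
  have hh := span_mem (ι := ι) (T := T)
  have hone : Ord (triples ι T) span 0 (fun _ => (1 : 𝔸)) := Ord.const_zero _ fun _ _ => h1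
  have cube : ∀ {x : ι × Time T × Time T × Time T → 𝔸}, Ord (triples ι T) span a x →
      Ord (triples ι T) span θ (fun y => x y * x y * x y) := fun hx =>
    (hx.mul hx hh ha ha (κ := 2 * a) (by linarith) (by linarith)).mul hx hh (by linarith) ha hθ
      (by linarith)
  have inv : ∀ {x : ι × Time T × Time T × Time T → 𝔸}, Ord (triples ι T) span a (fun y => x y - 1) →
      Ord (triples ι T) span 0 (fun y => approxInv (x y)) := fun hx =>
    (hone.sub (hx.mono hh le_rfl ha)).add (hx.mul hx hh ha ha le_rfl (by linarith))
  have oL := ord_left (f := fun w s t => m w s t - 1) hC ha hsmall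
  have oR := ord_right (f := fun w s t => m w s t - 1) hC ha hsmall
  have oO := ord_outer (f := fun w s t => m w s t - 1) hsmall
  have oM : Ord (triples ι T) span θ (fun x =>
      m x.1 x.2.2.1 x.2.2.2 * m x.1 x.2.1 x.2.2.1 - m x.1 x.2.1 x.2.2.2) :=
    ord_of_le fun x hx => (hm x.1).mul _ _ _ hx.1 hx.2
  have oLm : Ord (triples ι T) span 0 (fun x => m x.1 x.2.1 x.2.2.1) := by
    exact ((oL.mono hh le_rfl ha).add hone).congr_left fun x => sub_add_cancel _ _
  have mul0 : ∀ {κ : ℝ} {x y : ι × Time T × Time T × Time T → 𝔸}, 0 ≤ κ →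
      Ord (triples ι T) span κ x → Ord (triples ι T) span 0 y →
      Ord (triples ι T) span κ (fun z => x z * y z) := fun hκ hx hy =>
    hx.mul hy hh hκ le_rfl hκ (by linarith)
  have mul0' : ∀ {κ : ℝ} {x y : ι × Time T × Time T × Time T → 𝔸}, 0 ≤ κ →
      Ord (triples ι T) span 0 x → Ord (triples ι T) span κ y →
      Ord (triples ι T) span κ (fun z => x z * y z) := fun hκ hx hy =>
    hx.mul hy hh le_rfl hκ hκ (by linarith)
  have key : Ord (triples ι T) span θ (fun x => approxInv (m x.1 x.2.1 x.2.2.1) *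
      approxInv (m x.1 x.2.2.1 x.2.2.2) - approxInv (m x.1 x.2.1 x.2.2.2)) := by
    simp only [approxInv_mul_sub]
    refine (((mul0 hθ (cube oL) (inv oO)).add (mul0 hθ (mul0' hθ (inv oL) (cube oR))
      (mul0 le_rfl oLm (inv oO)))).sub (mul0' hθ (mul0 le_rfl (inv oL) (inv oR))
      (mul0 hθ oM (inv oO)))).sub (mul0' hθ (mul0 le_rfl (inv oL) (inv oR)) (cube oO))
  have ksmall : Ord (triples ι T) span a (fun x => approxInv (m x.1 x.2.1 x.2.2.2) - 1) := by
    have : Ord (triples ι T) span a (fun x => -(m x.1 x.2.1 x.2.2.2 - 1) +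
        (m x.1 x.2.1 x.2.2.2 - 1) * (m x.1 x.2.1 x.2.2.2 - 1)) :=
      oO.neg_left.add (oO.mul oO hh ha ha ha (by linarith))
    refine this.congr_left fun x => ?_
    rw [approxInv]; abel
  obtain ⟨C1, hC1, H1⟩ := key.exists_bound fun x hx => (hh x hx).1
  obtain ⟨C2, hC2, H2⟩ := exists_bound_of_ord_outer
    (f := fun w s t => approxInv (m w s t) - 1) ksmall
  refine ⟨C1 + C2, by positivity, fun w => ⟨fun s => ?_, fun s t hst => ?_,
    fun s u t hsu hut => ?_⟩⟩
  · simp [approxInv, (hm w).refl]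
  · rw [← MulOpposite.op_one, ← MulOpposite.op_sub, MulOpposite.norm_op]
    have := H2 w s t hst
    have h0 := Real.rpow_nonneg (time_sub_nonneg hst) a
    nlinarith
  · rw [← MulOpposite.op_mul, ← MulOpposite.op_sub, MulOpposite.norm_op]
    have := H1 (w, s, u, t) ⟨hsu, hut⟩
    have h0 := Real.rpow_nonneg (time_sub_nonneg (hsu.trans hut)) θ
    simp only [span] at this
    nlinarith

end Inverse

/-! ### The germ of the rough integral and Chen's relation. -/

section Germ

variable {α T : ℝ} {d : ℕ} {V : Type*} [NormedAddCommGroup V] [NormedSpace ℝ V]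

/-- The contraction of a bilinear map with the second level of a rough path. -/
def contract (η : RoughPath α T d) (s t : Time T)
    (z : EuclideanSpace ℝ (Fin d) →L[ℝ] EuclideanSpace ℝ (Fin d) →L[ℝ] V) : V :=
  ∑ i, ∑ j, η.level2 s t i j • z (EuclideanSpace.single i (1 : ℝ))
    (EuclideanSpace.single j (1 : ℝ))

theorem contract_sub (η : RoughPath α T d) (s t : Time T)
    (z z' : EuclideanSpace ℝ (Fin d) →L[ℝ] EuclideanSpace ℝ (Fin d) →L[ℝ] V) :
    contract η s t (z - z') = contract η s t z - contract η s t z' := by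
  simp [contract, smul_sub, Finset.sum_sub_distrib]

theorem bilin_eq_sum (z : EuclideanSpace ℝ (Fin d) →L[ℝ] EuclideanSpace ℝ (Fin d) →L[ℝ] V)
    (x y : EuclideanSpace ℝ (Fin d)) : z x y = ∑ i, ∑ j, (x i * y j) •
      z (EuclideanSpace.single i (1 : ℝ)) (EuclideanSpace.single j (1 : ℝ)) := by
  have hx : ∀ x : EuclideanSpace ℝ (Fin d),
      x = ∑ i, x i • EuclideanSpace.single i (1 : ℝ) := fun x => by
    ext i; simp [Finset.sum_apply, Pi.single_apply]
  conv_lhs => rw [hx x, hx y]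
  simp only [map_sum, map_smul, sum_apply, smul_apply, Finset.smul_sum, smul_smul]
  rw [Finset.sum_comm]
  exact Finset.sum_congr rfl fun i _ => Finset.sum_congr rfl fun j _ => by rw [mul_comm]

/-- The cross term is what turns the increment of a controlled integrand into its remainder in the
additivity defect of the germ. -/
theorem contract_chen (η : RoughPath α T d) {s u t : Time T} (hsu : s ≤ u) (hut : u ≤ t)
    (z : EuclideanSpace ℝ (Fin d) →L[ℝ] EuclideanSpace ℝ (Fin d) →L[ℝ] V) :
    contract η s t z = contract η s u z + contract η u t z
      + z (η.path u - η.path s) (η.path t - η.path u) := by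
  rw [bilin_eq_sum z, contract, contract, contract]
  simp only [← Finset.sum_add_distrib, ← add_smul]
  refine Finset.sum_congr rfl fun i _ => Finset.sum_congr rfl fun j _ => ?_
  rw [← η.chen s u t hsu hut i j]
  congr 1; ring

theorem exists_contract_bound (η : RoughPath α T d) : ∃ C : ℝ, 0 ≤ C ∧ ∀ s t, s ≤ t →
    ∀ z : EuclideanSpace ℝ (Fin d) →L[ℝ] EuclideanSpace ℝ (Fin d) →L[ℝ] V,
      ‖contract η s t z‖ ≤ C * ((t : ℝ) - s) ^ (2 * α) * ‖z‖ := by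
  obtain ⟨C, hC⟩ := η.holder_level2
  refine ⟨d * d * |C|, by positivity, fun s t hst z => ?_⟩
  have hterm : ∀ i j, ‖η.level2 s t i j • z (EuclideanSpace.single i (1 : ℝ))
      (EuclideanSpace.single j (1 : ℝ))‖ ≤ |C| * ((t : ℝ) - s) ^ (2 * α) * ‖z‖ := fun i j => by
    rw [norm_smul]
    have h1 := z.le_opNorm₂ (EuclideanSpace.single i (1 : ℝ)) (EuclideanSpace.single j (1 : ℝ))
    simp only [PiLp.norm_single, norm_one, mul_one] at h1
    have h2 := hC s t hst i j
    have h0 := Real.rpow_nonneg (time_sub_nonneg hst) (2 * α)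
    refine mul_le_mul (h2.trans ?_) h1 (norm_nonneg _) (by positivity)
    exact mul_le_mul_of_nonneg_right (le_abs_self C) h0
  refine (norm_sum_le_of_le _ fun i _ => norm_sum_le_of_le _ fun j _ => hterm i j).trans ?_
  simp only [Finset.sum_const, Finset.card_univ, Fintype.card_fin, nsmul_eq_mul]
  exact le_of_eq (by ring)

/-- The Hölder bound of the second level at `s = t` forces it to vanish on the diagonal; this makes
a flow step over an empty interval the identity. -/
theorem contract_self (η : RoughPath α T d) (hα : 0 < α) (s : Time T)
    (z : EuclideanSpace ℝ (Fin d) →L[ℝ] EuclideanSpace ℝ (Fin d) →L[ℝ] V) :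
    contract η s s z = 0 := by
  obtain ⟨C, -, h⟩ := exists_contract_bound (V := V) η
  have := h s s le_rfl z
  rw [sub_self, Real.zero_rpow (by positivity), mul_zero, zero_mul] at this
  exact norm_le_zero_iff.1 this

theorem exists_path_bound (η : RoughPath α T d) : ∃ C : ℝ, 0 ≤ C ∧ ∀ s t, s ≤ t →
    ‖η.path t - η.path s‖ ≤ C * ((t : ℝ) - s) ^ α := by
  obtain ⟨C, hC⟩ := η.holder_path
  refine ⟨|C|, abs_nonneg C, fun s t hst => (hC s t hst).trans ?_⟩
  exact mul_le_mul_of_nonneg_right (le_abs_self C) (Real.rpow_nonneg (time_sub_nonneg hst) _)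

variable {Ω : Type*}

theorem germ_eq (η : RoughPath α T d) (Z : Time T → Ω → (EuclideanSpace ℝ (Fin d) →L[ℝ] V))
    (Z' : Time T → Ω →
      (EuclideanSpace ℝ (Fin d) →L[ℝ] EuclideanSpace ℝ (Fin d) →L[ℝ] V)) (s t : Time T) (ω : Ω) :
    germ η Z Z' s t ω = Z s ω (η.path t - η.path s) + contract η s t (Z' s ω) := rfl

/-- The defect of additivity of the germ of a controlled path. -/
theorem germ_defect (η : RoughPath α T d)
    (Z : Time T → Ω → (EuclideanSpace ℝ (Fin d) →L[ℝ] V))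
    (Z' : Time T → Ω →
      (EuclideanSpace ℝ (Fin d) →L[ℝ] EuclideanSpace ℝ (Fin d) →L[ℝ] V))
    {s u t : Time T} (hsu : s ≤ u) (hut : u ≤ t) (ω : Ω) :
    germ η Z Z' s u ω + germ η Z Z' u t ω - germ η Z Z' s t ω
      = remainder η Z Z' s u ω (η.path t - η.path u)
        + contract η u t (Z' u ω - Z' s ω) := by
  rw [germ_eq, germ_eq, germ_eq, contract_chen η hsu hut, contract_sub, remainder]
  simp only [sub_apply, map_sub]
  abel

end Germ

/-! ### Sums of powers of partition steps. -/

section PartitionSums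

variable {T : ℝ} {X : Type*} [NormedAddCommGroup X]

/-- A sum of powers larger than one of the steps of a partition is small with its mesh. -/
theorem sum_rpow_le {c : ℕ → Time T} {n : ℕ} (hc : ∀ i < n, c i ≤ c (i + 1)) {δ θ : ℝ}
    (hθ : 1 ≤ θ) (hδ : ∀ i < n, (c (i + 1) : ℝ) - c i ≤ δ) (hδ0 : 0 ≤ δ) :
    ∑ i ∈ Finset.range n, ((c (i + 1) : ℝ) - c i) ^ θ ≤ T * δ ^ (θ - 1) := by
  have h1 : ∀ i ∈ Finset.range n, ((c (i + 1) : ℝ) - c i) ^ θ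
      ≤ ((c (i + 1) : ℝ) - c i) * δ ^ (θ - 1) := fun i hi => by
    have hi := Finset.mem_range.1 hi
    have h0 := time_sub_nonneg (hc i hi)
    have : ((c (i + 1) : ℝ) - c i) ^ θ
        = ((c (i + 1) : ℝ) - c i) * ((c (i + 1) : ℝ) - c i) ^ (θ - 1) := by
      conv_lhs => rw [show θ = 1 + (θ - 1) by ring, Real.rpow_add_of_nonneg h0 zero_le_one
        (by linarith), Real.rpow_one]
    rw [this]
    exact mul_le_mul_of_nonneg_left (Real.rpow_le_rpow h0 (hδ i hi) (by linarith)) h0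
  refine (Finset.sum_le_sum h1).trans ?_
  rw [← Finset.sum_mul, Finset.sum_range_sub (fun i => (c i : ℝ))]
  exact mul_le_mul_of_nonneg_right (time_sub_le _ _) (by positivity)

theorem tendsto_mesh_rpow (T : ℝ) {a : ℝ} (ha : 0 < a) :
    Tendsto (fun n : ℕ => (T / 2 ^ n) ^ a) atTop (𝓝 0) := by
  have h0 : Tendsto (fun n : ℕ => T / (2 : ℝ) ^ n) atTop (𝓝 0) :=
    Tendsto.div_atTop tendsto_const_nhds (tendsto_pow_atTop_atTop_of_one_lt one_lt_two)
  have := h0.rpow_const (p := a) (Or.inr ha.le)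
  rwa [Real.zero_rpow ha.ne'] at this

/-- A path whose increments have order above one is constant: over `2 ^ n` steps the increments add
up to at most a multiple of the mesh to the power `θ - 1`. -/
theorem eq_zero_of_sub_le_rpow {f : Time T → X} {C θ : ℝ} (hC : 0 ≤ C) (hθ : 1 < θ)
    (hf : ∀ s t : Time T, s ≤ t → ‖f t - f s‖ ≤ C * ((t : ℝ) - s) ^ θ) {s t : Time T}
    (hs : (s : ℝ) = 0) : f t = f s := by
  have hT : 0 ≤ T := t.2.1.trans t.2.2
  have hbound : ∀ n : ℕ, ‖f t - f s‖ ≤ C * (T * (T / 2 ^ n) ^ (θ - 1)) := fun n => by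
    have h0 : gridPoint n t 0 = s := Subtype.ext (by rw [gridPoint_zero, hs])
    have h1 := Finset.sum_range_sub (fun i => f (gridPoint n t i)) (2 ^ n)
    rw [gridPoint_last, h0] at h1
    rw [← h1]
    refine (norm_sum_le_of_le _ fun i _ => hf _ _ (monotone_gridPoint n t i.le_succ)).trans ?_
    rw [← Finset.mul_sum]
    exact mul_le_mul_of_nonneg_left (sum_rpow_le (fun i _ => monotone_gridPoint n t i.le_succ)
      hθ.le (fun i _ => gridPoint_sub_le n t i) (by positivity)) hC
  have hlim : Tendsto (fun n : ℕ => C * (T * (T / 2 ^ n) ^ (θ - 1))) atTop (𝓝 0) := by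
    simpa using ((tendsto_mesh_rpow T (sub_pos.2 hθ)).const_mul T).const_mul C
  have := ge_of_tendsto' hlim hbound
  exact sub_eq_zero.1 (norm_le_zero_iff.1 this)

end PartitionSums

/-! ### One-step operators of the linear rough equation. -/

section Flow

variable {α T : ℝ} {d k : ℕ} {Ω : Type*}

/-- A family of controlled rough paths whose norms are bounded uniformly in the parameter. -/
structure UniformControlled {V : Type*} [NormedAddCommGroup V] [NormedSpace ℝ V]
    (η : RoughPath α T d) (β β' C : ℝ) (Z : Time T → Ω → V)
    (Z' : Time T → Ω → (EuclideanSpace ℝ (Fin d) →L[ℝ] V)) : Prop where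
  bound : ∀ t ω, ‖Z t ω‖ ≤ C
  bound' : ∀ t ω, ‖Z' t ω‖ ≤ C
  holder : ∀ s t ω, s ≤ t → ‖Z t ω - Z s ω‖ ≤ C * ((t : ℝ) - s) ^ β
  holder' : ∀ s t ω, s ≤ t → ‖Z' t ω - Z' s ω‖ ≤ C * ((t : ℝ) - s) ^ β'
  remainder : ∀ s t ω, s ≤ t →
    ‖RoughRDE.remainder η Z Z' s t ω‖ ≤ C * ((t : ℝ) - s) ^ (β + β')

variable (η : RoughPath α T d)
  (F : Time T → Ω → (EuclideanSpace ℝ (Fin k) →L[ℝ]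
      EuclideanSpace ℝ (Fin d) →L[ℝ] EuclideanSpace ℝ (Fin k)))
  (F' : Time T → Ω → (EuclideanSpace ℝ (Fin d) →L[ℝ] EuclideanSpace ℝ (Fin k) →L[ℝ]
      EuclideanSpace ℝ (Fin d) →L[ℝ] EuclideanSpace ℝ (Fin k)))

/-- The derivative of the coefficient of the linear equation for the flow: the bilinear map
`(x, y) ↦ (F' x)(·) y + F (F (·) x) y`. -/
def flowField' (f : EuclideanSpace ℝ (Fin k) →L[ℝ]
      EuclideanSpace ℝ (Fin d) →L[ℝ] EuclideanSpace ℝ (Fin k))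
    (f' : EuclideanSpace ℝ (Fin d) →L[ℝ] EuclideanSpace ℝ (Fin k) →L[ℝ]
      EuclideanSpace ℝ (Fin d) →L[ℝ] EuclideanSpace ℝ (Fin k)) :
    EuclideanSpace ℝ (Fin d) →L[ℝ] EuclideanSpace ℝ (Fin d) →L[ℝ]
      (EuclideanSpace ℝ (Fin k) →L[ℝ] EuclideanSpace ℝ (Fin k)) :=
  (ContinuousLinearMap.flipₗᵢ ℝ (EuclideanSpace ℝ (Fin k)) (EuclideanSpace ℝ (Fin d))
      (EuclideanSpace ℝ (Fin k))).toContinuousLinearEquiv.toContinuousLinearMap.comp f'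
    + (ContinuousLinearMap.mul ℝ
        (EuclideanSpace ℝ (Fin k) →L[ℝ] EuclideanSpace ℝ (Fin k))).flip.bilinearComp f.flip f.flip

theorem flowField'_apply (f : EuclideanSpace ℝ (Fin k) →L[ℝ]
      EuclideanSpace ℝ (Fin d) →L[ℝ] EuclideanSpace ℝ (Fin k))
    (f' : EuclideanSpace ℝ (Fin d) →L[ℝ] EuclideanSpace ℝ (Fin k) →L[ℝ]
      EuclideanSpace ℝ (Fin d) →L[ℝ] EuclideanSpace ℝ (Fin k)) (x y : EuclideanSpace ℝ (Fin d)) :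
    flowField' f f' x y = (f' x).flip y + f.flip y * f.flip x := rfl

/-- The germ of the linear flow. -/
def flowGerm (s t : Time T) (ω : Ω) :
    EuclideanSpace ℝ (Fin k) →L[ℝ] EuclideanSpace ℝ (Fin k) :=
  germ η (fun s ω => (F s ω).flip) (fun s ω => flowField' (F s ω) (F' s ω)) s t ω

/-- One step of the linear flow. -/
def flowStep (ω : Ω) (s t : Time T) :
    EuclideanSpace ℝ (Fin k) →L[ℝ] EuclideanSpace ℝ (Fin k) :=
  1 + flowGerm η F F' s t ω

/-- Linearity in action: the germ of the equation depends on the solution only through an operator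
applied to `X s`, and this operator does not involve `X`. -/
theorem flowGerm_apply (X : Time T → Ω → EuclideanSpace ℝ (Fin k)) (s t : Time T) (ω : Ω) :
    flowGerm η F F' s t ω (X s ω) = germ η (integrand F X) (integrand' F F' X) s t ω := by
  simp [flowGerm, germ_eq, contract, integrand, integrand', flowField'_apply, sum_apply]

theorem flowStep_apply (X : Time T → Ω → EuclideanSpace ℝ (Fin k)) (s t : Time T) (ω : Ω) :
    flowStep η F F' ω s t (X s ω)
      = X s ω + germ η (integrand F X) (integrand' F F' X) s t ω := by
  rw [flowStep, ← flowGerm_apply]; rfl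

theorem norm_flowField'_le {C : ℝ} {f : EuclideanSpace ℝ (Fin k) →L[ℝ]
      EuclideanSpace ℝ (Fin d) →L[ℝ] EuclideanSpace ℝ (Fin k)}
    {f' : EuclideanSpace ℝ (Fin d) →L[ℝ] EuclideanSpace ℝ (Fin k) →L[ℝ]
      EuclideanSpace ℝ (Fin d) →L[ℝ] EuclideanSpace ℝ (Fin k)} (hf : ‖f‖ ≤ C) (hf' : ‖f'‖ ≤ C) :
    ‖flowField' f f'‖ ≤ C + C * C := by
  have hC : 0 ≤ C := (norm_nonneg _).trans hf
  refine ContinuousLinearMap.opNorm_le_bound₂ _ (by positivity) fun x y => ?_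
  rw [flowField'_apply]
  have h1 : ‖(f' x).flip y‖ ≤ C * ‖x‖ * ‖y‖ := by
    refine ((f' x).flip.le_opNorm y).trans ?_
    rw [ContinuousLinearMap.opNorm_flip]
    gcongr
    exact (f'.le_opNorm x).trans (by gcongr)
  have h2 : ∀ z, ‖f.flip z‖ ≤ C * ‖z‖ := fun z => by
    refine (f.flip.le_opNorm z).trans ?_
    rw [ContinuousLinearMap.opNorm_flip]
    gcongr
  calc _ ≤ C * ‖x‖ * ‖y‖ + (C * ‖y‖) * (C * ‖x‖) :=
        (norm_add_le _ _).trans (add_le_add h1 ((norm_mul_le _ _).trans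
          (mul_le_mul (h2 y) (h2 x) (norm_nonneg _) (by positivity))))
    _ = _ := by ring

theorem norm_flip_apply_le (f : EuclideanSpace ℝ (Fin k) →L[ℝ]
      EuclideanSpace ℝ (Fin d) →L[ℝ] EuclideanSpace ℝ (Fin k)) (z : EuclideanSpace ℝ (Fin d)) :
    ‖f.flip z‖ ≤ ‖f‖ * ‖z‖ := by
  have := f.flip.le_opNorm z
  rwa [ContinuousLinearMap.opNorm_flip] at this

theorem norm_flowField'_sub_le {C : ℝ} {f g : EuclideanSpace ℝ (Fin k) →L[ℝ]
      EuclideanSpace ℝ (Fin d) →L[ℝ] EuclideanSpace ℝ (Fin k)}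
    {f' g' : EuclideanSpace ℝ (Fin d) →L[ℝ] EuclideanSpace ℝ (Fin k) →L[ℝ]
      EuclideanSpace ℝ (Fin d) →L[ℝ] EuclideanSpace ℝ (Fin k)} (hf : ‖f‖ ≤ C) (hg : ‖g‖ ≤ C) :
    ‖flowField' f f' - flowField' g g'‖ ≤ ‖f' - g'‖ + 2 * C * ‖f - g‖ := by
  have hC : 0 ≤ C := (norm_nonneg _).trans hf
  refine ContinuousLinearMap.opNorm_le_bound₂ _ (by positivity) fun a b => ?_
  have e : (flowField' f f' - flowField' g g') a b = ((f' - g') a).flip b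
      + ((f - g).flip b * f.flip a + g.flip b * (f - g).flip a) := by
    have h1 : (f - g).flip b = f.flip b - g.flip b := rfl
    have h2 : (f - g).flip a = f.flip a - g.flip a := rfl
    have h3 : ((f' - g') a).flip b = (f' a).flip b - (g' a).flip b := rfl
    rw [sub_apply, sub_apply, flowField'_apply, flowField'_apply, h1, h2, h3]
    noncomm_ring
  rw [e]
  have b2 := (f' - g').le_opNorm a
  have b4 := (norm_flip_apply_le f a).trans (mul_le_mul_of_nonneg_right hf (norm_nonneg a))
  have b5 := (norm_flip_apply_le g b).trans (mul_le_mul_of_nonneg_right hg (norm_nonneg b))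
  calc _ ≤ (‖f' - g'‖ * ‖a‖) * ‖b‖
        + ((‖f - g‖ * ‖b‖) * (C * ‖a‖) + (C * ‖b‖) * (‖f - g‖ * ‖a‖)) := by
        refine (norm_add_le _ _).trans (add_le_add
          ((norm_flip_apply_le ((f' - g') a) b).trans (by gcongr))
          ((norm_add_le _ _).trans (add_le_add ((norm_mul_le _ _).trans ?_)
          ((norm_mul_le _ _).trans ?_))))
        · exact mul_le_mul (norm_flip_apply_le _ b) b4 (norm_nonneg _) (by positivity)
        · exact mul_le_mul b5 (norm_flip_apply_le _ a) (norm_nonneg _) (by positivity)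
    _ = _ := by ring

/-- The term `F F` in the derivative of the flow coefficient does not belong to the expansion of
`F`. It therefore survives in the remainder, with order only `2α`, and has to be cancelled by the
product of the first-order parts of two consecutive steps. -/
theorem remainder_flip_apply (s u : Time T) (ω : Ω) (z : EuclideanSpace ℝ (Fin d)) :
    remainder η (fun s ω => (F s ω).flip) (fun s ω => flowField' (F s ω) (F' s ω)) s u ω z
      = (remainder η F F' s u ω).flip z
        - (F s ω).flip z * (F s ω).flip (η.path u - η.path s) := by
  have h : (remainder η F F' s u ω).flip z
      = (F u ω).flip z - (F s ω).flip z - (F' s ω (η.path u - η.path s)).flip z := rfl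
  rw [h, remainder, sub_apply, sub_apply, flowField'_apply]
  abel

/-- The cancellation just mentioned: the additivity defect contributes `-e * a`, the product of two
steps contributes `b * a`, and only `(b - e) * a` is left, where `b - e` is an increment of the
coefficient. -/
theorem step_defect_identity {R : Type*} [Ring R] {a a2 b b2 c c2 r e z : R}
    (h : a + a2 + (b + b2) - (c + c2) = r - e * a + z) :
    (1 + (b + b2)) * (1 + (a + a2)) - (1 + (c + c2))
      = r + (b - e) * a + z + b * a2 + b2 * a + b2 * a2 := by
  obtain rfl : z = a + a2 + (b + b2) - (c + c2) - (r - e * a) := by rw [h]; abel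
  noncomm_ring

variable {η F F'}

set_option maxHeartbeats 1000000 in
/-- The steps of the linear flow are almost multiplicative. -/
theorem exists_almostMul_flowStep {β β' C : ℝ} (hα : α ∈ Set.Ioo (1 / 3 : ℝ) (1 / 2))
    (hβ : β ∈ Set.Ioc (1 / 4 : ℝ) α) (hβ' : β' ∈ Set.Ioc 0 β) (hC : 0 ≤ C)
    (h : UniformControlled η β β' C F F') :
    ∃ C' : ℝ, 0 ≤ C' ∧ ∀ ω, AlmostMul (flowStep η F F' ω) α (α + β + β') C' := by
  obtain ⟨hα1, hα2⟩ := hα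
  obtain ⟨hβ1, hβ2⟩ := hβ
  obtain ⟨hβ'1, hβ'2⟩ := hβ'
  obtain ⟨Cη, hCη, hη⟩ := exists_path_bound η
  obtain ⟨Cc, hCc, hc⟩ := exists_contract_bound
    (V := EuclideanSpace ℝ (Fin k) →L[ℝ] EuclideanSpace ℝ (Fin k)) η
  set P : Time T → Ω → _ := fun s ω => (F s ω).flip with hP
  set Q : Time T → Ω → _ := fun s ω => flowField' (F s ω) (F' s ω) with hQ
  have hh := span_mem (ι := Ω) (T := T)
  set S := triples Ω T
  have hQb : ∀ s ω, ‖Q s ω‖ ≤ C + C * C := fun s ω =>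
    norm_flowField'_le (h.bound s ω) (h.bound' s ω)
  have hPb : ∀ s ω, ‖P s ω‖ ≤ C := fun s ω => by
    rw [hP, ContinuousLinearMap.opNorm_flip]; exact h.bound s ω
  -- first order part and second order part of the germ
  have hA : ∀ (ω : Ω) (s t : Time T), s ≤ t →
      ‖P s ω (η.path t - η.path s)‖ ≤ C * Cη * ((t : ℝ) - s) ^ α := fun ω s t hst => by
    refine ((P s ω).le_opNorm _).trans ?_
    rw [mul_assoc]
    exact mul_le_mul (hPb s ω) (hη s t hst) (norm_nonneg _) hC
  have hB : ∀ (ω : Ω) (s t : Time T), s ≤ t →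
      ‖contract η s t (Q s ω)‖ ≤ Cc * (C + C * C) * ((t : ℝ) - s) ^ (2 * α) :=
    fun ω s t hst => by
      refine (hc s t hst _).trans ?_
      have := Real.rpow_nonneg (time_sub_nonneg hst) (2 * α)
      calc _ ≤ Cc * ((t : ℝ) - s) ^ (2 * α) * (C + C * C) := by gcongr; exact hQb s ω
        _ = _ := by ring
  have hg : ∀ ω s t, flowStep η F F' ω s t
      = 1 + (P s ω (η.path t - η.path s) + contract η s t (Q s ω)) := fun ω s t => rfl
  have oAl := ord_left (by positivity) (by linarith) hA
  have oAr := ord_right (by positivity) (by linarith) hA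
  have oAo := ord_outer hA
  have oBl := ord_left (by positivity) (by linarith) hB
  have oBr := ord_right (by positivity) (by linarith) hB
  have oBo := ord_outer hB
  have oη : Ord S span α (fun x => η.path x.2.2.2 - η.path x.2.2.1) :=
    ord_right (f := fun _ s t => η.path t - η.path s) hCη (by linarith) fun _ => hη
  have oR : Ord S span (β + β') (fun x => remainder η F F' x.2.1 x.2.2.1 x.1) :=
    ord_left (f := fun ω s t => remainder η F F' s t ω) hC (by linarith) fun ω s t hst =>
      h.remainder s t ω hst
  have oF : Ord S span β (fun x => F x.2.2.1 x.1 - F x.2.1 x.1) :=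
    ord_left (f := fun ω s t => F t ω - F s ω) hC (by linarith) fun ω s t hst =>
      h.holder s t ω hst
  have oF' : Ord S span β' (fun x => F' x.2.2.1 x.1 - F' x.2.1 x.1) :=
    ord_left (f := fun ω s t => F' t ω - F' s ω) hC (by linarith) fun ω s t hst =>
      h.holder' s t ω hst
  have hθ0 : 0 ≤ α + β + β' := by linarith
  -- the increments of the second order coefficient
  have oQ : Ord S span β' (fun x => Q x.2.2.1 x.1 - Q x.2.1 x.1) := by
    have o2 : Ord S span β' (fun x => 2 * C * ‖F x.2.2.1 x.1 - F x.2.1 x.1‖) :=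
      (oF.mono hh hβ'1.le hβ'2).norm_left.const_mul_left (2 * C)
    refine Asymptotics.IsBigO.trans ?_ (oF'.norm_left.add o2)
    refine Asymptotics.IsBigO.of_norm_le fun x => ?_
    exact norm_flowField'_sub_le (h.bound _ _) (h.bound _ _)
  have oC : Ord S span (α + β + β')
      (fun x => contract η x.2.2.1 x.2.2.2 (Q x.2.2.1 x.1 - Q x.2.1 x.1)) := by
    refine Ord.of_le_mul (a := 2 * α) (C := Cc) (f := fun x => ((x.2.2.2 : ℝ) - x.2.2.1) ^ (2 * α))
      ?_ oQ hh (fun x hx => ?_) (by linarith) hβ'1.le hθ0 (by linarith)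
    · refine ord_right (ι := Ω) (f := fun _ s t => ((t : ℝ) - s) ^ (2 * α)) zero_le_one
        (by linarith) fun _ s t hst => ?_
      rw [one_mul, Real.norm_of_nonneg (Real.rpow_nonneg (time_sub_nonneg hst) _)]
    · rw [Real.norm_of_nonneg (Real.rpow_nonneg (time_sub_nonneg hx.2) _), ← mul_assoc]
      exact hc _ _ hx.2 _
  have oR1 : Ord S span (α + β + β') (fun x =>
      (remainder η F F' x.2.1 x.2.2.1 x.1).flip (η.path x.2.2.2 - η.path x.2.2.1)) := by
    refine oR.of_le_mul (C := 1) oη hh (fun x _ => ?_) (by linarith) (by linarith) hθ0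
      (by linarith)
    rw [one_mul]
    refine (ContinuousLinearMap.le_opNorm _ _).trans ?_
    rw [ContinuousLinearMap.opNorm_flip]
  have oDF : Ord S span (α + β) (fun x =>
      (F x.2.2.1 x.1 - F x.2.1 x.1).flip (η.path x.2.2.2 - η.path x.2.2.1)) := by
    refine oF.of_le_mul (C := 1) oη hh (fun x _ => ?_) (by linarith) (by linarith) (by linarith)
      (by linarith)
    rw [one_mul]
    refine (ContinuousLinearMap.le_opNorm _ _).trans ?_
    rw [ContinuousLinearMap.opNorm_flip]
  have oDFA := oDF.mul oAl hh (κ := α + β + β') (by linarith) (by linarith) hθ0 (by linarith)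
  have o1 := oAr.mul oBl hh (κ := α + β + β') (by linarith) (by linarith) hθ0 (by linarith)
  have o2 := oBr.mul oAl hh (κ := α + β + β') (by linarith) (by linarith) hθ0 (by linarith)
  have o3 := oBr.mul oBl hh (κ := α + β + β') (by linarith) (by linarith) hθ0 (by linarith)
  -- The six terms have orders `α + β + β'`, `2α + β`, `2α + β'`, `3α`, `3α` and `4α`; all are at
  -- least `θ` because `β' ≤ β ≤ α`.
  have key : Ord S span (α + β + β') (fun x => flowStep η F F' x.1 x.2.2.1 x.2.2.2 *
      flowStep η F F' x.1 x.2.1 x.2.2.1 - flowStep η F F' x.1 x.2.1 x.2.2.2) := by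
    refine (((((oR1.add oDFA).add oC).add o1).add o2).add o3).congr' ?_ EventuallyEq.rfl
    refine mem_principal.2 fun x hx => ?_
    have hdef := germ_defect η P Q hx.1 hx.2 x.1
    rw [germ_eq, germ_eq, germ_eq] at hdef
    have hrem := remainder_flip_apply η F F' x.2.1 x.2.2.1 x.1
      (η.path x.2.2.2 - η.path x.2.2.1)
    rw [hrem] at hdef
    have hdF : (F x.2.2.1 x.1 - F x.2.1 x.1).flip (η.path x.2.2.2 - η.path x.2.2.1)
        = P x.2.2.1 x.1 (η.path x.2.2.2 - η.path x.2.2.1)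
          - P x.2.1 x.1 (η.path x.2.2.2 - η.path x.2.2.1) := rfl
    change _ = _
    beta_reduce
    rw [hg, hg, hg, hdF]
    exact (step_defect_identity hdef).symm
  have ksmall : Ord S span α (fun x => flowStep η F F' x.1 x.2.1 x.2.2.2 - 1) := by
    refine (oAo.add (oBo.mono hh (by linarith) (by linarith))).congr_left fun x => ?_
    rw [hg]; abel
  obtain ⟨C1, hC1, H1⟩ := key.exists_bound fun x hx => (hh x hx).1
  obtain ⟨C2, hC2, H2⟩ := exists_bound_of_ord_outer
    (f := fun w s t => flowStep η F F' w s t - 1) ksmall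
  refine ⟨C1 + C2, by positivity, fun w => ⟨fun s => ?_, fun s t hst => ?_,
    fun s u t hsu hut => ?_⟩⟩
  · rw [hg, sub_self, map_zero, contract_self η (by linarith), add_zero, add_zero]
  · have := H2 w s t hst
    have h0 := Real.rpow_nonneg (time_sub_nonneg hst) α
    nlinarith
  · have := H1 (w, s, u, t) ⟨hsu, hut⟩
    have h0 := Real.rpow_nonneg (time_sub_nonneg (hsu.trans hut)) (α + β + β')
    simp only [span] at this
    nlinarith

end Flow

/-! ### The linear flow and its inverse. -/

section FlowExistence

variable {α T : ℝ} {d k : ℕ} {Ω : Type*} {mΩ : MeasurableSpace Ω}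

/-- `U` is the flow from time `0` of the linear rough equation driven by `F`, and `V` is its
inverse; both are adapted, and bounded uniformly in the randomness. -/
structure IsLinearFlow (ℱ : Filtration (Time T) mΩ) (η : RoughPath α T d) (θ K : ℝ)
    (F : Time T → Ω → (EuclideanSpace ℝ (Fin k) →L[ℝ]
      EuclideanSpace ℝ (Fin d) →L[ℝ] EuclideanSpace ℝ (Fin k)))
    (F' : Time T → Ω → (EuclideanSpace ℝ (Fin d) →L[ℝ] EuclideanSpace ℝ (Fin k) →L[ℝ]
      EuclideanSpace ℝ (Fin d) →L[ℝ] EuclideanSpace ℝ (Fin k)))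
    (U V : Time T → Ω → (EuclideanSpace ℝ (Fin k) →L[ℝ] EuclideanSpace ℝ (Fin k))) : Prop where
  adapted : ∀ t, StronglyMeasurable[ℱ t] (U t)
  adapted_inv : ∀ t, StronglyMeasurable[ℱ t] (V t)
  zero : ∀ (t : Time T) ω, (t : ℝ) = 0 → U t ω = 1
  zero_inv : ∀ (t : Time T) ω, (t : ℝ) = 0 → V t ω = 1
  bound : ∀ t ω, ‖U t ω‖ ≤ K
  bound_inv : ∀ t ω, ‖V t ω‖ ≤ K
  step : ∀ s t ω, s ≤ t → ‖U t ω - flowStep η F F' ω s t * U s ω‖ ≤ K * ((t : ℝ) - s) ^ θ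
  step_inv : ∀ s t ω, s ≤ t → ‖V t ω * flowStep η F F' ω s t - V s ω‖ ≤ K * ((t : ℝ) - s) ^ θ
  holder : ∀ s t ω, s ≤ t → ‖U t ω - U s ω‖ ≤ K * ((t : ℝ) - s) ^ α
  holder_inv : ∀ s t ω, s ≤ t → ‖V t ω - V s ω‖ ≤ K * ((t : ℝ) - s) ^ α
  inv_mul : ∀ t ω, V t ω * U t ω = 1
  mul_inv : ∀ t ω, U t ω * V t ω = 1

theorem continuous_of_holder {X : Type*} [NormedAddCommGroup X] {f : Time T → X} {C a : ℝ}
    (ha : 0 < a) (hf : ∀ s t : Time T, s ≤ t → ‖f t - f s‖ ≤ C * ((t : ℝ) - s) ^ a) :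
    Continuous f := by
  have h : ∀ s t : Time T, dist (f t) (f s) ≤ C * (dist t s) ^ a := fun s t => by
    rw [dist_eq_norm, Subtype.dist_eq, Real.dist_eq]
    rcases le_total s t with hst | hst
    · rw [abs_of_nonneg (time_sub_nonneg hst)]; exact hf s t hst
    · rw [abs_sub_comm, abs_of_nonneg (time_sub_nonneg hst), norm_sub_rev]; exact hf t s hst
  refine continuous_iff_continuousAt.2 fun s => tendsto_iff_dist_tendsto_zero.2 ?_
  refine squeeze_zero (fun _ => dist_nonneg) (fun t => h s t) ?_
  have : Tendsto (fun t : Time T => C * (dist t s) ^ a) (𝓝 s) (𝓝 (C * (dist s s) ^ a)) :=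
    (((continuous_id.dist continuous_const).tendsto s).rpow_const (Or.inr ha.le)).const_mul C
  simpa [Real.zero_rpow ha.ne'] using this

variable {η : RoughPath α T d}
  {F : Time T → Ω → (EuclideanSpace ℝ (Fin k) →L[ℝ]
      EuclideanSpace ℝ (Fin d) →L[ℝ] EuclideanSpace ℝ (Fin k))}
  {F' : Time T → Ω → (EuclideanSpace ℝ (Fin d) →L[ℝ] EuclideanSpace ℝ (Fin k) →L[ℝ]
      EuclideanSpace ℝ (Fin d) →L[ℝ] EuclideanSpace ℝ (Fin k))}

theorem stronglyMeasurable_flowStep {m : MeasurableSpace Ω} {s t : Time T}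
    (hF : StronglyMeasurable[m] (F s)) (hF' : StronglyMeasurable[m] (F' s)) :
    StronglyMeasurable[m] (fun ω => flowStep η F F' ω s t) := by
  have hflip : ∀ x : EuclideanSpace ℝ (Fin d), Continuous fun f : EuclideanSpace ℝ (Fin k) →L[ℝ]
      EuclideanSpace ℝ (Fin d) →L[ℝ] EuclideanSpace ℝ (Fin k) => f.flip x := fun x =>
    ((ContinuousLinearMap.flipₗᵢ ℝ (EuclideanSpace ℝ (Fin k)) (EuclideanSpace ℝ (Fin d))
      (EuclideanSpace ℝ (Fin k))).continuous).clm_apply continuous_const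
  have h1 : ∀ x, StronglyMeasurable[m] fun ω => (F s ω).flip x := fun x =>
    (hflip x).comp_stronglyMeasurable hF
  have h2 : ∀ x y, StronglyMeasurable[m] fun ω => (F' s ω x).flip y := fun x y =>
    (hflip y).comp_stronglyMeasurable
      ((ContinuousLinearMap.apply ℝ _ x).continuous.comp_stronglyMeasurable hF')
  have : (fun ω => flowStep η F F' ω s t) = fun ω => 1 + ((F s ω).flip (η.path t - η.path s)
      + ∑ i, ∑ j, η.level2 s t i j •
        ((F' s ω (EuclideanSpace.single i (1 : ℝ))).flip (EuclideanSpace.single j (1 : ℝ))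
          + (F s ω).flip (EuclideanSpace.single j (1 : ℝ))
            * (F s ω).flip (EuclideanSpace.single i (1 : ℝ)))) := rfl
  rw [this]
  refine stronglyMeasurable_const.add ((h1 _).add ?_)
  refine Finset.stronglyMeasurable_fun_sum _ fun i _ =>
    Finset.stronglyMeasurable_fun_sum _ fun j _ => ?_
  exact ((h2 _ _).add ((h1 _).mul (h1 _))).const_smul (η.level2 s t i j)

/-- The grid is stopped at `t`, so every step starts no later than `t`. Its right end is irrelevant
for measurability because the rough path is deterministic. This is how the flow becomes adapted. -/
theorem stronglyMeasurable_gridProd {𝔸 : Type*} [NormedRing 𝔸] {m : MeasurableSpace Ω}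
    {M : Ω → Time T → Time T → 𝔸} {t : Time T}
    (h : ∀ s ≤ t, ∀ u, StronglyMeasurable[m] (fun ω => M ω s u)) (n : ℕ) :
    StronglyMeasurable[m] (fun ω => gridProd (M ω) n t) := by
  have : ∀ p, StronglyMeasurable[m] (fun ω => stepProd (M ω) (gridPoint n t) p) := fun p => by
    induction p with
    | zero => exact stronglyMeasurable_const
    | succ p ih => exact (h _ (gridPoint_le _ _ _) _).mul ih
  exact this _

/-- Existence of the flow of the linear rough equation, and of its inverse. -/
theorem exists_linearFlow (hT : 0 < T) (ℱ : Filtration (Time T) mΩ) {β β' C : ℝ}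
    (hα : α ∈ Set.Ioo (1 / 3 : ℝ) (1 / 2))
    (hβ : β ∈ Set.Ioc (1 / 4 : ℝ) α) (hβ' : β' ∈ Set.Ioc 0 β) (hsum : 1 < α + β + β')
    (hC : 0 ≤ C) (h : UniformControlled η β β' C F F')
    (hF : ∀ t, StronglyMeasurable[ℱ t] (F t)) (hF' : ∀ t, StronglyMeasurable[ℱ t] (F' t)) :
    ∃ U V K, 0 ≤ K ∧ IsLinearFlow ℱ η (α + β + β') K F F' U V := by
  have h1 : ‖(1 : EuclideanSpace ℝ (Fin k) →L[ℝ] EuclideanSpace ℝ (Fin k))‖ ≤ 1 :=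
    ContinuousLinearMap.norm_id_le
  have hα0 : 0 < α := by linarith [hα.1]
  have hθ0 : 0 ≤ α + β + β' := by linarith
  have hθα : α + β + β' ≤ 3 * α := by linarith [hβ.2, hβ'.2]
  have hαθ : α ≤ α + β + β' := by linarith [hβ.1, hβ'.1]
  obtain ⟨C1, hC1, hm⟩ := exists_almostMul_flowStep hα hβ hβ' hC h
  obtain ⟨C2, hC2, hn⟩ := exists_almostMul_op_approxInv hα0.le hθ0 hθα hC1 h1 _ hm
  obtain ⟨U, K1, hK1, hUlim, hU0, hUb, hUs⟩ := exists_multiplicative_primitive hT h1 hα0 hsum hC1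
    (fun ω => flowStep η F F' ω) hm
  obtain ⟨V, K2, hK2, hVlim, hV0, hVb, hVs⟩ := exists_multiplicative_primitive hT
    (𝔸 := (EuclideanSpace ℝ (Fin k) →L[ℝ] EuclideanSpace ℝ (Fin k))ᵐᵒᵖ)
    (by rw [← MulOpposite.op_one, MulOpposite.norm_op]; exact h1) hα0 hsum hC2
    (fun ω s t => MulOpposite.op (approxInv (flowStep η F F' ω s t))) hn
  have hV : ∀ ω t, ‖(V ω t).unop‖ ≤ K2 := fun ω t => by rw [MulOpposite.norm_unop]; exact hVb ω t
  set m := fun ω => flowStep η F F' ω with hmdef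
  set cube := fun ω s t => (m ω s t - 1) * (m ω s t - 1) * (m ω s t - 1) with hcube
  have hVs' : ∀ ω s t, s ≤ t → ‖(V ω t).unop - (V ω s).unop * approxInv (m ω s t)‖
      ≤ K2 * ((t : ℝ) - s) ^ (α + β + β') := fun ω s t hst => by
    have := hVs ω s t hst
    rwa [← MulOpposite.norm_unop] at this
  have hpow : ∀ {x κ κ' : ℝ}, 0 ≤ κ → κ ≤ κ' → 0 ≤ x → x ≤ T → x ^ κ' ≤ T ^ (κ' - κ) * x ^ κ :=
    fun h0 h1 hx hxT => rpow_le_const_mul_rpow hx hxT h0 h1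
  set M := 1 + C1 * T ^ α with hM
  have hM0 : 0 ≤ M := by positivity
  have hmM : ∀ ω s t, s ≤ t → ‖m ω s t‖ ≤ M := fun ω s t hst =>
    (hm ω).norm_le h1 hα0 hC1 hst (time_sub_le _ _)
  have hsm : ∀ ω s t, s ≤ t → ‖m ω s t - 1‖ ≤ C1 * ((t : ℝ) - s) ^ α := fun ω => (hm ω).small
  have hcubeb : ∀ ω s t, s ≤ t → ‖cube ω s t‖
      ≤ C1 ^ 3 * T ^ (3 * α - (α + β + β')) * ((t : ℝ) - s) ^ (α + β + β') :=
    fun ω s t hst => by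
      have h0 := time_sub_nonneg hst
      have e : (((t : ℝ) - s) ^ α) ^ 3 = ((t : ℝ) - s) ^ (3 * α) := by
        rw [← Real.rpow_natCast, ← Real.rpow_mul h0]; congr 1; push_cast; ring
      calc ‖cube ω s t‖ ≤ ‖m ω s t - 1‖ * ‖m ω s t - 1‖ * ‖m ω s t - 1‖ :=
            (norm_mul_le _ _).trans (by gcongr; exact norm_mul_le _ _)
        _ ≤ (C1 * ((t : ℝ) - s) ^ α) * (C1 * ((t : ℝ) - s) ^ α) * (C1 * ((t : ℝ) - s) ^ α) := by
            have := hsm ω s t hst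
            gcongr
        _ = C1 ^ 3 * (((t : ℝ) - s) ^ α) ^ 3 := by ring
        _ ≤ _ := by
            rw [e, mul_assoc]
            exact mul_le_mul_of_nonneg_left (hpow hθ0 hθα h0 (time_sub_le _ _)) (by positivity)
  set Kc := C1 ^ 3 * T ^ (3 * α - (α + β + β')) with hKc
  have hKc0 : 0 ≤ Kc := by positivity
  -- Sewing only says that `V` moves by the approximate inverse of a step; multiplying by the step
  -- on the right replaces that inverse by `1` up to a cube.
  have hVstep : ∀ ω s t, s ≤ t → ‖(V ω t).unop * m ω s t - (V ω s).unop‖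
      ≤ (K2 * M + K2 * Kc) * ((t : ℝ) - s) ^ (α + β + β') := fun ω s t hst => by
    have e : (V ω t).unop * m ω s t - (V ω s).unop
        = ((V ω t).unop - (V ω s).unop * approxInv (m ω s t)) * m ω s t
          + (V ω s).unop * cube ω s t := by
      rw [sub_mul, mul_assoc, approxInv_mul, mul_add, mul_one, hcube]; abel
    have h0 := time_sub_nonneg hst
    rw [e]
    calc _ ≤ (K2 * ((t : ℝ) - s) ^ (α + β + β')) * M
          + K2 * (Kc * ((t : ℝ) - s) ^ (α + β + β')) := by
          refine (norm_add_le _ _).trans (add_le_add ((norm_mul_le _ _).trans ?_)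
            ((norm_mul_le _ _).trans ?_))
          · exact mul_le_mul (hVs' ω s t hst) (hmM ω s t hst) (norm_nonneg _) (by positivity)
          · exact mul_le_mul (hV ω s) (hcubeb ω s t hst) (norm_nonneg _) hK2
      _ = _ := by ring
  have hUhol : ∀ ω s t, s ≤ t → ‖U ω t - U ω s‖
      ≤ (K1 * T ^ (α + β + β' - α) + C1 * K1) * ((t : ℝ) - s) ^ α := fun ω s t hst => by
    have e : U ω t - U ω s = (U ω t - m ω s t * U ω s) + (m ω s t - 1) * U ω s := by
      noncomm_ring
    have h0 := time_sub_nonneg hst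
    rw [e]
    calc _ ≤ K1 * (T ^ (α + β + β' - α) * ((t : ℝ) - s) ^ α)
          + (C1 * ((t : ℝ) - s) ^ α) * K1 := by
          refine (norm_add_le _ _).trans (add_le_add ((hUs ω s t hst).trans ?_)
            ((norm_mul_le _ _).trans ?_))
          · exact mul_le_mul_of_nonneg_left (hpow hα0.le hαθ h0 (time_sub_le _ _)) hK1
          · exact mul_le_mul (hsm ω s t hst) (hUb ω s) (norm_nonneg _) (by positivity)
      _ = _ := by ring
  have hVhol : ∀ ω s t, s ≤ t → ‖(V ω t).unop - (V ω s).unop‖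
      ≤ ((K2 * M + K2 * Kc) * T ^ (α + β + β' - α) + K2 * C1) * ((t : ℝ) - s) ^ α :=
    fun ω s t hst => by
    have e : (V ω t).unop - (V ω s).unop = ((V ω t).unop * m ω s t - (V ω s).unop)
        - (V ω t).unop * (m ω s t - 1) := by noncomm_ring
    have h0 := time_sub_nonneg hst
    rw [e]
    calc _ ≤ (K2 * M + K2 * Kc) * (T ^ (α + β + β' - α) * ((t : ℝ) - s) ^ α)
          + K2 * (C1 * ((t : ℝ) - s) ^ α) := by
          refine (norm_sub_le _ _).trans (add_le_add ((hVstep ω s t hst).trans ?_)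
            ((norm_mul_le _ _).trans ?_))
          · exact mul_le_mul_of_nonneg_left (hpow hα0.le hαθ h0 (time_sub_le _ _)) (by positivity)
          · exact mul_le_mul (hV ω t) (hsm ω s t hst) (norm_nonneg _) hK2
      _ = _ := by ring
  have hzero : ((⟨0, le_rfl, hT.le⟩ : Time T) : ℝ) = 0 := rfl
  have hV0' : ∀ ω (t : Time T), (t : ℝ) = 0 → (V ω t).unop = 1 := fun ω t ht => by
    rw [hV0 ω t ht, MulOpposite.unop_one]
  -- Inserting the step `m` between the factors shows that the increments of `V U` have order `θ >
  -- 1`; hence `V U` keeps its initial value `1`.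
  have hVU : ∀ ω t, (V ω t).unop * U ω t = 1 := fun ω t => by
    have hd : ∀ s t : Time T, s ≤ t → ‖(V ω t).unop * U ω t - (V ω s).unop * U ω s‖
        ≤ (K2 * K1 + (K2 * M + K2 * Kc) * K1) * ((t : ℝ) - s) ^ (α + β + β') :=
      fun s t hst => by
        have e : (V ω t).unop * U ω t - (V ω s).unop * U ω s
            = (V ω t).unop * (U ω t - m ω s t * U ω s)
              + ((V ω t).unop * m ω s t - (V ω s).unop) * U ω s := by noncomm_ring
        have h0 := time_sub_nonneg hst
        rw [e]
        calc _ ≤ K2 * (K1 * ((t : ℝ) - s) ^ (α + β + β'))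
              + ((K2 * M + K2 * Kc) * ((t : ℝ) - s) ^ (α + β + β')) * K1 := by
              refine (norm_add_le _ _).trans (add_le_add ((norm_mul_le _ _).trans ?_)
                ((norm_mul_le _ _).trans ?_))
              · exact mul_le_mul (hV ω t) (hUs ω s t hst) (norm_nonneg _) hK2
              · exact mul_le_mul (hVstep ω s t hst) (hUb ω s) (norm_nonneg _) (by positivity)
          _ = _ := by ring
    have := eq_zero_of_sub_le_rpow (t := t) (by positivity) hsum hd hzero
    simp only [hV0' ω _ hzero, hU0 ω _ hzero, mul_one] at this
    exact this
  -- In finite dimension a left inverse is a right inverse.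
  have hUV : ∀ ω t, U ω t * (V ω t).unop = 1 := fun ω t => by
    have h2 : ((V ω t).unop : EuclideanSpace ℝ (Fin k) →ₗ[ℝ] EuclideanSpace ℝ (Fin k))
        * (U ω t : EuclideanSpace ℝ (Fin k) →ₗ[ℝ] EuclideanSpace ℝ (Fin k)) = 1 := by
      rw [← ContinuousLinearMap.toLinearMap_mul, hVU]; rfl
    have h3 := mul_eq_one_comm.1 h2
    ext1 x
    exact congrArg (fun f => f x) h3
  set Ka := K1 * T ^ (α + β + β' - α) + C1 * K1 with hKa
  set Kb := (K2 * M + K2 * Kc) * T ^ (α + β + β' - α) + K2 * C1 with hKb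
  have hKa0 : 0 ≤ Ka := by positivity
  have hKb0 : 0 ≤ Kb := by positivity
  have hKv0 : 0 ≤ K2 * M + K2 * Kc := by positivity
  refine ⟨fun t ω => U ω t, fun t ω => (V ω t).unop, K1 + K2 + Ka + Kb + (K2 * M + K2 * Kc),
    by positivity, ?_⟩
  refine ⟨fun t => ?_, fun t => ?_, fun t ω => hU0 ω t, fun t ω => hV0' ω t, fun t ω => ?_,
    fun t ω => ?_, fun s t ω hst => ?_, fun s t ω hst => ?_, fun s t ω hst => ?_,
    fun s t ω hst => ?_, fun t ω => hVU ω t, fun t ω => hUV ω t⟩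
  · refine stronglyMeasurable_of_tendsto atTop (fun n => stronglyMeasurable_gridProd (M := m)
      (t := t) (fun s hs u => ?_) n) (tendsto_pi_nhds.2 fun ω => hUlim ω t)
    exact stronglyMeasurable_flowStep ((hF s).mono (ℱ.mono hs)) ((hF' s).mono (ℱ.mono hs))
  · refine MulOpposite.continuous_unop.comp_stronglyMeasurable ?_
    refine stronglyMeasurable_of_tendsto atTop (fun n => stronglyMeasurable_gridProd
      (M := fun ω s t => MulOpposite.op (approxInv (m ω s t)))
      (t := t) (fun s hs u => ?_) n) (tendsto_pi_nhds.2 fun ω => hVlim ω t)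
    refine MulOpposite.continuous_op.comp_stronglyMeasurable ?_
    have := stronglyMeasurable_flowStep (η := η) (t := u) ((hF s).mono (ℱ.mono hs))
      ((hF' s).mono (ℱ.mono hs))
    have h2 := this.sub (stronglyMeasurable_const
      (b := (1 : EuclideanSpace ℝ (Fin k) →L[ℝ] EuclideanSpace ℝ (Fin k))))
    exact (stronglyMeasurable_const.sub h2).add (h2.mul h2)
  · linarith [hUb ω t]
  · linarith [hV ω t]
  · exact (hUs ω s t hst).trans (mul_le_mul_of_nonneg_right (by linarith)
      (Real.rpow_nonneg (time_sub_nonneg hst) _))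
  · exact (hVstep ω s t hst).trans (mul_le_mul_of_nonneg_right (by linarith)
      (Real.rpow_nonneg (time_sub_nonneg hst) _))
  · exact (hUhol ω s t hst).trans (mul_le_mul_of_nonneg_right (by linarith)
      (Real.rpow_nonneg (time_sub_nonneg hst) _))
  · exact (hVhol ω s t hst).trans (mul_le_mul_of_nonneg_right (by linarith)
      (Real.rpow_nonneg (time_sub_nonneg hst) _))

end FlowExistence

/-! ### Modifications with bounds that hold for every outcome. -/

section Modification

variable {α T : ℝ} {d : ℕ} {Ω : Type*} {mΩ : MeasurableSpace Ω} {μ : Measure Ω}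
  {V : Type*} [NormedAddCommGroup V]

/-- The largest dyadic number of level `n` below `t`. -/
def dyadicFloor (n : ℕ) (t : Time T) : Time T :=
  ⟨(⌊(t : ℝ) * 2 ^ n⌋₊ : ℝ) / 2 ^ n, by positivity, by
    have := Nat.floor_le (mul_nonneg t.2.1 (by positivity : (0 : ℝ) ≤ 2 ^ n))
    exact ((div_le_iff₀ (by positivity)).2 this).trans t.2.2⟩

theorem dyadicFloor_le (n : ℕ) (t : Time T) : dyadicFloor n t ≤ t := by
  have := Nat.floor_le (mul_nonneg t.2.1 (by positivity : (0 : ℝ) ≤ 2 ^ n))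
  exact Subtype.coe_le_coe.1 ((div_le_iff₀ (by positivity)).2 this)

/-- Rounding down preserves adaptedness of limits, and monotonicity keeps `s ≤ t` along the
approximation, so bounds on pairs pass to the limit. -/
theorem dyadicFloor_mono (n : ℕ) {s t : Time T} (h : s ≤ t) :
    dyadicFloor n s ≤ dyadicFloor n t := by
  have h' : (s : ℝ) ≤ t := h
  refine Subtype.coe_le_coe.1 (?_ : (⌊(s : ℝ) * 2 ^ n⌋₊ : ℝ) / 2 ^ n ≤ ⌊(t : ℝ) * 2 ^ n⌋₊ / 2 ^ n)
  have : ⌊(s : ℝ) * 2 ^ n⌋₊ ≤ ⌊(t : ℝ) * 2 ^ n⌋₊ := Nat.floor_mono (by gcongr)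
  gcongr

theorem tendsto_dyadicFloor (t : Time T) :
    Tendsto (fun n => dyadicFloor n t) atTop (𝓝 t) := by
  rw [tendsto_subtype_rng]
  have h0 : Tendsto (fun n : ℕ => (t : ℝ) - 1 / (2 : ℝ) ^ n) atTop (𝓝 ((t : ℝ) - 0)) :=
    tendsto_const_nhds.sub (Tendsto.div_atTop tendsto_const_nhds
      (tendsto_pow_atTop_atTop_of_one_lt one_lt_two))
  rw [sub_zero] at h0
  refine tendsto_of_tendsto_of_tendsto_of_le_of_le h0 tendsto_const_nhds (fun n => ?_)
    (fun n => dyadicFloor_le n t)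
  have h2 : (0 : ℝ) < 2 ^ n := by positivity
  have := (Nat.lt_floor_add_one ((t : ℝ) * 2 ^ n)).le
  change (t : ℝ) - 1 / 2 ^ n ≤ (⌊(t : ℝ) * 2 ^ n⌋₊ : ℝ) / 2 ^ n
  rw [sub_le_iff_le_add, ← add_div, le_div_iff₀ h2]
  exact this

/-- The dyadic times. -/
def dyadics (T : ℝ) : Set (Time T) := {s | ∃ n : ℕ, ∃ j : ℕ, (s : ℝ) = j / 2 ^ n}

theorem dyadicFloor_mem (n : ℕ) (t : Time T) : dyadicFloor n t ∈ dyadics T := ⟨n, _, rfl⟩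

theorem countable_dyadics (T : ℝ) : (dyadics T).Countable := by
  have : (Set.range fun p : ℕ × ℕ => (p.2 : ℝ) / 2 ^ p.1).Countable := Set.countable_range _
  refine (this.preimage (Subtype.val_injective (p := fun x => x ∈ Set.Icc (0 : ℝ) T))).mono ?_
  rintro s ⟨n, j, h⟩
  exact ⟨(n, j), h.symm⟩

/-- The exceptional null set depends on the pair `s, t`; this is why the bounds are later collected
on countably many dyadic pairs only. -/
theorem HolderLp.ae_bound {κ : ℝ} {A : Time T → Time T → Ω → V} (h : HolderLp μ κ ∞ A) :
    ∃ C : ℝ, 0 ≤ C ∧ ∀ s t : Time T, s < t → ∀ᵐ ω ∂μ, ‖A s t ω‖ ≤ C * ((t : ℝ) - s) ^ κ := by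
  obtain ⟨C, hC⟩ := h
  refine ⟨C, C.2, fun s t hst => ?_⟩
  have h1 := hC s t hst
  rw [eLpNorm_exponent_top] at h1
  filter_upwards [ae_le_eLpNormEssSup (f := A s t) (μ := μ)] with ω hω
  have h2 := hω.trans h1
  have h0 := Real.rpow_nonneg (time_sub_nonneg hst.le) κ
  rw [← ofReal_norm, ← ENNReal.ofReal_coe_nnreal, ← ENNReal.ofReal_mul C.coe_nonneg] at h2
  exact (ENNReal.ofReal_le_ofReal_iff (mul_nonneg C.2 h0)).1 h2

theorem MemLp.ae_bound {f : Ω → V} (h : MemLp f ∞ μ) :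
    ∃ C : ℝ, 0 ≤ C ∧ ∀ᵐ ω ∂μ, ‖f ω‖ ≤ C := by
  refine ⟨(eLpNorm f ∞ μ).toReal, ENNReal.toReal_nonneg, ?_⟩
  filter_upwards [ae_le_eLpNormEssSup (f := f) (μ := μ)] with ω hω
  rw [← eLpNorm_exponent_top, ← ENNReal.ofReal_toReal h.2.ne, ← ofReal_norm] at hω
  exact (ENNReal.ofReal_le_ofReal_iff ENNReal.toReal_nonneg).1 hω

/-- A strongly controlled path with bounded norms has a modification all of whose paths are
controlled, uniformly in the randomness. -/
theorem exists_uniformControlled_modification [NormedSpace ℝ V] [CompleteSpace V] (hT : 0 < T)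
    {ℱ : Filtration (Time T) mΩ}
    (hℱ : ∀ (t : Time T) (N : Set Ω), μ N = 0 → MeasurableSet[ℱ t] N) {η : RoughPath α T d}
    {β β' : ℝ} (hβ : 0 < β) (hβ' : 0 < β') {Z : Time T → Ω → V}
    {Z' : Time T → Ω → (EuclideanSpace ℝ (Fin d) →L[ℝ] V)}
    (hZ : IsStrongControlled ℱ μ η β β' ∞ Z Z') :
    ∃ W W' C, 0 ≤ C ∧ UniformControlled η β β' C W W' ∧
      (∀ t, StronglyMeasurable[ℱ t] (W t)) ∧ (∀ t, StronglyMeasurable[ℱ t] (W' t)) ∧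
      (∀ t, W t =ᵐ[μ] Z t) ∧ ∀ t, W' t =ᵐ[μ] Z' t := by
  obtain ⟨C1, hC1, h1⟩ := hZ.holder.ae_bound
  obtain ⟨C2, hC2, h2⟩ := hZ.holder'.ae_bound
  obtain ⟨C3, hC3, h3⟩ := hZ.remainder.ae_bound
  set z : Time T := ⟨0, le_rfl, hT.le⟩ with hz
  obtain ⟨C4, hC4, h4⟩ := MemLp.ae_bound (hZ.memLp_zero z rfl)
  obtain ⟨C5, hC5, h5⟩ := MemLp.ae_bound (hZ.memLp_zero' z rfl)
  have h1' : ∀ s t : Time T, s ≤ t → ∀ᵐ ω ∂μ, ‖Z t ω - Z s ω‖ ≤ C1 * ((t : ℝ) - s) ^ β :=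
    fun s t hst => by
      rcases hst.eq_or_lt with rfl | hst
      · simp [Real.zero_rpow hβ.ne']
      · exact h1 s t hst
  have h2' : ∀ s t : Time T, s ≤ t → ∀ᵐ ω ∂μ, ‖Z' t ω - Z' s ω‖ ≤ C2 * ((t : ℝ) - s) ^ β' :=
    fun s t hst => by
      rcases hst.eq_or_lt with rfl | hst
      · simp [Real.zero_rpow hβ'.ne']
      · exact h2 s t hst
  have h3' : ∀ s t : Time T, s ≤ t → ∀ᵐ ω ∂μ,
      ‖RoughRDE.remainder η Z Z' s t ω‖ ≤ C3 * ((t : ℝ) - s) ^ (β + β') :=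
    fun s t hst => by
      rcases hst.eq_or_lt with rfl | hst
      · simp [RoughRDE.remainder, Real.zero_rpow (add_pos hβ hβ').ne']
      · exact h3 s t hst
  have hzle : ∀ t : Time T, z ≤ t := fun t => Subtype.coe_le_coe.1 t.2.1
  have hpow : ∀ {x κ : ℝ}, 0 ≤ κ → 0 ≤ x → x ≤ T → x ^ κ ≤ T ^ κ := fun hκ hx hxT =>
    Real.rpow_le_rpow hx hxT hκ
  have hb1 : ∀ t, ∀ᵐ ω ∂μ, ‖Z t ω‖ ≤ C4 + C1 * T ^ β := fun t => by
    filter_upwards [h4, h1' z t (hzle t)] with ω ha hb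
    have := norm_le_insert' (Z t ω) (Z z ω)
    have := mul_le_mul_of_nonneg_left
      (hpow hβ.le (time_sub_nonneg (hzle t)) (time_sub_le z t)) hC1
    linarith
  have hb2 : ∀ t, ∀ᵐ ω ∂μ, ‖Z' t ω‖ ≤ C5 + C2 * T ^ β' := fun t => by
    filter_upwards [h5, h2' z t (hzle t)] with ω ha hb
    have := norm_le_insert' (Z' t ω) (Z' z ω)
    have := mul_le_mul_of_nonneg_left
      (hpow hβ'.le (time_sub_nonneg (hzle t)) (time_sub_le z t)) hC2
    linarith
  set C := C1 + C2 + C3 + (C4 + C1 * T ^ β) + (C5 + C2 * T ^ β') with hC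
  have hp1 : 0 ≤ T ^ β := by positivity
  have hp2 : 0 ≤ T ^ β' := by positivity
  have hq1 : 0 ≤ C1 * T ^ β := by positivity
  have hq2 : 0 ≤ C2 * T ^ β' := by positivity
  -- The good event involves countably many conditions, hence has full measure. Although it looks at
  -- all times, completeness of the filtration puts it in every `ℱ t`. Off it the modification is
  -- set to zero.
  set G : Set Ω := {ω | ∀ s ∈ dyadics T, ∀ t ∈ dyadics T, s ≤ t →
    ‖Z t ω - Z s ω‖ ≤ C1 * ((t : ℝ) - s) ^ β ∧ ‖Z' t ω - Z' s ω‖ ≤ C2 * ((t : ℝ) - s) ^ β' ∧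
    ‖RoughRDE.remainder η Z Z' s t ω‖ ≤ C3 * ((t : ℝ) - s) ^ (β + β') ∧
    ‖Z t ω‖ ≤ C4 + C1 * T ^ β ∧ ‖Z' t ω‖ ≤ C5 + C2 * T ^ β'} with hG
  have hGae : ∀ᵐ ω ∂μ, ω ∈ G := by
    simp only [hG, Set.mem_ofPred_eq]
    refine (ae_ball_iff (countable_dyadics T)).2 fun s _ =>
      (ae_ball_iff (countable_dyadics T)).2 fun t _ => ?_
    by_cases hst : s ≤ t
    · filter_upwards [h1' s t hst, h2' s t hst, h3' s t hst, hb1 t, hb2 t]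
        with ω a b c e f _ using ⟨a, b, c, e, f⟩
    · exact Eventually.of_forall fun ω h => absurd h hst
  have hGm : ∀ t, MeasurableSet[ℱ t] G := fun t => by
    rw [← @MeasurableSet.compl_iff _ _ (ℱ t)]
    exact hℱ t _ hGae
  have hpos : ∀ {s t : Time T} {κ : ℝ}, s ≤ t → 0 ≤ ((t : ℝ) - s) ^ κ := fun h =>
    Real.rpow_nonneg (time_sub_nonneg h) _
  -- convergence along dyadic times
  have hdist : ∀ {κ : ℝ}, 0 < κ → ∀ (C : ℝ) (t : Time T), Tendsto
      (fun n => C * ((t : ℝ) - dyadicFloor n t) ^ κ) atTop (𝓝 0) := fun {κ} hκ C t => by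
    have h0 : Tendsto (fun n => (t : ℝ) - dyadicFloor n t) atTop (𝓝 ((t : ℝ) - t)) :=
      tendsto_const_nhds.sub ((continuous_subtype_val.tendsto t).comp (tendsto_dyadicFloor t))
    rw [sub_self] at h0
    have := (h0.rpow_const (p := κ) (Or.inr hκ.le)).const_mul C
    rwa [Real.zero_rpow hκ.ne', mul_zero] at this
  have hcau : ∀ {κ : ℝ}, 0 < κ → ∀ {E : Type _} [NormedAddCommGroup E] (f : Time T → E) (C : ℝ),
      0 ≤ C →
      (∀ s ∈ dyadics T, ∀ t ∈ dyadics T, s ≤ t → ‖f t - f s‖ ≤ C * ((t : ℝ) - s) ^ κ) →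
      ∀ t, CauchySeq fun n => f (dyadicFloor n t) := fun {κ} hκ E _ f C hC hf t => by
    refine cauchySeq_of_le_tendsto_0 (fun n => C * (2 * (1 / 2 ^ n : ℝ)) ^ κ)
      (fun n p N hn hp => ?_) ?_
    · have hfl : ∀ n, (t : ℝ) - dyadicFloor n t ≤ 1 / 2 ^ n := fun n => by
        have := (Nat.lt_floor_add_one ((t : ℝ) * 2 ^ n)).le
        change (t : ℝ) - (⌊(t : ℝ) * 2 ^ n⌋₊ : ℝ) / 2 ^ n ≤ 1 / 2 ^ n
        rw [sub_le_iff_le_add', ← add_div, le_div_iff₀ (by positivity)]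
        exact this
      have hmono : ∀ {n}, N ≤ n → (1 / 2 ^ n : ℝ) ≤ 1 / 2 ^ N := fun h =>
        one_div_le_one_div_of_le (by positivity) (pow_le_pow_right₀ one_le_two h)
      have a1 := (hfl n).trans (hmono hn)
      have a2 := (hfl p).trans (hmono hp)
      have b1 : ((dyadicFloor n t : Time T) : ℝ) ≤ t := dyadicFloor_le n t
      have b2 : ((dyadicFloor p t : Time T) : ℝ) ≤ t := dyadicFloor_le p t
      have h0 : (0 : ℝ) < 1 / 2 ^ N := by positivity
      rw [dist_eq_norm]
      rcases le_total (dyadicFloor n t) (dyadicFloor p t) with h | h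
      · rw [norm_sub_rev]
        refine (hf _ (dyadicFloor_mem _ _) _ (dyadicFloor_mem _ _) h).trans ?_
        exact mul_le_mul_of_nonneg_left (Real.rpow_le_rpow (time_sub_nonneg h) (by linarith)
          hκ.le) hC
      · refine (hf _ (dyadicFloor_mem _ _) _ (dyadicFloor_mem _ _) h).trans ?_
        exact mul_le_mul_of_nonneg_left (Real.rpow_le_rpow (time_sub_nonneg h) (by linarith)
          hκ.le) hC
    · have h0 : Tendsto (fun n : ℕ => 2 * (1 / (2 : ℝ) ^ n)) atTop (𝓝 (2 * 0)) :=
        (Tendsto.div_atTop tendsto_const_nhds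
          (tendsto_pow_atTop_atTop_of_one_lt one_lt_two)).const_mul 2
      rw [mul_zero] at h0
      have := (h0.rpow_const (p := κ) (Or.inr hκ.le)).const_mul C
      rwa [Real.zero_rpow hκ.ne', mul_zero] at this
  have hW : ∀ t ω, ∃ l, Tendsto (fun n => G.indicator (Z (dyadicFloor n t)) ω) atTop (𝓝 l) :=
    fun t ω => by
      by_cases hω : ω ∈ G
      · simp only [Set.indicator_of_mem hω]
        exact cauchySeq_tendsto_of_complete (hcau hβ (fun s => Z s ω) C1 hC1
          (fun s hs t ht hst => (hω s hs t ht hst).1) t)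
      · simp only [Set.indicator_of_notMem hω]
        exact ⟨0, tendsto_const_nhds⟩
  have hW' : ∀ t ω, ∃ l, Tendsto (fun n => G.indicator (Z' (dyadicFloor n t)) ω) atTop (𝓝 l) :=
    fun t ω => by
      by_cases hω : ω ∈ G
      · simp only [Set.indicator_of_mem hω]
        exact cauchySeq_tendsto_of_complete (hcau hβ' (fun s => Z' s ω) C2 hC2
          (fun s hs t ht hst => (hω s hs t ht hst).2.1) t)
      · simp only [Set.indicator_of_notMem hω]
        exact ⟨0, tendsto_const_nhds⟩
  choose W hW using hW
  choose W' hW' using hW'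
  have hlen : ∀ {κ : ℝ}, 0 < κ → ∀ (C : ℝ) (s t : Time T), Tendsto
      (fun n => C * (((dyadicFloor n t : Time T) : ℝ) - dyadicFloor n s) ^ κ) atTop
      (𝓝 (C * ((t : ℝ) - s) ^ κ)) := fun {κ} hκ C s t =>
    (((((continuous_subtype_val.tendsto t).comp (tendsto_dyadicFloor t)).sub
      ((continuous_subtype_val.tendsto s).comp (tendsto_dyadicFloor s))).rpow_const
        (p := κ) (Or.inr hκ.le))).const_mul C
  refine ⟨W, W', C, by positivity, ⟨fun t ω => ?_, fun t ω => ?_, fun s t ω hst => ?_,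
    fun s t ω hst => ?_, fun s t ω hst => ?_⟩, fun t => ?_, fun t => ?_, fun t => ?_,
    fun t => ?_⟩
  · refine le_of_tendsto (hW t ω).norm (Eventually.of_forall fun n => ?_)
    by_cases hω : ω ∈ G
    · have := (hω _ (dyadicFloor_mem n t) _ (dyadicFloor_mem n t) le_rfl).2.2.2.1
      simp only [Set.indicator_of_mem hω]
      linarith
    · simp only [Set.indicator_of_notMem hω, norm_zero]; positivity
  · refine le_of_tendsto (hW' t ω).norm (Eventually.of_forall fun n => ?_)
    by_cases hω : ω ∈ G
    · have := (hω _ (dyadicFloor_mem n t) _ (dyadicFloor_mem n t) le_rfl).2.2.2.2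
      simp only [Set.indicator_of_mem hω]
      linarith
    · simp only [Set.indicator_of_notMem hω, norm_zero]; positivity
  · refine le_of_tendsto_of_tendsto ((hW t ω).sub (hW s ω)).norm (hlen hβ C s t)
      (Eventually.of_forall fun n => ?_)
    have hle := dyadicFloor_mono n hst
    by_cases hω : ω ∈ G
    · have := (hω _ (dyadicFloor_mem n s) _ (dyadicFloor_mem n t) hle).1
      simp only [Set.indicator_of_mem hω]
      exact this.trans (mul_le_mul_of_nonneg_right (by linarith) (hpos hle))
    · simp only [Set.indicator_of_notMem hω, sub_self, norm_zero]
      have := hpos (κ := β) hle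
      positivity
  · refine le_of_tendsto_of_tendsto ((hW' t ω).sub (hW' s ω)).norm (hlen hβ' C s t)
      (Eventually.of_forall fun n => ?_)
    have hle := dyadicFloor_mono n hst
    by_cases hω : ω ∈ G
    · have := (hω _ (dyadicFloor_mem n s) _ (dyadicFloor_mem n t) hle).2.1
      simp only [Set.indicator_of_mem hω]
      exact this.trans (mul_le_mul_of_nonneg_right (by linarith) (hpos hle))
    · simp only [Set.indicator_of_notMem hω, sub_self, norm_zero]
      have := hpos (κ := β') hle
      positivity
  · have hη : ∀ t, Tendsto (fun n => η.path (dyadicFloor n t)) atTop (𝓝 (η.path t)) := fun t =>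
      (η.continuous_path.tendsto t).comp (tendsto_dyadicFloor t)
    have hlim := ((hW t ω).sub (hW s ω)).sub ((((isBoundedBilinearMap_apply (𝕜 := ℝ)).continuous.tendsto
      (W' s ω, η.path t - η.path s)).comp ((hW' s ω).prodMk_nhds ((hη t).sub (hη s)))))
    refine le_of_tendsto_of_tendsto hlim.norm (hlen (add_pos hβ hβ') C s t)
      (Eventually.of_forall fun n => ?_)
    have hle := dyadicFloor_mono n hst
    change ‖G.indicator (Z (dyadicFloor n t)) ω - G.indicator (Z (dyadicFloor n s)) ω
      - G.indicator (Z' (dyadicFloor n s)) ω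
        (η.path (dyadicFloor n t) - η.path (dyadicFloor n s))‖ ≤ _
    by_cases hω : ω ∈ G
    · have := (hω _ (dyadicFloor_mem n s) _ (dyadicFloor_mem n t) hle).2.2.1
      simp only [Set.indicator_of_mem hω]
      exact this.trans (mul_le_mul_of_nonneg_right (by linarith) (hpos hle))
    · simp only [Set.indicator_of_notMem hω, sub_self, zero_apply, norm_zero]
      have := hpos (κ := β + β') hle
      positivity
  · exact stronglyMeasurable_of_tendsto atTop (fun n =>
      ((hZ.progressive.stronglyAdapted _).mono (ℱ.mono (dyadicFloor_le n t))).indicator (hGm t))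
      (tendsto_pi_nhds.2 fun ω => hW t ω)
  · exact stronglyMeasurable_of_tendsto atTop (fun n =>
      ((hZ.progressive'.stronglyAdapted _).mono (ℱ.mono (dyadicFloor_le n t))).indicator (hGm t))
      (tendsto_pi_nhds.2 fun ω => hW' t ω)
  -- For fixed `t` the countably many bounds between `t` and its dyadic approximations hold almost
  -- surely, so the dyadic limit is `Z t`.
  · have hd : ∀ᵐ ω ∂μ, ∀ n, ‖Z t ω - Z (dyadicFloor n t) ω‖
        ≤ C1 * ((t : ℝ) - dyadicFloor n t) ^ β :=
      ae_all_iff.2 fun n => h1' _ _ (dyadicFloor_le n t)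
    filter_upwards [hGae, hd] with ω hω hd
    refine tendsto_nhds_unique (hW t ω) ?_
    simp only [Set.indicator_of_mem hω]
    refine tendsto_iff_norm_sub_tendsto_zero.2 (squeeze_zero (fun _ => norm_nonneg _)
      (fun n => ?_) (hdist hβ C1 t))
    rw [norm_sub_rev]; exact hd n
  · have hd : ∀ᵐ ω ∂μ, ∀ n, ‖Z' t ω - Z' (dyadicFloor n t) ω‖
        ≤ C2 * ((t : ℝ) - dyadicFloor n t) ^ β' :=
      ae_all_iff.2 fun n => h2' _ _ (dyadicFloor_le n t)
    filter_upwards [hGae, hd] with ω hω hd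
    refine tendsto_nhds_unique (hW' t ω) ?_
    simp only [Set.indicator_of_mem hω]
    refine tendsto_iff_norm_sub_tendsto_zero.2 (squeeze_zero (fun _ => norm_nonneg _)
      (fun n => ?_) (hdist hβ' C2 t))
    rw [norm_sub_rev]; exact hd n

end Modification

/-! ### Integrals over time and Grönwall's inequality. -/

section TimeIntegral

variable {T : ℝ} {E : Type*} [NormedAddCommGroup E] [NormedSpace ℝ E]

theorem map_timeMeasure (T : ℝ) :
    (timeMeasure T).map (Subtype.val : Time T → ℝ) = volume.restrict (Set.Icc 0 T) :=
  map_comap_subtype_coe measurableSet_Icc _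

theorem timeMeasure_preimage {B : Set ℝ} (hB : MeasurableSet B) :
    timeMeasure T (Subtype.val ⁻¹' B) = volume (B ∩ Set.Icc 0 T) := by
  rw [← Measure.restrict_apply hB, ← map_timeMeasure,
    Measure.map_apply measurable_subtype_coe hB]

theorem timeMeasure_Ioc (s t : Time T) :
    timeMeasure T (Set.Ioc s t) = ENNReal.ofReal ((t : ℝ) - s) := by
  have : Set.Ioc s t = Subtype.val ⁻¹' Set.Ioc (s : ℝ) t := rfl
  rw [this, timeMeasure_preimage measurableSet_Ioc, Set.inter_eq_left.2, Real.volume_Ioc]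
  exact fun x hx => ⟨s.2.1.trans hx.1.le, hx.2.trans t.2.2⟩

instance isFiniteMeasure_timeMeasure : IsFiniteMeasure (timeMeasure T) := by
  constructor
  have := timeMeasure_preimage (T := T) MeasurableSet.univ
  rw [Set.preimage_univ] at this
  rw [this]
  exact (measure_mono Set.inter_subset_right).trans_lt measure_Icc_lt_top

theorem timeMeasure_Iic_zero {s : Time T} (hs : (s : ℝ) = 0) : timeMeasure T (Set.Iic s) = 0 := by
  have : Set.Iic s = Subtype.val ⁻¹' Set.Iic (s : ℝ) := rfl
  rw [this, timeMeasure_preimage measurableSet_Iic, hs]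
  refine measure_mono_null (t := {(0 : ℝ)}) (fun x hx => le_antisymm hx.1 hx.2.1) ?_
  simp

theorem setIntegral_Iic_sub {f : Time T → E} (hf : Integrable f (timeMeasure T)) {s t : Time T}
    (hst : s ≤ t) : ∫ r in Set.Iic t, f r ∂timeMeasure T - ∫ r in Set.Iic s, f r ∂timeMeasure T
      = ∫ r in Set.Ioc s t, f r ∂timeMeasure T := by
  rw [← Set.Iic_union_Ioc_eq_Iic hst, setIntegral_union (Set.Iic_disjoint_Ioc le_rfl)
    measurableSet_Ioc hf.integrableOn hf.integrableOn]
  abel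

theorem norm_setIntegral_Ioc_le {f : Time T → E} {B : ℝ} {s t : Time T} (hst : s ≤ t)
    (hf : ∀ r ∈ Set.Ioc s t, ‖f r‖ ≤ B) :
    ‖∫ r in Set.Ioc s t, f r ∂timeMeasure T‖ ≤ B * ((t : ℝ) - s) := by
  have h := norm_setIntegral_le_of_norm_le_const (μ := timeMeasure T)
    (by rw [timeMeasure_Ioc]; exact ENNReal.ofReal_lt_top) hf
  rwa [measureReal_def, timeMeasure_Ioc, ENNReal.toReal_ofReal (time_sub_nonneg hst)] at h

/-- Integration gains the factor `1 / c` in the exponentially weighted norm. With `c = 2 * L` a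
Lipschitz integral operator becomes a contraction with factor `1 / 2` on the whole of `[0, T]`. -/
theorem setIntegral_exp_le {c : ℝ} (hc : 0 < c) (t : Time T) :
    ∫ r in Set.Iic t, Real.exp (c * r) ∂timeMeasure T ≤ Real.exp (c * t) / c := by
  have h1 : ∫ r in Set.Iic t, Real.exp (c * r) ∂timeMeasure T
      = ∫ x in Set.Ioc (0 : ℝ) t, Real.exp (c * x) := by
    have e : Set.Iic t = Subtype.val ⁻¹' Set.Iic (t : ℝ) := rfl
    have h := setIntegral_map (μ := timeMeasure T) (g := (Subtype.val : Time T → ℝ))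
      (f := fun x => Real.exp (c * x)) (measurableSet_Iic (a := (t : ℝ)))
      (by fun_prop) measurable_subtype_coe.aemeasurable
    rw [e, ← h, map_timeMeasure, Measure.restrict_restrict measurableSet_Iic]
    rw [← integral_Icc_eq_integral_Ioc]
    congr 2
    ext x
    exact ⟨fun hx => ⟨hx.2.1, hx.1⟩, fun hx => ⟨hx.2, hx.1, hx.2.trans t.2.2⟩⟩
  rw [h1, ← intervalIntegral.integral_of_le t.2.1, intervalIntegral.integral_comp_mul_left _ hc.ne',
    integral_exp, smul_eq_mul, mul_zero, Real.exp_zero, div_eq_inv_mul]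
  have : 0 ≤ c⁻¹ := by positivity
  nlinarith

theorem norm_setIntegral_Iic_le_exp {f : Time T → E} {c S : ℝ} (hc : 0 < c) (hS : 0 ≤ S)
    {t : Time T} (hf : ∀ r ≤ t, ‖f r‖ ≤ S * Real.exp (c * r)) :
    ‖∫ r in Set.Iic t, f r ∂timeMeasure T‖ ≤ S * (Real.exp (c * t) / c) := by
  have hint : IntegrableOn (fun r : Time T => S * Real.exp (c * r)) (Set.Iic t)
      (timeMeasure T) := by
    refine (Continuous.integrable_of_hasCompactSupport (by fun_prop) ?_).integrableOn
    exact HasCompactSupport.of_compactSpace _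
  refine (norm_integral_le_of_norm_le hint ((ae_restrict_iff' measurableSet_Iic).2
    (Eventually.of_forall fun r hr => hf r hr))).trans ?_
  rw [integral_const_mul]
  exact mul_le_mul_of_nonneg_left (setIntegral_exp_le hc t) hS

/-- Grönwall's inequality in integral form. -/
theorem gronwall_integral (hT : 0 ≤ T) {f : Time T → ℝ} (hf : Continuous f)
    (hf0 : ∀ t, 0 ≤ f t) {A L : ℝ}
    (hA : 0 ≤ A) (hL : 0 < L)
    (h : ∀ t, f t ≤ A + L * ∫ r in Set.Iic t, f r ∂timeMeasure T) (t : Time T) :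
    f t ≤ 2 * A * Real.exp (2 * L * T) := by
  have : Nonempty (Time T) := ⟨⟨0, le_rfl, hT⟩⟩
  -- Let `S` be the maximum of `f` against the weight `exp (-2 L r)`. Evaluating the hypothesis
  -- where it is attained gives `S ≤ A + S / 2`.
  obtain ⟨t0, ht0⟩ := (by fun_prop : Continuous fun r : Time T =>
    Real.exp (-(2 * L * r)) * f r).exists_forall_ge_of_hasCompactSupport
      (HasCompactSupport.of_compactSpace _)
  set S := Real.exp (-(2 * L * t0)) * f t0 with hS
  have hS0 : 0 ≤ S := mul_nonneg (Real.exp_pos _).le (hf0 _)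
  have hfS : ∀ r, f r ≤ S * Real.exp (2 * L * r) := fun r => by
    have := mul_le_mul_of_nonneg_right (ht0 r) (Real.exp_pos (2 * L * r)).le
    rwa [mul_right_comm, ← Real.exp_add, neg_add_cancel, Real.exp_zero, one_mul] at this
  have h1 := norm_setIntegral_Iic_le_exp (f := f) (t := t0) (c := 2 * L) (by positivity) hS0
    fun r _ => by rw [Real.norm_of_nonneg (hf0 r)]; exact hfS r
  have h2 := (h t0).trans (add_le_add le_rfl (mul_le_mul_of_nonneg_left
    ((le_abs_self _).trans h1) hL.le))
  have h3 : L * (S * (Real.exp (2 * L * t0) / (2 * L))) = S / 2 * Real.exp (2 * L * t0) := by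
    field_simp
  rw [h3] at h2
  have h4 : S ≤ A + S / 2 := by
    have h5 := mul_le_mul_of_nonneg_left h2 (Real.exp_pos (-(2 * L * t0))).le
    rw [← hS, mul_add, mul_left_comm, ← Real.exp_add, neg_add_cancel, Real.exp_zero, mul_one] at h5
    have h6 : Real.exp (-(2 * L * t0)) ≤ 1 := Real.exp_le_one_iff.2 (by
      have := t0.2.1
      have : 0 ≤ 2 * L * (t0 : ℝ) := by positivity
      linarith)
    nlinarith
  calc f t ≤ S * Real.exp (2 * L * t) := hfS t
    _ ≤ 2 * A * Real.exp (2 * L * T) := by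
        have := t.2.2
        gcongr
        linarith

end TimeIntegral

/-! ### Picard iteration for random integral equations. -/

section Picard

theorem stronglyMeasurable_integral_left {A B E : Type*} {mA : MeasurableSpace A}
    {mB : MeasurableSpace B} [NormedAddCommGroup E] [NormedSpace ℝ E] (ν : Measure A) [SFinite ν]
    {f : A × B → E} (hf : StronglyMeasurable f) : StronglyMeasurable fun b => ∫ a, f (a, b) ∂ν :=
  hf.integral_prod_left'

variable {T : ℝ} {k : ℕ} {Ω : Type*} {mΩ : MeasurableSpace Ω}

theorem IsStronglyProgressive.stronglyMeasurable_path {ℱ : Filtration (Time T) mΩ} {E : Type*}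
    [NormedAddCommGroup E] (hT : 0 ≤ T) {h : Time T → Ω → E}
    (hh : IsStronglyProgressive ℱ h) (ω : Ω) : StronglyMeasurable fun r => h r ω := by
  have h1 := hh ⟨T, hT, le_rfl⟩
  exact h1.comp_measurable (g := fun r : Time T => ((⟨r, r.2.2⟩ : Set.Iic (⟨T, hT, le_rfl⟩ : Time T)), ω))
    (Measurable.prodMk (measurable_id.subtype_mk) measurable_const)

theorem IsStronglyProgressive.stronglyMeasurable_setIntegral {ℱ : Filtration (Time T) mΩ}
    {E : Type*} [NormedAddCommGroup E] [NormedSpace ℝ E] {h : Time T → Ω → E}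
    (hh : IsStronglyProgressive ℱ h) (t : Time T) :
    StronglyMeasurable[ℱ t] fun ω => ∫ r in Set.Iic t, h r ω ∂timeMeasure T := by
  have e : (fun ω => ∫ r in Set.Iic t, h r ω ∂timeMeasure T)
      = fun ω => ∫ r : Set.Iic t, h r ω ∂(Measure.comap Subtype.val (timeMeasure T)) := by
    funext ω
    exact (integral_subtype_comap measurableSet_Iic (fun r => h r ω)).symm
  rw [e]
  have : IsFiniteMeasure (Measure.comap (Subtype.val : Set.Iic t → Time T) (timeMeasure T)) := by
    infer_instance
  exact @stronglyMeasurable_integral_left _ _ _ _ (ℱ t) _ _ _ _ _ (hh t)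

theorem ProgressiveField.isStronglyProgressive {ℱ : Filtration (Time T) mΩ}
    {g : Time T → Ω → EuclideanSpace ℝ (Fin k) → EuclideanSpace ℝ (Fin k)}
    (hg : ProgressiveField ℱ g) {M : Time T → Ω → EuclideanSpace ℝ (Fin k)}
    (hM : IsStronglyProgressive ℱ M) : IsStronglyProgressive ℱ fun r ω => g r ω (M r ω) := by
  intro t
  have h1 := (hM t).measurable
  refine Measurable.stronglyMeasurable ?_
  exact Measurable.comp (hg t) (Measurable.prodMk measurable_fst
    (Measurable.prodMk measurable_snd h1))

variable {g : Time T → Ω → EuclideanSpace ℝ (Fin k) → EuclideanSpace ℝ (Fin k)}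
  {ξ : Ω → EuclideanSpace ℝ (Fin k)}

/-- The Picard iterates of an integral equation. -/
def picard (g : Time T → Ω → EuclideanSpace ℝ (Fin k) → EuclideanSpace ℝ (Fin k))
    (ξ : Ω → EuclideanSpace ℝ (Fin k)) : ℕ → Time T → Ω → EuclideanSpace ℝ (Fin k)
  | 0 => fun _ ω => ξ ω
  | n + 1 => fun t ω => ξ ω + ∫ r in Set.Iic t, g r ω (picard g ξ n r ω) ∂timeMeasure T

theorem exists_bound_of_continuous {E : Type*} [NormedAddCommGroup E] {f : Time T → E}
    (hf : Continuous f) : ∃ B : ℝ, 0 ≤ B ∧ ∀ t, ‖f t‖ ≤ B := by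
  obtain ⟨B, hB⟩ := (isCompact_range hf).isBounded.exists_norm_le
  exact ⟨|B|, abs_nonneg B, fun t => (hB _ ⟨t, rfl⟩).trans (le_abs_self B)⟩

/-- An integral equation with progressively measurable Lipschitz coefficient has a continuous
adapted solution. -/
theorem exists_integral_equation_solution (hT : 0 < T) {ℱ : Filtration (Time T) mΩ}
    (hg : ProgressiveField ℱ g) {L : ℝ} (hL : 0 < L)
    (hgrow : ∀ t ω x, ‖g t ω x‖ ≤ L * (1 + ‖x‖))
    (hlip : ∀ t ω x y, ‖g t ω x - g t ω y‖ ≤ L * ‖x - y‖)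
    (hξ : ∀ t, StronglyMeasurable[ℱ t] ξ) :
    ∃ M : Time T → Ω → EuclideanSpace ℝ (Fin k), (∀ ω, Continuous fun t => M t ω) ∧
      StronglyAdapted ℱ M ∧ (∀ ω, Integrable (fun r => g r ω (M r ω)) (timeMeasure T)) ∧
      (∀ t ω, M t ω = ξ ω + ∫ r in Set.Iic t, g r ω (M r ω) ∂timeMeasure T) ∧
      ∀ t ω, ‖M t ω‖ ≤ 2 * (‖ξ ω‖ + L * T) * Real.exp (2 * L * T) := by
  have hint : ∀ {N : Time T → Ω → EuclideanSpace ℝ (Fin k)}, (∀ ω, Continuous fun t => N t ω) →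
      StronglyAdapted ℱ N → ∀ ω, Integrable (fun r => g r ω (N r ω)) (timeMeasure T) :=
    fun {N} hNc hNa ω => by
      obtain ⟨B, hB0, hB⟩ := exists_bound_of_continuous (hNc ω)
      have hp := hg.isStronglyProgressive (hNa.isStronglyProgressive_of_continuous hNc)
      refine Integrable.of_bound
        (IsStronglyProgressive.stronglyMeasurable_path hT.le hp ω).aestronglyMeasurable
        (L * (1 + B)) (Eventually.of_forall fun r => (hgrow _ _ _).trans ?_)
      have := hB r
      gcongr
  have hcont : ∀ {N : Time T → Ω → EuclideanSpace ℝ (Fin k)}, (∀ ω, Continuous fun t => N t ω) →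
      StronglyAdapted ℱ N → ∀ ω, Continuous fun t =>
        ξ ω + ∫ r in Set.Iic t, g r ω (N r ω) ∂timeMeasure T := fun {N} hNc hNa ω => by
      obtain ⟨B, hB0, hB⟩ := exists_bound_of_continuous (hNc ω)
      refine continuous_of_holder (C := L * (1 + B)) one_pos fun s t hst => ?_
      rw [add_sub_add_left_eq_sub, setIntegral_Iic_sub (hint hNc hNa ω) hst, Real.rpow_one]
      refine norm_setIntegral_Ioc_le hst fun r _ => (hgrow _ _ _).trans ?_
      have := hB r
      gcongr
  have hP : ∀ n, (∀ ω, Continuous fun t => picard g ξ n t ω) ∧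
      StronglyAdapted ℱ (picard g ξ n) := fun n => by
    induction n with
    | zero => exact ⟨fun _ => continuous_const, hξ⟩
    | succ n ih =>
      refine ⟨hcont ih.1 ih.2, fun t => ?_⟩
      have hp := hg.isStronglyProgressive (ih.2.isStronglyProgressive_of_continuous ih.1)
      exact (hξ t).add (IsStronglyProgressive.stronglyMeasurable_setIntegral hp t)
  -- The contraction estimate: one iteration halves the distance in the norm with weight `exp (2 L
  -- t)`.
  have hdiff : ∀ {N N' : Time T → Ω → EuclideanSpace ℝ (Fin k)} {S : ℝ} {ω : Ω},
      (∀ ω, Continuous fun t => N t ω) → StronglyAdapted ℱ N →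
      (∀ ω, Continuous fun t => N' t ω) → StronglyAdapted ℱ N' → 0 ≤ S →
      (∀ r, ‖N r ω - N' r ω‖ ≤ S * Real.exp (2 * L * r)) → ∀ t,
      ‖∫ r in Set.Iic t, g r ω (N r ω) ∂timeMeasure T
        - ∫ r in Set.Iic t, g r ω (N' r ω) ∂timeMeasure T‖ ≤ S / 2 * Real.exp (2 * L * t) :=
    fun {N N' S ω} h1 h2 h3 h4 hS h t => by
      rw [← integral_sub (hint h1 h2 ω).integrableOn (hint h3 h4 ω).integrableOn]
      refine (norm_setIntegral_Iic_le_exp (c := 2 * L) (S := L * S) (by positivity)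
        (by positivity) fun r _ => ?_).trans (le_of_eq (by field_simp))
      refine (hlip _ _ _ _).trans ?_
      rw [mul_assoc]
      exact mul_le_mul_of_nonneg_left (h r) hL.le
  have hexp1 : ∀ t : Time T, 1 ≤ Real.exp (2 * L * t) := fun t =>
    Real.one_le_exp (by have := t.2.1; positivity)
  have hexpT : ∀ t : Time T, Real.exp (2 * L * t) ≤ Real.exp (2 * L * T) := fun t => by
    have := t.2.2
    gcongr
  -- A bound for the first Picard increment, which starts the geometric series.
  set D : Ω → ℝ := fun ω => L * (1 + ‖ξ ω‖) * T with hD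
  have hD0 : ∀ ω, 0 ≤ D ω := fun ω => by positivity
  have hstep : ∀ n t ω, ‖picard g ξ n t ω - picard g ξ (n + 1) t ω‖
      ≤ D ω / 2 ^ n * Real.exp (2 * L * t) := fun n => by
    induction n with
    | zero =>
      intro t ω
      have hz : ((⟨0, le_rfl, hT.le⟩ : Time T) : ℝ) = 0 := rfl
      have hle : (⟨0, le_rfl, hT.le⟩ : Time T) ≤ t := Subtype.coe_le_coe.1 t.2.1
      have e := setIntegral_Iic_sub (hint (hP 0).1 (hP 0).2 ω) hle
      rw [setIntegral_measure_zero _ (timeMeasure_Iic_zero hz), sub_zero] at e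
      have hb := norm_setIntegral_Ioc_le (f := fun r => g r ω (picard g ξ 0 r ω)) hle
        fun r _ => hgrow r ω (ξ ω)
      rw [← e] at hb
      rw [pow_zero, div_one, norm_sub_rev]
      simp only [picard, add_sub_cancel_left] at hb ⊢
      refine hb.trans ?_
      have h1 := time_sub_le (⟨0, le_rfl, hT.le⟩ : Time T) t
      calc L * (1 + ‖ξ ω‖) * ((t : ℝ) - 0) ≤ D ω * 1 := by
            rw [mul_one]; exact mul_le_mul_of_nonneg_left h1 (by positivity)
        _ ≤ _ := mul_le_mul_of_nonneg_left (hexp1 t) (hD0 ω)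
    | succ n ih =>
      intro t ω
      have h := hdiff (hP n).1 (hP n).2 (hP (n + 1)).1 (hP (n + 1)).2
        (div_nonneg (hD0 ω) (by positivity)) (fun r => ih r ω) t
      rw [picard, picard, add_sub_add_left_eq_sub]
      refine h.trans (le_of_eq ?_)
      rw [pow_succ, div_div]
  have hgeo : ∀ t ω n, dist (picard g ξ n t ω) (picard g ξ (n + 1) t ω)
      ≤ (2 * (D ω * Real.exp (2 * L * T))) / 2 / 2 ^ n := fun t ω n => by
    rw [dist_eq_norm]
    refine (hstep n t ω).trans ?_
    calc D ω / 2 ^ n * Real.exp (2 * L * t) ≤ D ω / 2 ^ n * Real.exp (2 * L * T) :=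
          mul_le_mul_of_nonneg_left (hexpT t) (div_nonneg (hD0 ω) (by positivity))
      _ = _ := by ring
  choose M hM using fun t ω => cauchySeq_tendsto_of_complete
    (cauchySeq_of_le_geometric_two (hgeo t ω))
  have hrate : ∀ t ω n, ‖picard g ξ n t ω - M t ω‖
      ≤ 2 * (D ω * Real.exp (2 * L * T)) / 2 ^ n := fun t ω n => by
    rw [← dist_eq_norm]
    exact dist_le_of_le_geometric_two_of_tendsto (hgeo t ω) (hM t ω) n
  have hrate0 : ∀ ω, Tendsto (fun n : ℕ => 2 * (D ω * Real.exp (2 * L * T)) / (2 : ℝ) ^ n) atTop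
      (𝓝 0) := fun ω => Tendsto.div_atTop tendsto_const_nhds
    (tendsto_pow_atTop_atTop_of_one_lt one_lt_two)
  have hMc : ∀ ω, Continuous fun t => M t ω := fun ω => by
    refine TendstoUniformly.continuous (F := fun n t => picard g ξ n t ω) (p := atTop) ?_
      (Frequently.of_forall fun n => (hP n).1 ω)
    rw [Metric.tendstoUniformly_iff]
    intro ε hε
    filter_upwards [(hrate0 ω).eventually_lt_const hε] with n hn t
    rw [dist_comm, dist_eq_norm]
    exact (hrate t ω n).trans_lt hn
  have hMa : StronglyAdapted ℱ M := fun t =>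
    stronglyMeasurable_of_tendsto atTop (fun n => (hP n).2 t) (tendsto_pi_nhds.2 fun ω => hM t ω)
  have hMeq : ∀ t ω, M t ω = ξ ω + ∫ r in Set.Iic t, g r ω (M r ω) ∂timeMeasure T := fun t ω => by
    have h1 : Tendsto (fun n => picard g ξ (n + 1) t ω) atTop (𝓝 (M t ω)) :=
      (hM t ω).comp (tendsto_add_atTop_nat 1)
    refine tendsto_nhds_unique h1 ?_
    simp only [picard]
    refine tendsto_const_nhds.add (tendsto_iff_norm_sub_tendsto_zero.2 ?_)
    have h2 : Tendsto (fun n : ℕ => 2 * (D ω * Real.exp (2 * L * T)) / (2 : ℝ) ^ n / 2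
        * Real.exp (2 * L * t)) atTop (𝓝 0) := by
      simpa using ((hrate0 ω).div_const 2).mul_const (Real.exp (2 * L * t))
    refine squeeze_zero (fun _ => norm_nonneg _) (fun n => ?_) h2
    have hS : 0 ≤ 2 * (D ω * Real.exp (2 * L * T)) / 2 ^ n := by have := hD0 ω; positivity
    refine hdiff (hP n).1 (hP n).2 hMc hMa hS (fun r => (hrate r ω n).trans ?_) t
    exact le_mul_of_one_le_right hS (hexp1 r)
  refine ⟨M, hMc, hMa, hint hMc hMa, hMeq, fun t ω => ?_⟩
  refine gronwall_integral hT.le (hMc ω).norm (fun _ => norm_nonneg _) (by positivity) hL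
    (fun t => ?_) t
  have hMint : Integrable (fun r => ‖M r ω‖) (timeMeasure T) :=
    (hMc ω).norm.integrable_of_hasCompactSupport (HasCompactSupport.of_compactSpace _)
  have h1 : ‖∫ r in Set.Iic t, g r ω (M r ω) ∂timeMeasure T‖
      ≤ ∫ r in Set.Iic t, (L + L * ‖M r ω‖) ∂timeMeasure T := by
    refine norm_integral_le_of_norm_le ((integrable_const L).add (hMint.const_mul L)).integrableOn
      (Eventually.of_forall fun r => (hgrow _ _ _).trans (le_of_eq (by ring)))
  rw [integral_add (integrable_const L) (hMint.const_mul L).integrableOn, integral_const_mul] at h1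
  have hz : ((⟨0, le_rfl, hT.le⟩ : Time T) : ℝ) = 0 := rfl
  have hle : (⟨0, le_rfl, hT.le⟩ : Time T) ≤ t := Subtype.coe_le_coe.1 t.2.1
  have h2 : ∫ r in Set.Iic t, L ∂timeMeasure T ≤ L * T := by
    have e := setIntegral_Iic_sub (T := T) (integrable_const L) hle
    rw [setIntegral_measure_zero _ (timeMeasure_Iic_zero hz), sub_zero] at e
    rw [e]
    refine (Real.le_norm_self _).trans ((norm_setIntegral_Ioc_le hle (B := L) fun r _ => ?_).trans ?_)
    · rw [Real.norm_of_nonneg hL.le]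
    · exact mul_le_mul_of_nonneg_left (time_sub_le _ _) hL.le
  have h3 : ‖M t ω‖ ≤ ‖ξ ω‖ + ‖∫ r in Set.Iic t, g r ω (M r ω) ∂timeMeasure T‖ := by
    rw [hMeq t ω]; exact norm_add_le _ _
  linarith

end Picard

/-! ### Variation of constants and controlled-path estimates. -/

section PathwiseSolution

variable {α T : ℝ} {d k : ℕ} {Ω : Type*} {mΩ : MeasurableSpace Ω}
  {η : RoughPath α T d}
  {F : Time T → Ω → (EuclideanSpace ℝ (Fin k) →L[ℝ]
      EuclideanSpace ℝ (Fin d) →L[ℝ] EuclideanSpace ℝ (Fin k))}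
  {F' : Time T → Ω → (EuclideanSpace ℝ (Fin d) →L[ℝ] EuclideanSpace ℝ (Fin k) →L[ℝ]
      EuclideanSpace ℝ (Fin d) →L[ℝ] EuclideanSpace ℝ (Fin k))}
  {U V : Time T → Ω → (EuclideanSpace ℝ (Fin k) →L[ℝ] EuclideanSpace ℝ (Fin k))}
  {b : Time T → Ω → EuclideanSpace ℝ (Fin k) → EuclideanSpace ℝ (Fin k)}
  {ξ : Ω → EuclideanSpace ℝ (Fin k)} {X : Time T → Ω → EuclideanSpace ℝ (Fin k)}
  {θ K : ℝ}

/-- A bounded continuous adapted process that solves a rough equation with drift `b` pathwise: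
its increments agree with the drift and the germ of the rough integral up to an error of order
`θ`. -/
structure IsPathwiseSolution (ℱ : Filtration (Time T) mΩ) (η : RoughPath α T d) (θ B : ℝ)
    (b : Time T → Ω → EuclideanSpace ℝ (Fin k) → EuclideanSpace ℝ (Fin k))
    (F : Time T → Ω → (EuclideanSpace ℝ (Fin k) →L[ℝ]
      EuclideanSpace ℝ (Fin d) →L[ℝ] EuclideanSpace ℝ (Fin k)))
    (F' : Time T → Ω → (EuclideanSpace ℝ (Fin d) →L[ℝ] EuclideanSpace ℝ (Fin k) →L[ℝ]
      EuclideanSpace ℝ (Fin d) →L[ℝ] EuclideanSpace ℝ (Fin k)))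
    (X : Time T → Ω → EuclideanSpace ℝ (Fin k)) : Prop where
  continuous : ∀ ω, Continuous fun t => X t ω
  adapted : StronglyAdapted ℱ X
  bound : ∀ t ω, ‖X t ω‖ ≤ B
  drift_bound : ∀ t ω, ‖b t ω (X t ω)‖ ≤ B
  integrable : ∀ ω, Integrable (fun r => b r ω (X r ω)) (timeMeasure T)
  expansion : ∀ s t ω, s ≤ t →
    ‖X t ω - X s ω - ∫ r in Set.Ioc s t, b r ω (X r ω) ∂timeMeasure T
      - germ η (integrand F X) (integrand' F F' X) s t ω‖ ≤ B * ((t : ℝ) - s) ^ θ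

theorem progressive_of_continuous_adapted {ℱ : Filtration (Time T) mΩ} {E : Type*}
    [NormedAddCommGroup E] {Z : Time T → Ω → E} (hc : ∀ ω, Continuous fun t => Z t ω)
    (ha : ∀ t, StronglyMeasurable[ℱ t] (Z t)) : IsStronglyProgressive ℱ Z :=
  StronglyAdapted.isStronglyProgressive_of_continuous (f := ℱ) ha hc

/-- Variation of constants: the linear flow and Picard iteration give a pathwise solution. -/
theorem exists_pathwise_solution (hT : 0 < T) {ℱ : Filtration (Time T) mΩ} (hα : 0 < α)
    (hθα : θ ≤ 1 + α) (hθ : 0 ≤ θ) (hK : 0 ≤ K) (hflow : IsLinearFlow ℱ η θ K F F' U V)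
    (hb : ProgressiveField ℱ b) {L : ℝ} (hL : 0 < L)
    (hgrow : ∀ t ω x, ‖b t ω x‖ ≤ L * (1 + ‖x‖))
    (hlip : ∀ t ω x y, ‖b t ω x - b t ω y‖ ≤ L * ‖x - y‖)
    (hξ : ∀ t, StronglyMeasurable[ℱ t] ξ) {R : ℝ} (hR : ∀ ω, ‖ξ ω‖ ≤ R) :
    ∃ X B, 0 ≤ B ∧ IsPathwiseSolution ℱ η θ B b F F' X ∧
      ∀ (t : Time T) ω, (t : ℝ) = 0 → X t ω = ξ ω := by
  have hUc : ∀ ω, Continuous fun t => U t ω := fun ω =>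
    continuous_of_holder hα fun s t hst => hflow.holder s t ω hst
  have hVc : ∀ ω, Continuous fun t => V t ω := fun ω =>
    continuous_of_holder hα fun s t hst => hflow.holder_inv s t ω hst
  have hUp := progressive_of_continuous_adapted hUc hflow.adapted
  have hVp := progressive_of_continuous_adapted hVc hflow.adapted_inv
  -- The drift in the coordinates `M = V X`, in which the rough part has disappeared.
  set g : Time T → Ω → EuclideanSpace ℝ (Fin k) → EuclideanSpace ℝ (Fin k) :=
    fun r ω x => V r ω (b r ω (U r ω x)) with hg
  have happ : Continuous fun p : (EuclideanSpace ℝ (Fin k) →L[ℝ] EuclideanSpace ℝ (Fin k)) ×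
      EuclideanSpace ℝ (Fin k) => p.1 p.2 := isBoundedBilinearMap_apply.continuous
  have hgm : ProgressiveField ℱ g := fun t => by
    have h1 := (hUp t).measurable
    have h2 := (hVp t).measurable
    have hproj : Measurable[(inferInstance : MeasurableSpace (Set.Iic t)).prod
        ((ℱ t).prod (inferInstance : MeasurableSpace (EuclideanSpace ℝ (Fin k)))),
        (inferInstance : MeasurableSpace (Set.Iic t)).prod (ℱ t)]
        (fun q : Set.Iic t × Ω × EuclideanSpace ℝ (Fin k) => (q.1, q.2.1)) :=
      Measurable.prodMk measurable_fst (measurable_fst.comp measurable_snd)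
    have h3 := h1.comp hproj
    have h4 := h2.comp hproj
    have h5 := happ.measurable.comp (h3.prodMk (measurable_snd.comp measurable_snd))
    have h6 := (hb t).comp (Measurable.prodMk measurable_fst
      (Measurable.prodMk (measurable_fst.comp measurable_snd) h5))
    exact happ.measurable.comp (h4.prodMk h6)
  have hgV : ∀ t ω x, ‖V t ω x‖ ≤ (K + 1) * ‖x‖ := fun t ω x =>
    ((V t ω).le_opNorm x).trans (mul_le_mul_of_nonneg_right
      ((hflow.bound_inv t ω).trans (by linarith)) (norm_nonneg _))
  have hgU : ∀ t ω x, ‖U t ω x‖ ≤ (K + 1) * ‖x‖ := fun t ω x =>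
    ((U t ω).le_opNorm x).trans (mul_le_mul_of_nonneg_right
      ((hflow.bound t ω).trans (by linarith)) (norm_nonneg _))
  -- `K + 1` in place of `K` keeps the constant positive and lets the `1` of the growth bound be
  -- absorbed.
  set L' := (K + 1) * L * (K + 1) with hL'
  have hL'0 : 0 < L' := by positivity
  have hggrow : ∀ t ω x, ‖g t ω x‖ ≤ L' * (1 + ‖x‖) := fun t ω x => by
    calc ‖g t ω x‖ ≤ (K + 1) * (L * (1 + (K + 1) * ‖x‖)) := by
          refine (hgV _ _ _).trans ?_
          gcongr
          refine (hgrow _ _ _).trans ?_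
          gcongr
          exact hgU _ _ _
      _ ≤ (K + 1) * (L * ((K + 1) * (1 + ‖x‖))) := by
          gcongr
          linarith
      _ = _ := by rw [hL']; ring
  have hglip : ∀ t ω x y, ‖g t ω x - g t ω y‖ ≤ L' * ‖x - y‖ := fun t ω x y => by
    calc ‖g t ω x - g t ω y‖ ≤ (K + 1) * (L * ((K + 1) * ‖x - y‖)) := by
          rw [hg, ← map_sub]
          refine (hgV _ _ _).trans ?_
          gcongr
          refine (hlip _ _ _ _).trans ?_
          gcongr
          rw [← map_sub]
          exact hgU _ _ _
      _ = _ := by rw [hL']; ring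
  obtain ⟨M, hMc, hMa, hMi, hMeq, hMb⟩ :=
    exists_integral_equation_solution hT hgm hL'0 hggrow hglip hξ
  set BM := 2 * (R + L' * T) * Real.exp (2 * L' * T) with hBM
  have hMB : ∀ t ω, ‖M t ω‖ ≤ BM := fun t ω => (hMb t ω).trans (by
    have := hR ω
    rw [hBM]; gcongr)
  -- The sign of the bound `BM` is read off from the value of a norm, which needs an outcome.
  rcases isEmpty_or_nonempty Ω with hΩ | ⟨⟨ω0⟩⟩
  · refine ⟨M, 0, le_rfl, ⟨fun ω => isEmptyElim ω, hMa, fun _ ω => isEmptyElim ω,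
      fun _ ω => isEmptyElim ω, fun ω => isEmptyElim ω, fun _ _ ω => isEmptyElim ω⟩,
      fun _ ω => isEmptyElim ω⟩
  have hBM0 : 0 ≤ BM := (norm_nonneg _).trans (hMB ⟨0, le_rfl, hT.le⟩ ω0)
  set X : Time T → Ω → EuclideanSpace ℝ (Fin k) := fun t ω => U t ω (M t ω) with hX
  have hXB : ∀ t ω, ‖X t ω‖ ≤ (K + 1) * BM := fun t ω =>
    (hgU t ω _).trans (mul_le_mul_of_nonneg_left (hMB t ω) (by linarith))
  have hXc : ∀ ω, Continuous fun t => X t ω := fun ω => (hUc ω).clm_apply (hMc ω)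
  have hXa : StronglyAdapted ℱ X := fun t =>
    happ.comp_stronglyMeasurable ((hflow.adapted t).prodMk (hMa t))
  set Bb := L * (1 + (K + 1) * BM) with hBb
  have hBb0 : 0 ≤ Bb := by positivity
  have hbX : ∀ t ω, ‖b t ω (X t ω)‖ ≤ Bb := fun t ω => (hgrow _ _ _).trans (by
    have := hXB t ω
    rw [hBb]; gcongr)
  have hbp := hb.isStronglyProgressive (progressive_of_continuous_adapted hXc hXa)
  have hbi : ∀ ω, Integrable (fun r => b r ω (X r ω)) (timeMeasure T) := fun ω =>
    Integrable.of_bound (IsStronglyProgressive.stronglyMeasurable_path hT.le hbp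
      ω).aestronglyMeasurable Bb (Eventually.of_forall fun r => hbX r ω)
  have hUV : ∀ t ω x, U t ω (V t ω x) = x := fun t ω x =>
    congrArg (fun f => f x) (hflow.mul_inv t ω)
  have hMeq' : ∀ t ω, M t ω = ξ ω + ∫ r in Set.Iic t, V r ω (b r ω (X r ω)) ∂timeMeasure T :=
    hMeq
  have hMi' : ∀ ω, Integrable (fun r => V r ω (b r ω (X r ω))) (timeMeasure T) := hMi
  have hloc : ∀ s t ω, s ≤ t →
      ‖X t ω - X s ω - ∫ r in Set.Ioc s t, b r ω (X r ω) ∂timeMeasure T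
        - germ η (integrand F X) (integrand' F F' X) s t ω‖
        ≤ (K * BM + K * (K + 1) * Bb * T ^ (1 + α - θ)) * ((t : ℝ) - s) ^ θ :=
    fun s t ω hst => by
      have h0 := time_sub_nonneg hst
      have hstep := flowStep_apply η F F' X s t ω
      have hinc : M t ω - M s ω = ∫ r in Set.Ioc s t, V r ω (b r ω (X r ω)) ∂timeMeasure T := by
        rw [hMeq' t ω, hMeq' s ω, add_sub_add_left_eq_sub, setIntegral_Iic_sub (hMi' ω) hst]
      -- Writing `b = U_r V_r b` under the integral leaves `U_t - U_r`, of order `α`, so the drift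
      -- error has order `1 + α ≥ θ`.
      have hU : U t ω (M t ω - M s ω) - ∫ r in Set.Ioc s t, b r ω (X r ω) ∂timeMeasure T
          = ∫ r in Set.Ioc s t, (U t ω - U r ω) (V r ω (b r ω (X r ω))) ∂timeMeasure T := by
        rw [hinc, ← (U t ω).integral_comp_comm (hMi' ω).integrableOn,
          ← integral_sub ((U t ω).integrable_comp (hMi' ω)).integrableOn (hbi ω).integrableOn]
        refine integral_congr_ae (Eventually.of_forall fun r => ?_)
        simp only [sub_apply, hUV]
      have e : X t ω - X s ω - ∫ r in Set.Ioc s t, b r ω (X r ω) ∂timeMeasure T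
          - germ η (integrand F X) (integrand' F F' X) s t ω
          = (U t ω - flowStep η F F' ω s t * U s ω) (M s ω)
            + ∫ r in Set.Ioc s t, (U t ω - U r ω) (V r ω (b r ω (X r ω))) ∂timeMeasure T := by
        rw [← hU, sub_apply, map_sub]
        have : (flowStep η F F' ω s t * U s ω) (M s ω) = flowStep η F F' ω s t (X s ω) := rfl
        rw [this, hstep]
        simp only [hX]
        abel
      have h1 : ‖(U t ω - flowStep η F F' ω s t * U s ω) (M s ω)‖
          ≤ (K * ((t : ℝ) - s) ^ θ) * BM :=
        (ContinuousLinearMap.le_opNorm _ _).trans (mul_le_mul (hflow.step s t ω hst) (hMB s ω)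
          (norm_nonneg _) (by positivity))
      have h2 : ‖∫ r in Set.Ioc s t, (U t ω - U r ω) (V r ω (b r ω (X r ω))) ∂timeMeasure T‖
          ≤ ((K * ((t : ℝ) - s) ^ α) * ((K + 1) * Bb)) * ((t : ℝ) - s) := by
        refine norm_setIntegral_Ioc_le hst fun r hr => ?_
        refine (ContinuousLinearMap.le_opNorm _ _).trans (mul_le_mul ?_ ?_ (norm_nonneg _)
          (by positivity))
        · refine (hflow.holder r t ω hr.2).trans ?_
          refine mul_le_mul_of_nonneg_left (Real.rpow_le_rpow (time_sub_nonneg hr.2) ?_ hα.le) hK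
          have : (s : ℝ) ≤ r := hr.1.le
          linarith
        · exact (hgV _ _ _).trans (mul_le_mul_of_nonneg_left (hbX r ω) (by linarith))
      have h3 : ((t : ℝ) - s) ^ α * ((t : ℝ) - s) ≤ T ^ (1 + α - θ) * ((t : ℝ) - s) ^ θ := by
        have : ((t : ℝ) - s) ^ α * ((t : ℝ) - s) = ((t : ℝ) - s) ^ (1 + α) := by
          rw [Real.rpow_add_of_nonneg h0 zero_le_one hα.le, Real.rpow_one, mul_comm]
        rw [this]
        exact rpow_le_const_mul_rpow h0 (time_sub_le _ _) hθ hθα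
      rw [e]
      refine (norm_add_le _ _).trans ((add_le_add h1 h2).trans ?_)
      calc _ = K * BM * ((t : ℝ) - s) ^ θ
            + K * (K + 1) * Bb * (((t : ℝ) - s) ^ α * ((t : ℝ) - s)) := by ring
        _ ≤ K * BM * ((t : ℝ) - s) ^ θ
            + K * (K + 1) * Bb * (T ^ (1 + α - θ) * ((t : ℝ) - s) ^ θ) := by gcongr
        _ = _ := by ring
  set Bl := K * BM + K * (K + 1) * Bb * T ^ (1 + α - θ) with hBl
  have hBl0 : 0 ≤ Bl := by positivity
  have hXB0 : 0 ≤ (K + 1) * BM := by positivity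
  refine ⟨X, (K + 1) * BM + Bb + Bl, by positivity, ⟨hXc, hXa, fun t ω => ?_, fun t ω => ?_, hbi,
    fun s t ω hst => ?_⟩, fun t ω ht => ?_⟩
  · linarith [hXB t ω]
  · linarith [hbX t ω]
  · exact (hloc s t ω hst).trans (mul_le_mul_of_nonneg_right (by linarith)
      (Real.rpow_nonneg (time_sub_nonneg hst) _))
  · have h1 : X t ω = M t ω := by
      simp only [hX, hflow.zero t ω ht]; rfl
    rw [h1, hMeq' t ω, setIntegral_measure_zero _ (timeMeasure_Iic_zero ht), add_zero]

/-- A discrete product rule: each term contains one increment, of `F'`, of `X`, of `F` or of `F X`,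
and is therefore of order at least `β'`. -/
theorem derivative_sub_identity {D E : Type*} [NormedAddCommGroup D] [NormedSpace ℝ D]
    [NormedAddCommGroup E] [NormedSpace ℝ E] (f g : E →L[ℝ] D →L[ℝ] E)
    (f' g' : D →L[ℝ] E →L[ℝ] D →L[ℝ] E) (x y : E) :
    (f'.flip x + f.comp (f x)) - (g'.flip y + g.comp (g y))
      = (f' - g').flip x + g'.flip (x - y) + (f - g).comp (f x) + g.comp (f x - g y) := by
  ext1 z
  simp only [sub_apply, map_sub, add_apply, ContinuousLinearMap.flip_apply,
    ContinuousLinearMap.comp_apply]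
  abel

set_option maxHeartbeats 1000000 in
/-- A pathwise solution is controlled, and so is the integrand that it generates. -/
theorem IsPathwiseSolution.uniformControlled {ℱ : Filtration (Time T) mΩ} {β β' B C : ℝ}
    (hα : α ∈ Set.Ioo (1 / 3 : ℝ) (1 / 2))
    (hβ : β ∈ Set.Ioc (1 / 4 : ℝ) α) (hβ' : β' ∈ Set.Ioc 0 β) (hsum : 1 < α + β + β')
    (hC : 0 ≤ C) (hB : 0 ≤ B) (h : UniformControlled η β β' C F F')
    (hX : IsPathwiseSolution ℱ η (α + β + β') B b F F' X) :
    ∃ C', 0 ≤ C' ∧ UniformControlled η α β C' X (integrand F X) ∧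
      UniformControlled η β β' C' (integrand F X) (integrand' F F' X) := by
  obtain ⟨hα1, hα2⟩ := hα
  obtain ⟨hβ1, hβ2⟩ := hβ
  obtain ⟨hβ'1, hβ'2⟩ := hβ'
  obtain ⟨Cη, hCη, hη⟩ := exists_path_bound η
  obtain ⟨Cc, hCc, hc⟩ := exists_contract_bound (V := EuclideanSpace ℝ (Fin k)) η
  have hh := span_mem (ι := Ω) (T := T)
  set S := triples Ω T
  have oη : Ord S span α (fun x => η.path x.2.2.2 - η.path x.2.1) :=
    ord_outer (f := fun _ s t => η.path t - η.path s) fun _ => hη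
  have oR : Ord S span (β + β') (fun x => remainder η F F' x.2.1 x.2.2.2 x.1) :=
    ord_outer (f := fun ω s t => remainder η F F' s t ω) fun ω s t hst =>
      h.remainder s t ω hst
  have oF : Ord S span β (fun x => F x.2.2.2 x.1 - F x.2.1 x.1) :=
    ord_outer (f := fun ω s t => F t ω - F s ω) fun ω s t hst => h.holder s t ω hst
  have oF' : Ord S span β' (fun x => F' x.2.2.2 x.1 - F' x.2.1 x.1) :=
    ord_outer (f := fun ω s t => F' t ω - F' s ω) fun ω s t hst => h.holder' s t ω hst
  have oX0 : Ord S span 0 (fun x => X x.2.1 x.1) := Ord.const_zero _ fun x _ => hX.bound _ _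
  have oXt : Ord S span 0 (fun x => X x.2.2.2 x.1) := Ord.const_zero _ fun x _ => hX.bound _ _
  have oF0 : Ord S span 0 (fun x => F x.2.1 x.1) := Ord.const_zero _ fun x _ => h.bound _ _
  have oF'0 : Ord S span 0 (fun x => F' x.2.1 x.1) := Ord.const_zero _ fun x _ => h.bound' _ _
  have bFX : ∀ t ω, ‖F t ω (X t ω)‖ ≤ C * B := fun t ω =>
    ((F t ω).le_opNorm _).trans (mul_le_mul (h.bound t ω) (hX.bound t ω) (norm_nonneg _) hC)
  have bG : ∀ t ω, ‖integrand' F F' X t ω‖ ≤ C * B + C * (C * B) := fun t ω => by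
    refine (norm_add_le _ _).trans (add_le_add ?_ ?_)
    · refine ((F' t ω).flip.le_opNorm _).trans ?_
      rw [ContinuousLinearMap.opNorm_flip]
      exact mul_le_mul (h.bound' t ω) (hX.bound t ω) (norm_nonneg _) hC
    · exact (ContinuousLinearMap.opNorm_comp_le _ _).trans
        (mul_le_mul (h.bound t ω) (bFX t ω) (norm_nonneg _) hC)
  have oFX : Ord S span 0 (fun x => F x.2.1 x.1 (X x.2.1 x.1)) :=
    Ord.const_zero _ fun x _ => bFX _ _
  have oFXt : Ord S span 0 (fun x => F x.2.2.2 x.1 (X x.2.2.2 x.1)) :=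
    Ord.const_zero _ fun x _ => bFX _ _
  have oD : Ord S span (α + β + β') (fun x => X x.2.2.2 x.1 - X x.2.1 x.1
      - ∫ r in Set.Ioc x.2.1 x.2.2.2, b r x.1 (X r x.1) ∂timeMeasure T
      - germ η (integrand F X) (integrand' F F' X) x.2.1 x.2.2.2 x.1) :=
    ord_of_le fun x hx => hX.expansion _ _ _ (hx.1.trans hx.2)
  have oI : Ord S span 1 (fun x => ∫ r in Set.Ioc x.2.1 x.2.2.2, b r x.1 (X r x.1)
      ∂timeMeasure T) := ord_of_le fun x hx => by
    rw [Real.rpow_one]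
    exact norm_setIntegral_Ioc_le (hx.1.trans hx.2) fun r _ => hX.drift_bound r _
  have oC : Ord S span (2 * α) (fun x => contract η x.2.1 x.2.2.2
      (integrand' F F' X x.2.1 x.1)) := ord_of_le (C := Cc * (C * B + C * (C * B))) fun x hx => by
    refine (hc _ _ (hx.1.trans hx.2) _).trans ?_
    have h0 := Real.rpow_nonneg (hh x hx).1 (2 * α)
    calc _ ≤ Cc * ((x.2.2.2 : ℝ) - x.2.1) ^ (2 * α) * (C * B + C * (C * B)) := by
          gcongr
          exact bG _ _
      _ = _ := by rw [span]; ring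
  have app : ∀ {A A' : Type _} [NormedAddCommGroup A] [NormedSpace ℝ A] [NormedAddCommGroup A']
      [NormedSpace ℝ A'] {a c κ : ℝ} {f : Ω × Time T × Time T × Time T → (A →L[ℝ] A')}
      {g : Ω × Time T × Time T × Time T → A}, Ord S span a f → Ord S span c g → 0 ≤ a → 0 ≤ c →
      0 ≤ κ → κ ≤ a + c → Ord S span κ (fun x => f x (g x)) :=
    fun hf hg ha hc hκ hac => hf.of_le_mul (C := 1) hg hh
      (fun x _ => by rw [one_mul]; exact ContinuousLinearMap.le_opNorm _ _) ha hc hκ hac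
  -- The remainder of `X` consists of the expansion error, the drift and the second-order part of
  -- the germ, of orders `θ`, `1` and `2α`. All are at least `α + β`, since `β ≤ α < 1 / 2`.
  have oRX : Ord S span (α + β) (fun x => remainder η X (integrand F X) x.2.1 x.2.2.2 x.1) := by
    refine (((oD.mono hh (by linarith) (by linarith)).add
      (oI.mono hh (by linarith) (by linarith))).add
      (oC.mono hh (by linarith) (by linarith))).congr_left fun x => ?_
    rw [germ_eq, remainder]
    abel
  have oX : Ord S span α (fun x => X x.2.2.2 x.1 - X x.2.1 x.1) := by
    refine ((oRX.mono hh (by linarith) (by linarith)).add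
      (app oFX oη le_rfl (by linarith) (by linarith) (by linarith))).congr_left fun x => ?_
    rw [remainder, integrand]
    abel
  have oFXi : Ord S span β (fun x => integrand F X x.2.2.2 x.1 - integrand F X x.2.1 x.1) := by
    refine ((app oF oXt (by linarith) le_rfl (by linarith) (by linarith)).add
      (app oF0 oX le_rfl (by linarith) (by linarith) (by linarith))).congr_left fun x => ?_
    simp only [integrand, sub_apply, map_sub]
    abel
  -- The remainder of the product is the remainder of `F` applied to `X_s`, plus the product of the
  -- two increments, plus `F_s` applied to the remainder of `X`.
  have oRFX : Ord S span (β + β') (fun x =>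
      remainder η (integrand F X) (integrand' F F' X) x.2.1 x.2.2.2 x.1) := by
    refine (((app oR oX0 (by linarith) le_rfl (by linarith) (by linarith)).add
      (app oF oX (κ := β + β') (by linarith) (by linarith) (by linarith) (by linarith))).add
      (app oF0 oRX (κ := β + β') le_rfl (by linarith) (by linarith)
        (by linarith))).congr_left fun x => ?_
    simp only [remainder, integrand, integrand', sub_apply, map_sub, add_apply,
      ContinuousLinearMap.flip_apply, ContinuousLinearMap.comp_apply]
    abel
  have flipO : ∀ {a : ℝ} {f : Ω × Time T × Time T × Time T → (EuclideanSpace ℝ (Fin d) →L[ℝ]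
      EuclideanSpace ℝ (Fin k) →L[ℝ] EuclideanSpace ℝ (Fin d) →L[ℝ] EuclideanSpace ℝ (Fin k))},
      Ord S span a f → Ord S span a (fun x => (f x).flip) := fun hf =>
    Asymptotics.IsBigO.trans (Asymptotics.IsBigO.of_norm_le fun x => by
      rw [ContinuousLinearMap.opNorm_flip]) hf.norm_left
  have oG : Ord S span β' (fun x =>
      integrand' F F' X x.2.2.2 x.1 - integrand' F F' X x.2.1 x.1) := by
    have o1 := app (flipO oF') oXt (κ := β') (by linarith) le_rfl (by linarith) (by linarith)
    have o2 := app (flipO oF'0) oX (κ := β') le_rfl (by linarith) (by linarith) (by linarith)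
    have o3 : Ord S span β' (fun x => (F x.2.2.2 x.1 - F x.2.1 x.1).comp
        (F x.2.2.2 x.1 (X x.2.2.2 x.1))) :=
      oF.of_le_mul (C := 1) oFXt hh (fun x _ => by
        rw [one_mul]; exact ContinuousLinearMap.opNorm_comp_le _ _) (by linarith) le_rfl
        (by linarith) (by linarith)
    have o4 : Ord S span β' (fun x => (F x.2.1 x.1).comp
        (integrand F X x.2.2.2 x.1 - integrand F X x.2.1 x.1)) :=
      oF0.of_le_mul (C := 1) oFXi hh (fun x _ => by
        rw [one_mul]; exact ContinuousLinearMap.opNorm_comp_le _ _) le_rfl (by linarith)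
        (by linarith) (by linarith)
    refine (((o1.add o2).add o3).add o4).congr_left fun x => ?_
    exact (derivative_sub_identity _ _ _ _ _ _).symm
  obtain ⟨C1, hC1, h1⟩ := exists_bound_of_ord_outer (f := fun ω s t => X t ω - X s ω) oX
  obtain ⟨C2, hC2, h2⟩ := exists_bound_of_ord_outer
    (f := fun ω s t => integrand F X t ω - integrand F X s ω) oFXi
  obtain ⟨C3, hC3, h3⟩ := exists_bound_of_ord_outer
    (f := fun ω s t => integrand' F F' X t ω - integrand' F F' X s ω) oG
  obtain ⟨C4, hC4, h4⟩ := exists_bound_of_ord_outer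
    (f := fun ω s t => remainder η X (integrand F X) s t ω) oRX
  obtain ⟨C5, hC5, h5⟩ := exists_bound_of_ord_outer
    (f := fun ω s t => remainder η (integrand F X) (integrand' F F' X) s t ω) oRFX
  have hCB : 0 ≤ C * B := by positivity
  have hCCB : 0 ≤ C * (C * B) := by positivity
  have up : ∀ {D : ℝ} {a κ : ℝ} {s t : Time T}, s ≤ t → a ≤ D * ((t : ℝ) - s) ^ κ →
      D ≤ B + C * B + C * (C * B) + C * B + C1 + C2 + C3 + C4 + C5 →
      a ≤ (B + C * B + C * (C * B) + C * B + C1 + C2 + C3 + C4 + C5) * ((t : ℝ) - s) ^ κ :=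
    fun hst ha hD => ha.trans (mul_le_mul_of_nonneg_right hD
      (Real.rpow_nonneg (time_sub_nonneg hst) _))
  refine ⟨B + C * B + C * (C * B) + C * B + C1 + C2 + C3 + C4 + C5, by positivity,
    ⟨fun t ω => ?_, fun t ω => ?_, fun s t ω hst => ?_, fun s t ω hst => ?_, fun s t ω hst => ?_⟩,
    ⟨fun t ω => ?_, fun t ω => ?_, fun s t ω hst => ?_, fun s t ω hst => ?_, fun s t ω hst => ?_⟩⟩
  · linarith [hX.bound t ω]
  · have := bFX t ω
    simp only [integrand]; linarith
  · exact up hst (h1 ω s t hst) (by linarith)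
  · exact up hst (h2 ω s t hst) (by linarith)
  · exact up hst (h4 ω s t hst) (by linarith)
  · have := bFX t ω
    simp only [integrand]; linarith
  · linarith [bG t ω]
  · exact up hst (h2 ω s t hst) (by linarith)
  · exact up hst (h3 ω s t hst) (by linarith)
  · exact up hst (h5 ω s t hst) (by linarith)

end PathwiseSolution

/-! ### From pathwise solutions to solutions of the equation. -/

section Existence

variable {α T : ℝ} {d k : ℕ} {Ω : Type*} {mΩ : MeasurableSpace Ω} {μ : Measure Ω}
  {η : RoughPath α T d}

theorem holderLp_top_of_ae_bound {V : Type*} [NormedAddCommGroup V] {κ C : ℝ}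
    {A : Time T → Time T → Ω → V} (hC : 0 ≤ C)
    (h : ∀ s t : Time T, s < t → ∀ᵐ ω ∂μ, ‖A s t ω‖ ≤ C * ((t : ℝ) - s) ^ κ) :
    HolderLp μ κ ∞ A := by
  refine ⟨C.toNNReal, fun s t hst => ?_⟩
  rw [eLpNorm_exponent_top]
  refine (eLpNormEssSup_le_of_ae_bound (h s t hst)).trans (le_of_eq ?_)
  rw [ENNReal.ofReal_mul hC]; rfl

/-- Processes with uniformly controlled modifications are strongly controlled in `L_∞`. -/
theorem UniformControlled.isStrongControlled {V : Type*} [NormedAddCommGroup V] [NormedSpace ℝ V]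
    [CompleteSpace V] [IsProbabilityMeasure μ] {ℱ : Filtration (Time T) mΩ} {β β' C : ℝ}
    {W Z : Time T → Ω → V} {W' Z' : Time T → Ω → (EuclideanSpace ℝ (Fin d) →L[ℝ] V)}
    (hC : 0 ≤ C) (h : UniformControlled η β β' C W W') (hZ : IsStronglyProgressive ℱ Z)
    (hZ' : IsStronglyProgressive ℱ Z') (hWZ : ∀ t, W t =ᵐ[μ] Z t)
    (hWZ' : ∀ t, W' t =ᵐ[μ] Z' t) : IsStrongControlled ℱ μ η β β' ∞ Z Z' := by
  have hrem : HolderLp μ (β + β') ∞ (RoughRDE.remainder η Z Z') :=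
    holderLp_top_of_ae_bound hC fun s t hst => by
      filter_upwards [hWZ s, hWZ t, hWZ' s] with ω h1 h2 h3
      rw [RoughRDE.remainder, ← h1, ← h2, ← h3]
      exact h.remainder s t ω hst.le
  refine ⟨⟨hZ, hZ', fun t _ => ?_, fun t _ => ?_, ?_, ?_, ?_⟩, hrem⟩
  · refine MemLp.of_bound ((hZ.stronglyAdapted t).mono (ℱ.le t)).aestronglyMeasurable C ?_
    filter_upwards [hWZ t] with ω h1
    rw [← h1]; exact h.bound t ω
  · refine MemLp.of_bound ((hZ'.stronglyAdapted t).mono (ℱ.le t)).aestronglyMeasurable C ?_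
    filter_upwards [hWZ' t] with ω h1
    rw [← h1]; exact h.bound' t ω
  · refine holderLp_top_of_ae_bound hC fun s t hst => ?_
    filter_upwards [hWZ s, hWZ t] with ω h1 h2
    rw [← h1, ← h2]; exact h.holder s t ω hst.le
  · refine holderLp_top_of_ae_bound hC fun s t hst => ?_
    filter_upwards [hWZ' s, hWZ' t] with ω h1 h2
    rw [← h1, ← h2]; exact h.holder' s t ω hst.le
  -- Conditional expectation contracts `L_∞`, so the strong remainder bound contains the weak one.
  · obtain ⟨D, hD⟩ := hrem
    exact ⟨D, fun s t hst => (eLpNorm_condExp_le_eLpNorm _ le_top).trans (hD s t hst)⟩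

variable {F G : Time T → Ω → (EuclideanSpace ℝ (Fin k) →L[ℝ]
      EuclideanSpace ℝ (Fin d) →L[ℝ] EuclideanSpace ℝ (Fin k))}
  {F' G' : Time T → Ω → (EuclideanSpace ℝ (Fin d) →L[ℝ] EuclideanSpace ℝ (Fin k) →L[ℝ]
      EuclideanSpace ℝ (Fin d) →L[ℝ] EuclideanSpace ℝ (Fin k))}
  {b c : Time T → Ω → EuclideanSpace ℝ (Fin k) → EuclideanSpace ℝ (Fin k)}
  {ξ ζ : Ω → EuclideanSpace ℝ (Fin k)} {X : Time T → Ω → EuclideanSpace ℝ (Fin k)}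

theorem stronglyMeasurable_clm_apply {D E A : Type*} [NormedAddCommGroup D] [NormedSpace ℝ D]
    [NormedAddCommGroup E] [NormedSpace ℝ E] {mA : MeasurableSpace A} {f : A → D →L[ℝ] E}
    {x : A → D} (hf : StronglyMeasurable f) (hx : StronglyMeasurable x) :
    StronglyMeasurable fun a => f a (x a) :=
  (isBoundedBilinearMap_apply (𝕜 := ℝ)).continuous.comp_stronglyMeasurable (hf.prodMk hx)

theorem stronglyMeasurable_clm_comp {D E G A : Type*} [NormedAddCommGroup D] [NormedSpace ℝ D]
    [NormedAddCommGroup E] [NormedSpace ℝ E] [NormedAddCommGroup G] [NormedSpace ℝ G]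
    {mA : MeasurableSpace A} {f : A → E →L[ℝ] G} {g : A → D →L[ℝ] E}
    (hf : StronglyMeasurable f) (hg : StronglyMeasurable g) :
    StronglyMeasurable fun a => (f a).comp (g a) :=
  (isBoundedBilinearMap_comp (𝕜 := ℝ)).continuous.comp_stronglyMeasurable (hf.prodMk hg)

theorem stronglyMeasurable_clm_flip {D E G A : Type*} [NormedAddCommGroup D] [NormedSpace ℝ D]
    [NormedAddCommGroup E] [NormedSpace ℝ E] [NormedAddCommGroup G] [NormedSpace ℝ G]
    {mA : MeasurableSpace A} {f : A → D →L[ℝ] E →L[ℝ] G} (hf : StronglyMeasurable f) :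
    StronglyMeasurable fun a => (f a).flip :=
  (ContinuousLinearMap.flipₗᵢ ℝ D E G).continuous.comp_stronglyMeasurable hf

theorem stronglyMeasurable_derivative {D E A : Type*} [NormedAddCommGroup D] [NormedSpace ℝ D]
    [NormedAddCommGroup E] [NormedSpace ℝ E] {mA : MeasurableSpace A} {f : A → E →L[ℝ] D →L[ℝ] E}
    {f' : A → D →L[ℝ] E →L[ℝ] D →L[ℝ] E} {x : A → E} (hf : StronglyMeasurable f)
    (hf' : StronglyMeasurable f') (hx : StronglyMeasurable x) :
    StronglyMeasurable fun a => (f' a).flip (x a) + (f a).comp (f a (x a)) :=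
  (stronglyMeasurable_clm_apply (stronglyMeasurable_clm_flip hf') hx).add
    (stronglyMeasurable_clm_comp hf (stronglyMeasurable_clm_apply hf hx))

theorem isStronglyProgressive_integrand {ℱ : Filtration (Time T) mΩ}
    (hF : IsStronglyProgressive ℱ F) (hX : IsStronglyProgressive ℱ X) :
    IsStronglyProgressive ℱ (integrand F X) := fun t =>
  stronglyMeasurable_clm_apply (hF t) (hX t)

theorem isStronglyProgressive_integrand' {ℱ : Filtration (Time T) mΩ}
    (hF : IsStronglyProgressive ℱ F) (hF' : IsStronglyProgressive ℱ F')
    (hX : IsStronglyProgressive ℱ X) :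
    IsStronglyProgressive ℱ (integrand' F F' X) := fun t => by
  unfold integrand'
  exact stronglyMeasurable_derivative (hF t) (hF' t) (hX t)

theorem integrand_ae_eq {t : Time T} (h : G t =ᵐ[μ] F t) :
    integrand G X t =ᵐ[μ] integrand F X t := by
  filter_upwards [h] with ω hω
  rw [integrand, integrand, hω]

theorem integrand'_ae_eq {t : Time T} (h : G t =ᵐ[μ] F t) (h' : G' t =ᵐ[μ] F' t) :
    integrand' G G' X t =ᵐ[μ] integrand' F F' X t := by
  filter_upwards [h, h'] with ω hω hω'
  rw [integrand', integrand', hω, hω']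

theorem germ_ae_eq {s t : Time T} (h : G s =ᵐ[μ] F s) (h' : G' s =ᵐ[μ] F' s) :
    germ η (integrand G X) (integrand' G G' X) s t
      =ᵐ[μ] germ η (integrand F X) (integrand' F F' X) s t := by
  filter_upwards [integrand_ae_eq (X := X) h, integrand'_ae_eq (X := X) h h'] with ω h1 h2
  rw [germ_eq, germ_eq, h1, h2]

theorem IsPartition.le_succ {t : Time T} {n : ℕ} {π : ℕ → Time T} (h : IsPartition t n π) :
    ∀ i < n, π i ≤ π (i + 1) := fun i hi => (h.2.2 i hi).le

/-- A pathwise solution for modifications of the coefficients is a solution of the rough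
equation. -/
theorem IsPathwiseSolution.isSolution [IsProbabilityMeasure μ] {ℱ : Filtration (Time T) mΩ}
    {β β' B C : ℝ} (hα : α ∈ Set.Ioo (1 / 3 : ℝ) (1 / 2))
    (hβ : β ∈ Set.Ioc (1 / 4 : ℝ) α) (hβ' : β' ∈ Set.Ioc 0 β) (hsum : 1 < α + β + β')
    (hC : 0 ≤ C) (hB : 0 ≤ B) (hG : UniformControlled η β β' C G G')
    (hX : IsPathwiseSolution ℱ η (α + β + β') B c G G' X)
    (hF : IsStronglyProgressive ℱ F) (hF' : IsStronglyProgressive ℱ F')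
    (hGF : ∀ t, G t =ᵐ[μ] F t) (hGF' : ∀ t, G' t =ᵐ[μ] F' t)
    (hcb : ∀ᵐ ω ∂μ, ∀ t x, c t ω x = b t ω x)
    (hζ : ∀ (t : Time T) ω, (t : ℝ) = 0 → X t ω = ζ ω) (hζξ : ζ =ᵐ[μ] ξ) :
    IsSolution ℱ μ η b F F' ξ β β' ∞ X ∧
      IsStrongControlled ℱ μ η α β ∞ X (integrand F X) := by
  obtain ⟨C', hC', h1, h2⟩ := hX.uniformControlled hα hβ hβ' hsum hC hB hG
  have hXp := progressive_of_continuous_adapted hX.continuous hX.adapted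
  have hi := isStronglyProgressive_integrand hF hXp
  have hi' := isStronglyProgressive_integrand' hF hF' hXp
  refine ⟨⟨by simp, ⟨by linarith [hβ.1], hβ.2⟩, hβ', by linarith [hα.1, hβ.1], hsum,
    hX.continuous, hX.adapted, ?_, ?_, ?_⟩, ?_⟩
  · filter_upwards [hcb] with ω hω
    simpa only [hω] using hX.integrable ω
  · exact (h2.isStrongControlled hC' hi hi' (fun t => integrand_ae_eq (hGF t))
      fun t => integrand'_ae_eq (hGF t) (hGF' t)).toIsStochControlled
  -- The integral process is defined by the equation, so what must be shown is that it is the limit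
  -- of the compensated Riemann sums.
  · refine ⟨fun t ω => X t ω - ξ ω - ∫ r in Set.Iic t, b r ω (X r ω) ∂timeMeasure T, ?_,
      Eventually.of_forall fun ω t => by
        beta_reduce; rw [sub_sub, add_sub_cancel]⟩
    intro t ε hε κ _
    have hθ : 0 < α + β + β' - 1 := by linarith
    obtain ⟨δ, hδ, hδε⟩ : ∃ δ : ℝ, 0 < δ ∧ B * (T * δ ^ (α + β + β' - 1)) < ε := by
      have hev : ∀ᶠ δ in 𝓝[>] (0 : ℝ), B * (T * δ ^ (α + β + β' - 1)) < ε := by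
        have hc : Continuous fun δ : ℝ => B * (T * δ ^ (α + β + β' - 1)) :=
          continuous_const.mul (continuous_const.mul (Real.continuous_rpow_const hθ.le))
        have := (hc.tendsto 0).mono_left (nhdsWithin_le_nhds (s := Set.Ioi 0))
        refine this.eventually_lt_const ?_
        rw [Real.zero_rpow hθ.ne', mul_zero, mul_zero]
        exact hε
      obtain ⟨δ, h1, h2⟩ := (hev.and self_mem_nhdsWithin).exists
      exact ⟨δ, h2, h1⟩
    refine ⟨δ, hδ, fun n π hπ hmesh => ?_⟩
    -- The convergence is better than in probability: telescoping bounds the error by `B T δ ^ (θ -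
    -- 1) < ε` almost surely, for every partition of mesh below `δ`. The exceptional event is null.
    refine le_of_eq_of_le ?_ (zero_le (a := κ))
    have hgerm : ∀ᵐ ω ∂μ, ∀ i, germ η (integrand G X) (integrand' G G' X) (π i) (π (i + 1)) ω
        = germ η (integrand F X) (integrand' F F' X) (π i) (π (i + 1)) ω :=
      ae_all_iff.2 fun i => germ_ae_eq (hGF _) (hGF' _)
    refine measure_eq_zero_iff_ae_notMem.2 ?_
    filter_upwards [hgerm, hcb, hζξ] with ω hg hb hξ
    simp only [not_le]
    refine lt_of_le_of_lt ?_ hδε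
    have h0 : X (π 0) ω = ξ ω := by rw [hζ _ _ hπ.1, hξ]
    set J : Time T → EuclideanSpace ℝ (Fin k) :=
      fun t => ∫ r in Set.Iic t, b r ω (X r ω) ∂timeMeasure T with hJ
    have hJ0 : J (π 0) = 0 := setIntegral_measure_zero _ (timeMeasure_Iic_zero hπ.1)
    have hint : Integrable (fun r => b r ω (X r ω)) (timeMeasure T) := by
      simpa only [hb] using hX.integrable ω
    have hsumD : ∑ i ∈ Finset.range n, germ η (integrand F X) (integrand' F F' X)
        (π i) (π (i + 1)) ω - (X t ω - ξ ω - J t) = - ∑ i ∈ Finset.range n,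
        (X (π (i + 1)) ω - X (π i) ω - (J (π (i + 1)) - J (π i))
          - germ η (integrand F X) (integrand' F F' X) (π i) (π (i + 1)) ω) := by
      rw [Finset.sum_sub_distrib, Finset.sum_sub_distrib,
        Finset.sum_range_sub (fun i => X (π i) ω), Finset.sum_range_sub (fun i => J (π i)),
        hπ.2.1, h0, hJ0]
      abel
    rw [hsumD, norm_neg]
    refine (norm_sum_le_of_le _ fun i hi => ?_).trans
      (b := ∑ i ∈ Finset.range n, B * ((π (i + 1) : ℝ) - π i) ^ (α + β + β')) ?_
    · have hle := hπ.le_succ i (Finset.mem_range.1 hi)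
      have := hX.expansion (π i) (π (i + 1)) ω hle
      rw [hg i] at this
      simp only [hb] at this
      rwa [hJ, setIntegral_Iic_sub hint hle]
    · rw [← Finset.mul_sum]
      exact mul_le_mul_of_nonneg_left (sum_rpow_le hπ.le_succ (by linarith)
        (fun i hi => (hmesh i hi).le) hδ.le) hB
  · exact h1.isStrongControlled hC' hXp hi (fun t => EventuallyEq.rfl)
      fun t => integrand_ae_eq (hGF t)

end Existence

/-! ### Sums of adapted increments in `L²`. -/

section Martingale

variable {Ω : Type*} {mΩ : MeasurableSpace Ω} {μ : Measure Ω}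
  {E : Type*} [NormedAddCommGroup E] [InnerProductSpace ℝ E]

/-- Pythagoras' theorem in `L²`. -/
theorem eLpNorm_add_le_sqrt {f g : Ω → E} (hf : MemLp f 2 μ) (hg : MemLp g 2 μ)
    (h : ∫ ω, inner ℝ (f ω) (g ω) ∂μ = 0) {x y : ℝ} (hx0 : 0 ≤ x) (hy0 : 0 ≤ y)
    (hx : eLpNorm f 2 μ ≤ ENNReal.ofReal x)
    (hy : eLpNorm g 2 μ ≤ ENNReal.ofReal y) :
    eLpNorm (f + g) 2 μ ≤ ENNReal.ofReal (√(x ^ 2 + y ^ 2)) := by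
  have h0 : inner ℝ (hf.toLp f) (hg.toLp g) = 0 := by
    rw [L2.inner_def, ← h]
    refine integral_congr_ae ?_
    filter_upwards [hf.coeFn_toLp, hg.coeFn_toLp] with ω h1 h2
    rw [h1, h2]
  have h1 := norm_add_sq_eq_norm_sq_add_norm_sq_real h0
  rw [← MemLp.toLp_add hf hg, Lp.norm_toLp, Lp.norm_toLp, Lp.norm_toLp] at h1
  have h2 : (eLpNorm f 2 μ).toReal ≤ x := ENNReal.toReal_le_of_le_ofReal hx0 hx
  have h3 : (eLpNorm g 2 μ).toReal ≤ y := ENNReal.toReal_le_of_le_ofReal hy0 hy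
  rw [← ENNReal.ofReal_toReal (hf.add hg).eLpNorm_ne_top]
  refine ENNReal.ofReal_le_ofReal (Real.le_sqrt_of_sq_le ?_)
  rw [sq, h1, ← sq, ← sq]
  gcongr

/-- Conditioning on `m` pulls the measurable factor out of the inner product and leaves the
vanishing conditional mean. This is the orthogonality of martingale increments. -/
theorem integral_inner_eq_zero [CompleteSpace E] {m : MeasurableSpace Ω} [IsFiniteMeasure μ]
    (hm : m ≤ mΩ) {f g : Ω → E}
    (hf : MemLp f 2 μ) (hg : MemLp g 2 μ) (hfm : StronglyMeasurable[m] f)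
    (hgm : μ[g | m] =ᵐ[μ] 0) : ∫ ω, inner ℝ (f ω) (g ω) ∂μ = 0 := by
  have hint : Integrable (fun ω => innerSL ℝ (f ω) (g ω)) μ := by
    refine (L2.integrable_inner (𝕜 := ℝ) (hf.toLp f) (hg.toLp g)).congr ?_
    filter_upwards [hf.coeFn_toLp, hg.coeFn_toLp] with ω h1 h2
    rw [h1, h2, innerSL_apply_apply]
  have h : μ[fun ω => inner ℝ (f ω) (g ω) | m] =ᵐ[μ] fun ω => inner ℝ (f ω) (μ[g | m] ω) :=
    condExp_bilin_of_stronglyMeasurable_left (innerSL ℝ) hfm hint (hg.integrable one_le_two)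
  rw [← integral_condExp (μ := μ) hm (f := fun ω => inner ℝ (f ω) (g ω))]
  refine integral_eq_zero_of_ae ?_
  filter_upwards [h, hgm] with ω h2 h3
  rw [h2, h3, Pi.zero_apply, inner_zero_right, Pi.zero_apply]

/-- Sums of adapted square-integrable increments: conditional means add up linearly, the
martingale part grows like the square root of the number of terms. -/
theorem eLpNorm_sum_le_of_condExp [CompleteSpace E] [IsProbabilityMeasure μ]
    {G : ℕ → MeasurableSpace Ω}
    (hG : Monotone G) (hle : ∀ j, G j ≤ mΩ) {D : ℕ → Ω → E} {N : ℕ} {a b : ℝ}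
    (ha0 : 0 ≤ a) (hb0 : 0 ≤ b)
    (hD : ∀ j < N, StronglyMeasurable[G (j + 1)] (D j))
    (hb : ∀ j < N, eLpNorm (D j) 2 μ ≤ ENNReal.ofReal b)
    (ha : ∀ j < N, eLpNorm (μ[D j | G j]) 2 μ ≤ ENNReal.ofReal a) :
    eLpNorm (fun ω => ∑ j ∈ Finset.range N, D j ω) 2 μ
      ≤ ENNReal.ofReal (N * a + √N * (a + b)) := by
  -- Doob decomposition: the compensated terms are orthogonal with norm at most `a + b`, giving `√N
  -- (a + b)`; the compensators are summed by the triangle inequality.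
  set M : ℕ → Ω → E := fun j => D j - μ[D j | G j] with hM
  have hDL : ∀ j < N, MemLp (D j) 2 μ := fun j hj =>
    ⟨((hD j hj).mono (hle _)).aestronglyMeasurable, (hb j hj).trans_lt ENNReal.ofReal_lt_top⟩
  have hcL : ∀ j < N, MemLp (μ[D j | G j]) 2 μ := fun j hj => (hDL j hj).condExp one_le_two
  have hML : ∀ j < N, MemLp (M j) 2 μ := fun j hj => (hDL j hj).sub (hcL j hj)
  have hMm : ∀ j < N, StronglyMeasurable[G (j + 1)] (M j) := fun j hj =>
    (hD j hj).sub (stronglyMeasurable_condExp.mono (hG j.le_succ))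
  have hMb : ∀ j < N, eLpNorm (M j) 2 μ ≤ ENNReal.ofReal (a + b) := fun j hj => by
    refine (eLpNorm_sub_le (hDL j hj).1 (hcL j hj).1 one_le_two).trans ?_
    rw [add_comm a, ENNReal.ofReal_add hb0 ha0]
    exact add_le_add (hb j hj) (ha j hj)
  have hMc : ∀ j < N, μ[M j | G j] =ᵐ[μ] 0 := fun j hj => by
    have h1 := condExp_sub ((hDL j hj).integrable one_le_two)
      (integrable_condExp (μ := μ) (m := G j) (f := D j)) (G j)
    have h2 := condExp_of_stronglyMeasurable (hle j)
      (stronglyMeasurable_condExp (μ := μ) (m := G j) (f := D j)) integrable_condExp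
    refine h1.trans ?_
    rw [h2, sub_self]
  have hS : ∀ n ≤ N, StronglyMeasurable[G n] (∑ j ∈ Finset.range n, M j) ∧
      MemLp (∑ j ∈ Finset.range n, M j) 2 μ ∧
      eLpNorm (∑ j ∈ Finset.range n, M j) 2 μ ≤ ENNReal.ofReal (√n * (a + b)) := fun n hn => by
    refine ⟨Finset.stronglyMeasurable_sum _ fun j hj => ?_, memLp_finsetSum' _ fun j hj => ?_, ?_⟩
    · have := Finset.mem_range.1 hj
      exact (hMm j (by omega)).mono (hG this)
    · have := Finset.mem_range.1 hj
      exact hML j (by omega)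
    induction n with
    | zero => simp
    | succ n ih =>
      have hSm : StronglyMeasurable[G n] (∑ j ∈ Finset.range n, M j) :=
        Finset.stronglyMeasurable_sum _ fun j hj => by
          have := Finset.mem_range.1 hj
          exact (hMm j (by omega)).mono (hG this)
      have hSL : MemLp (∑ j ∈ Finset.range n, M j) 2 μ := memLp_finsetSum' _ fun j hj => by
        have := Finset.mem_range.1 hj
        exact hML j (by omega)
      rw [Finset.sum_range_succ]
      refine (eLpNorm_add_le_sqrt hSL (hML n hn) (integral_inner_eq_zero (hle n) hSL (hML n hn)
        hSm (hMc n hn)) (by positivity) (by positivity) (ih (by omega)) (hMb n hn)).trans ?_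
      refine ENNReal.ofReal_le_ofReal (Real.sqrt_le_iff.2 ⟨by positivity, le_of_eq ?_⟩)
      rw [mul_pow, mul_pow, Real.sq_sqrt (by positivity), Real.sq_sqrt (by positivity)]
      push_cast; ring
  have e : (fun ω => ∑ j ∈ Finset.range N, D j ω)
      = ∑ j ∈ Finset.range N, M j + ∑ j ∈ Finset.range N, μ[D j | G j] := by
    rw [← Finset.sum_add_distrib]
    funext ω
    simp [hM, Finset.sum_apply]
  rw [e]
  refine (eLpNorm_add_le (hS N le_rfl).2.1.1 (memLp_finsetSum' _ fun j hj =>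
    hcL j (Finset.mem_range.1 hj)).1 one_le_two).trans ?_
  rw [add_comm, ENNReal.ofReal_add (by positivity) (by positivity)]
  refine add_le_add ?_ (hS N le_rfl).2.2
  refine (eLpNorm_sum_le (fun j hj => (hcL j (Finset.mem_range.1 hj)).1) one_le_two).trans ?_
  refine (Finset.sum_le_card_nsmul _ _ _ fun j hj => ha j (Finset.mem_range.1 hj)).trans ?_
  rw [Finset.card_range, nsmul_eq_mul, ENNReal.ofReal_mul (by positivity), ENNReal.ofReal_natCast]

/-- If the total error is at least `ε`, one of the `r` summands exceeds a fixed threshold, and a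
union bound over fixed `r` finishes. -/
theorem tendstoInMeasure_sum_of_le {A B : Type*} [NormedAddCommGroup A] [NormedAddCommGroup B]
    {K : ℝ} (hK : 0 ≤ K) {r : ℕ} {f : ℕ → ℕ → Ω → A} {g : ℕ → Ω → A} {F : ℕ → Ω → B} {H : Ω → B}
    (hfg : ∀ i < r, TendstoInMeasure μ (f i) atTop (g i))
    (h : ∀ n ω, ‖F n ω - H ω‖ ≤ K * ∑ i ∈ Finset.range r, ‖f i n ω - g i ω‖) :
    TendstoInMeasure μ F atTop H := by
  rw [tendstoInMeasure_iff_norm]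
  intro ε hε
  -- The added ones give `K * r * δ < ε` strictly, also when `K` or `r` vanishes.
  set δ := ε / ((K + 1) * (r + 1)) with hδ
  have hδ0 : 0 < δ := by positivity
  have hlim : Tendsto (fun n => ∑ i ∈ Finset.range r, μ {ω | δ ≤ ‖f i n ω - g i ω‖}) atTop
      (𝓝 0) := by
    have := tendsto_finsetSum (Finset.range r) fun i hi =>
      (tendstoInMeasure_iff_norm.1 (hfg i (Finset.mem_range.1 hi))) δ hδ0
    simpa using this
  refine tendsto_of_tendsto_of_tendsto_of_le_of_le tendsto_const_nhds hlim (fun _ => zero_le)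
    fun n => ?_
  refine (measure_mono ?_).trans (measure_biUnion_finset_le (Finset.range r)
    fun i => {ω | δ ≤ ‖f i n ω - g i ω‖})
  intro ω hω
  by_contra hc
  simp only [Set.mem_iUnion, Set.mem_ofPred_eq, not_exists, not_le] at hc
  have h1 : K * ∑ i ∈ Finset.range r, ‖f i n ω - g i ω‖ ≤ K * (r * δ) := by
    refine mul_le_mul_of_nonneg_left ?_ hK
    refine (Finset.sum_le_card_nsmul _ _ _ fun i hi => (hc i hi).le).trans (le_of_eq ?_)
    rw [Finset.card_range, nsmul_eq_mul]
  have h2 : K * (r * δ) < ε := by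
    have : ε = (K + 1) * (r + 1) * δ := by rw [hδ]; field_simp
    nlinarith [mul_nonneg hK hδ0.le, mul_nonneg (Nat.cast_nonneg (α := ℝ) r) hδ0.le]
  exact absurd ((hω.trans (h n ω)).trans h1) (not_le.2 h2)

end Martingale

/-! ### Nested dyadic partitions of `[0, t]` and midpoint refinement. -/

section DyadicPartition

variable {T : ℝ}

/-- The `i`-th point of the partition of `[0, t]` into `2 ^ n` intervals of equal length. -/
def dyadicPoint (t : Time T) (n i : ℕ) : Time T :=
  ⟨t * min ((i : ℝ) / 2 ^ n) 1, mul_nonneg t.2.1 (by positivity),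
    (mul_le_of_le_one_right t.2.1 (min_le_right _ _)).trans t.2.2⟩

theorem dyadicPoint_coe (t : Time T) {n i : ℕ} (h : i ≤ 2 ^ n) :
    (dyadicPoint t n i : ℝ) = t * (i / 2 ^ n) := by
  have : (i : ℝ) / 2 ^ n ≤ 1 := div_le_one_of_le₀ (by exact_mod_cast h) (by positivity)
  show (t : ℝ) * min ((i : ℝ) / 2 ^ n) 1 = _
  rw [min_eq_left this]

theorem dyadicPoint_zero (t : Time T) (n : ℕ) : (dyadicPoint t n 0 : ℝ) = 0 := by
  rw [dyadicPoint_coe t (Nat.zero_le _)]; simp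

theorem dyadicPoint_last (t : Time T) (n : ℕ) : dyadicPoint t n (2 ^ n) = t := by
  refine Subtype.ext ?_
  rw [dyadicPoint_coe t le_rfl]; simp

theorem dyadicPoint_refine (t : Time T) (n l i : ℕ) :
    dyadicPoint t (n + l) (i * 2 ^ l) = dyadicPoint t n i := by
  refine Subtype.ext ?_
  have : ((i * 2 ^ l : ℕ) : ℝ) / 2 ^ (n + l) = i / 2 ^ n := by
    push_cast
    rw [pow_add, mul_div_mul_right _ _ (by positivity)]
  show (t : ℝ) * min _ 1 = t * min _ 1
  rw [this]

theorem dyadicPoint_two_mul (t : Time T) (n i : ℕ) :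
    dyadicPoint t (n + 1) (2 * i) = dyadicPoint t n i := by
  rw [← dyadicPoint_refine t n 1 i, pow_one, mul_comm]

theorem monotone_dyadicPoint (t : Time T) (n : ℕ) : Monotone (dyadicPoint t n) := fun i j h =>
  Subtype.coe_le_coe.1 <| mul_le_mul_of_nonneg_left (min_le_min_right _ (by gcongr)) t.2.1

theorem dyadicPoint_sub (t : Time T) {n i : ℕ} (h : i < 2 ^ n) :
    (dyadicPoint t n (i + 1) : ℝ) - dyadicPoint t n i = t / 2 ^ n := by
  rw [dyadicPoint_coe t h, dyadicPoint_coe t h.le]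
  push_cast; ring

theorem dyadicPoint_lt {t : Time T} (ht : 0 < (t : ℝ)) {n i : ℕ} (h : i < 2 ^ n) :
    dyadicPoint t n i < dyadicPoint t n (i + 1) := by
  have h1 := dyadicPoint_sub t h
  have : 0 < (t : ℝ) / 2 ^ n := by positivity
  exact Subtype.coe_lt_coe.1 (by linarith)

theorem isPartition_dyadicPoint {t : Time T} (ht : 0 < (t : ℝ)) {n N : ℕ} (h : N ≤ 2 ^ n) :
    IsPartition (dyadicPoint t n N) N (dyadicPoint t n) :=
  ⟨dyadicPoint_zero t n, rfl, fun _ hi => dyadicPoint_lt ht (hi.trans_le h)⟩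

variable {V : Type*} [AddCommGroup V]

/-- The defect of additivity of a two-parameter function at the midpoint of a dyadic interval. -/
def midDefect (f : Time T → Time T → V) (t : Time T) (n i : ℕ) : V :=
  f (dyadicPoint t n i) (dyadicPoint t (n + 1) (2 * i + 1))
    + f (dyadicPoint t (n + 1) (2 * i + 1)) (dyadicPoint t n (i + 1))
    - f (dyadicPoint t n i) (dyadicPoint t n (i + 1))

theorem sum_range_two_mul (f : ℕ → V) (N : ℕ) :
    ∑ j ∈ Finset.range (2 * N), f j = ∑ j ∈ Finset.range N, (f (2 * j) + f (2 * j + 1)) := by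
  induction N with
  | zero => simp
  | succ N ih =>
    rw [show 2 * (N + 1) = 2 * N + 1 + 1 by ring, Finset.sum_range_succ, Finset.sum_range_succ,
      Finset.sum_range_succ, ih]
    abel

theorem sum_range_mul (f : ℕ → V) (r P : ℕ) :
    ∑ i ∈ Finset.range r, ∑ j ∈ Finset.range P, f (i * P + j)
      = ∑ q ∈ Finset.range (r * P), f q := by
  induction r with
  | zero => simp
  | succ r ih => rw [Finset.sum_range_succ, ih, Nat.succ_mul, Finset.sum_range_add]

/-- Refining a dyadic interval changes a Riemann sum by the midpoint defects. -/
theorem sum_dyadic_sub (f : Time T → Time T → V) (t : Time T) (n i m : ℕ) :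
    ∑ j ∈ Finset.range (2 ^ m), f (dyadicPoint t (n + m) (i * 2 ^ m + j))
        (dyadicPoint t (n + m) (i * 2 ^ m + j + 1))
      - f (dyadicPoint t n i) (dyadicPoint t n (i + 1))
      = ∑ l ∈ Finset.range m, ∑ j ∈ Finset.range (2 ^ l), midDefect f t (n + l) (i * 2 ^ l + j) := by
  induction m with
  | zero => simp
  | succ m ih =>
    rw [Finset.sum_range_succ, ← ih, pow_succ', sum_range_two_mul,
      sub_add_eq_add_sub, ← Finset.sum_add_distrib]
    congr 1
    refine Finset.sum_congr rfl fun j _ => ?_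
    have e1 : i * (2 * 2 ^ m) + 2 * j = 2 * (i * 2 ^ m + j) := by ring
    have e2 : i * (2 * 2 ^ m) + (2 * j + 1) = 2 * (i * 2 ^ m + j) + 1 := by ring
    have e3 : 2 * (i * 2 ^ m + j) + 1 + 1 = 2 * (i * 2 ^ m + j + 1) := by ring
    rw [e1, e2, e3, ← add_assoc n, dyadicPoint_two_mul, dyadicPoint_two_mul, midDefect]
    abel

end DyadicPartition

/-! ### Elementary `L²` estimates. -/

section Bounds

variable {Ω : Type*} {mΩ : MeasurableSpace Ω} {μ : Measure Ω}
  {E G : Type*} [NormedAddCommGroup E] [NormedAddCommGroup G]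

theorem eLpNorm_add_le_ofReal {f g : Ω → E} (hf : AEStronglyMeasurable f μ)
    (hg : AEStronglyMeasurable g μ) {x y : ℝ} (hx0 : 0 ≤ x) (hy0 : 0 ≤ y)
    (hx : eLpNorm f 2 μ ≤ ENNReal.ofReal x) (hy : eLpNorm g 2 μ ≤ ENNReal.ofReal y) :
    eLpNorm (fun ω => f ω + g ω) 2 μ ≤ ENNReal.ofReal (x + y) := by
  rw [ENNReal.ofReal_add hx0 hy0]
  exact (eLpNorm_add_le hf hg one_le_two).trans (add_le_add hx hy)

theorem eLpNorm_le_ofReal_mul {f : Ω → E} {g : Ω → G} {c x : ℝ} (hc : 0 ≤ c)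
    (h : ∀ᵐ ω ∂μ, ‖f ω‖ ≤ c * ‖g ω‖) (hx : eLpNorm g 2 μ ≤ ENNReal.ofReal x) :
    eLpNorm f 2 μ ≤ ENNReal.ofReal (c * x) := by
  rw [ENNReal.ofReal_mul hc]
  exact (eLpNorm_le_mul_eLpNorm_of_ae_le_mul h 2).trans (mul_le_mul_right hx _)

theorem eLpNorm_sum_le_ofReal {f : ℕ → Ω → E} {N : ℕ} {x : ℕ → ℝ}
    (hf : ∀ i < N, AEStronglyMeasurable (f i) μ) (hx0 : ∀ i < N, 0 ≤ x i)
    (hx : ∀ i < N, eLpNorm (f i) 2 μ ≤ ENNReal.ofReal (x i)) :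
    eLpNorm (fun ω => ∑ i ∈ Finset.range N, f i ω) 2 μ
      ≤ ENNReal.ofReal (∑ i ∈ Finset.range N, x i) := by
  have e : (fun ω => ∑ i ∈ Finset.range N, f i ω) = ∑ i ∈ Finset.range N, f i := by
    funext ω; rw [Finset.sum_apply]
  rw [e, ENNReal.ofReal_sum_of_nonneg fun i hi => hx0 i (Finset.mem_range.1 hi)]
  exact (eLpNorm_sum_le (fun i hi => hf i (Finset.mem_range.1 hi)) one_le_two).trans
    (Finset.sum_le_sum fun i hi => hx i (Finset.mem_range.1 hi))

/-- Orthogonality lives in `L²`; on a probability space every `p ≥ 2`, including `∞`, reduces to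
that case. -/
theorem HolderLp.exists_bound_two [IsProbabilityMeasure μ] {T κ : ℝ} {p : ℝ≥0∞} (hp : 2 ≤ p)
    {A : Time T → Time T → Ω → E} (h : HolderLp μ κ p A)
    (hA : ∀ s t, AEStronglyMeasurable (A s t) μ) :
    ∃ C : ℝ, 0 ≤ C ∧ ∀ s t : Time T, s ≤ t → s ≠ t →
      eLpNorm (A s t) 2 μ ≤ ENNReal.ofReal (C * ((t : ℝ) - s) ^ κ) := by
  obtain ⟨C, hC⟩ := h
  refine ⟨C, C.coe_nonneg, fun s t hst hne => ?_⟩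
  rw [ENNReal.ofReal_mul C.coe_nonneg, ENNReal.ofReal_coe_nnreal]
  exact (eLpNorm_le_eLpNorm_of_exponent_le hp (hA s t)).trans (hC s t (lt_of_le_of_ne hst hne))

end Bounds

/-! ### Additivity defect of the germ of a stochastic controlled path. -/

section GermDefect

variable {α T : ℝ} {d : ℕ} {Ω : Type*} {mΩ : MeasurableSpace Ω} {μ : Measure Ω}
  {η : RoughPath α T d} {V : Type*} [NormedAddCommGroup V] [NormedSpace ℝ V]
  {Z : Time T → Ω → (EuclideanSpace ℝ (Fin d) →L[ℝ] V)}
  {Z' : Time T → Ω → (EuclideanSpace ℝ (Fin d) →L[ℝ] EuclideanSpace ℝ (Fin d) →L[ℝ] V)}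
  {ℱ : Filtration (Time T) mΩ} {γ γ' : ℝ} {p : ℝ≥0∞}

theorem continuous_contract (η : RoughPath α T d) (s t : Time T) :
    Continuous fun z : EuclideanSpace ℝ (Fin d) →L[ℝ] EuclideanSpace ℝ (Fin d) →L[ℝ] V =>
      contract η s t z := by
  unfold contract
  exact continuous_finsetSum _ fun i _ => continuous_finsetSum _ fun j _ => by fun_prop

theorem stronglyMeasurable_germ {m : MeasurableSpace Ω} {s : Time T}
    (hZ : StronglyMeasurable[m] (Z s)) (hD : StronglyMeasurable[m] (Z' s)) (t : Time T) :
    StronglyMeasurable[m] (germ η Z Z' s t) :=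
  (stronglyMeasurable_clm_apply hZ stronglyMeasurable_const).add
    ((continuous_contract η s t).comp_stronglyMeasurable hD)

/-- The defect of additivity of the germ of a stochastic controlled path: it is small in `L²`,
and its conditional expectation is smaller still. -/
theorem IsStochControlled.exists_germ_defect_bound [CompleteSpace V] [IsProbabilityMeasure μ]
    (hp : 2 ≤ p) (hγα : γ ≤ α) (hγ : 0 < γ) (hγ' : 0 < γ')
    (h : IsStochControlled ℱ μ η γ γ' p Z Z') :
    ∃ B : ℝ, 0 ≤ B ∧ ∀ s u t : Time T, s < u → u < t →
      eLpNorm (fun ω => germ η Z Z' s u ω + germ η Z Z' u t ω - germ η Z Z' s t ω) 2 μ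
        ≤ ENNReal.ofReal (B * ((t : ℝ) - s) ^ (α + γ)) ∧
      eLpNorm (μ[fun ω => germ η Z Z' s u ω + germ η Z Z' u t ω - germ η Z Z' s t ω | ℱ s]) 2 μ
        ≤ ENNReal.ofReal (B * ((t : ℝ) - s) ^ (α + γ + γ')) := by
  have hα : 0 < α := hγ.trans_le hγα
  have mZ : ∀ t, StronglyMeasurable (Z t) := fun t =>
    (h.progressive.stronglyAdapted t).mono (ℱ.le t)
  have mZ' : ∀ t, StronglyMeasurable (Z' t) := fun t =>
    (h.progressive'.stronglyAdapted t).mono (ℱ.le t)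
  obtain ⟨C1, hC1, h1⟩ := h.holder.exists_bound_two hp fun s t =>
    ((mZ t).sub (mZ s)).aestronglyMeasurable
  obtain ⟨C2, hC2, h2⟩ := h.holder'.exists_bound_two hp fun s t =>
    ((mZ' t).sub (mZ' s)).aestronglyMeasurable
  obtain ⟨C3, hC3, h3⟩ := h.condExp_remainder.exists_bound_two hp fun s t =>
    (stronglyMeasurable_condExp.mono (ℱ.le s)).aestronglyMeasurable
  obtain ⟨Cη, hCη, hη⟩ := exists_path_bound η
  obtain ⟨Cc, hCc, hc⟩ := exists_contract_bound (V := V) η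
  rcases lt_or_ge T 0 with hT | hT
  · exact ⟨0, le_rfl, fun s => absurd (s.2.1.trans s.2.2) (not_le.2 hT)⟩
  set o : Time T := ⟨0, le_rfl, hT⟩ with ho
  -- The initial value and the Hölder bound control the derivative in `L²` uniformly in time.
  obtain ⟨C0, hC0, h0⟩ : ∃ C0 : ℝ, 0 ≤ C0 ∧ ∀ s, eLpNorm (Z' s) 2 μ ≤ ENNReal.ofReal C0 := by
    have hm := (h.memLp_zero' o rfl).mono_exponent hp
    refine ⟨(eLpNorm (Z' o) 2 μ).toReal + C2 * T ^ γ', by positivity, fun s => ?_⟩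
    have e0 : eLpNorm (Z' o) 2 μ ≤ ENNReal.ofReal (eLpNorm (Z' o) 2 μ).toReal := by
      rw [ENNReal.ofReal_toReal hm.eLpNorm_ne_top]
    by_cases hs : o = s
    · rw [← hs]
      exact e0.trans (ENNReal.ofReal_le_ofReal (le_add_of_nonneg_right (by positivity)))
    · have hle : o ≤ s := Subtype.coe_le_coe.1 s.2.1
      have := eLpNorm_add_le_ofReal (mZ' o).aestronglyMeasurable
        ((mZ' s).sub (mZ' o)).aestronglyMeasurable ENNReal.toReal_nonneg (by positivity) e0
        ((h2 o s hle hs).trans (ENNReal.ofReal_le_ofReal (mul_le_mul_of_nonneg_left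
          (Real.rpow_le_rpow (time_sub_nonneg hle) (time_sub_le _ _) hγ'.le) hC2)))
      simpa using this
  have hpow : ∀ {x a b : ℝ}, 0 ≤ x → x ≤ T → 0 ≤ a → a ≤ b → x ^ b ≤ T ^ (b - a) * x ^ a :=
    fun hx hxT ha hab => rpow_le_const_mul_rpow hx hxT ha hab
  set KR := C1 + C0 * (Cη * T ^ (α - γ)) with hKR
  have hKR0 : 0 ≤ KR := by positivity
  set B := Cη * KR + Cη * C3 + Cc * C2 * T ^ (2 * α + γ' - (α + γ))
    + Cc * C2 * T ^ (2 * α + γ' - (α + γ + γ')) with hB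
  refine ⟨B, by positivity, fun s u t hsu hut => ?_⟩
  have hsu' := time_sub_nonneg hsu.le
  have hut' := time_sub_nonneg hut.le
  have hst' := time_sub_nonneg (hsu.trans hut).le
  have hle1 : (u : ℝ) - s ≤ t - s := by linarith
  have hle2 : (t : ℝ) - u ≤ t - s := by linarith
  have hleT := time_sub_le s t
  set x := (t : ℝ) - s with hx
  have eD : (fun ω => germ η Z Z' s u ω + germ η Z Z' u t ω - germ η Z Z' s t ω)
      = fun ω => remainder η Z Z' s u ω (η.path t - η.path u)
        + contract η u t (Z' u ω - Z' s ω) := by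
    funext ω; exact germ_defect η Z Z' hsu.le hut.le ω
  have mR : StronglyMeasurable (remainder η Z Z' s u) :=
    ((mZ u).sub (mZ s)).sub (stronglyMeasurable_clm_apply (mZ' s) stronglyMeasurable_const)
  have bη1 : ‖η.path u - η.path s‖ ≤ Cη * x ^ α := (hη s u hsu.le).trans
    (mul_le_mul_of_nonneg_left (Real.rpow_le_rpow hsu' hle1 hα.le) hCη)
  have bη2 : ‖η.path t - η.path u‖ ≤ Cη * x ^ α := (hη u t hut.le).trans
    (mul_le_mul_of_nonneg_left (Real.rpow_le_rpow hut' hle2 hα.le) hCη)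
  -- Without conditioning there is no cancellation in the remainder, which only inherits the order
  -- `γ` of the increments of `Z`.
  have bR : eLpNorm (remainder η Z Z' s u) 2 μ ≤ ENNReal.ofReal (KR * x ^ γ) := by
    have a1 : eLpNorm (fun ω => Z u ω - Z s ω) 2 μ ≤ ENNReal.ofReal (C1 * x ^ γ) :=
      (h1 s u hsu.le hsu.ne).trans (ENNReal.ofReal_le_ofReal
        (mul_le_mul_of_nonneg_left (Real.rpow_le_rpow hsu' hle1 hγ.le) hC1))
    have a2 : eLpNorm (fun ω => -(Z' s ω (η.path u - η.path s))) 2 μ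
        ≤ ENNReal.ofReal (Cη * x ^ α * C0) := by
      refine eLpNorm_le_ofReal_mul (by positivity) (Eventually.of_forall fun ω => ?_) (h0 s)
      rw [norm_neg, mul_comm]
      exact ((Z' s ω).le_opNorm _).trans (mul_le_mul_of_nonneg_left bη1 (norm_nonneg _))
    have a3 := eLpNorm_add_le_ofReal ((mZ u).sub (mZ s)).aestronglyMeasurable
      (stronglyMeasurable_clm_apply (mZ' s) stronglyMeasurable_const).neg.aestronglyMeasurable
      (by positivity) (by positivity) a1 a2
    have e : remainder η Z Z' s u = fun ω => (Z u - Z s) ω + -(Z' s ω (η.path u - η.path s)) := by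
      funext ω; rw [remainder, Pi.sub_apply, sub_eq_add_neg _ (Z' s ω _)]
    rw [e]
    refine a3.trans (ENNReal.ofReal_le_ofReal ?_)
    have := hpow hst' hleT hγ.le hγα
    calc _ ≤ C1 * x ^ γ + Cη * (T ^ (α - γ) * x ^ γ) * C0 := by gcongr
      _ = _ := by rw [hKR]; ring
  have mA : StronglyMeasurable fun ω => remainder η Z Z' s u ω (η.path t - η.path u) :=
    stronglyMeasurable_clm_apply mR stronglyMeasurable_const
  have mC : StronglyMeasurable fun ω => contract η u t (Z' u ω - Z' s ω) :=
    (continuous_contract η u t).comp_stronglyMeasurable ((mZ' u).sub (mZ' s))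
  have bA : eLpNorm (fun ω => remainder η Z Z' s u ω (η.path t - η.path u)) 2 μ
      ≤ ENNReal.ofReal (Cη * x ^ α * (KR * x ^ γ)) := by
    refine eLpNorm_le_ofReal_mul (by positivity) (Eventually.of_forall fun ω => ?_) bR
    rw [mul_comm]
    exact (ContinuousLinearMap.le_opNorm _ _).trans
      (mul_le_mul_of_nonneg_left bη2 (norm_nonneg _))
  have bC : eLpNorm (fun ω => contract η u t (Z' u ω - Z' s ω)) 2 μ
      ≤ ENNReal.ofReal (Cc * x ^ (2 * α) * (C2 * x ^ γ')) := by
    refine eLpNorm_le_ofReal_mul (by positivity) (Eventually.of_forall fun ω => ?_)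
      ((h2 s u hsu.le hsu.ne).trans (ENNReal.ofReal_le_ofReal
        (mul_le_mul_of_nonneg_left (Real.rpow_le_rpow hsu' hle1 hγ'.le) hC2)))
    refine (hc u t hut.le _).trans (mul_le_mul_of_nonneg_right ?_ (norm_nonneg _))
    exact mul_le_mul_of_nonneg_left (Real.rpow_le_rpow hut' hle2 (by positivity)) hCc
  have xA : x ^ α * x ^ γ = x ^ (α + γ) := (Real.rpow_add_of_nonneg hst' hα.le hγ.le).symm
  have xA' : x ^ α * x ^ (γ + γ') = x ^ (α + γ + γ') := by
    rw [add_assoc, Real.rpow_add_of_nonneg hst' hα.le (by positivity)]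
  have xC : x ^ (2 * α) * x ^ γ' = x ^ (2 * α + γ') :=
    (Real.rpow_add_of_nonneg hst' (by positivity) hγ'.le).symm
  have xC1 := hpow hst' hleT (show 0 ≤ α + γ by positivity)
    (show α + γ ≤ 2 * α + γ' by linarith)
  have xC2 := hpow hst' hleT (show 0 ≤ α + γ + γ' by positivity)
    (show α + γ + γ' ≤ 2 * α + γ' by linarith)
  rw [eD]
  constructor
  · refine (eLpNorm_add_le_ofReal mA.aestronglyMeasurable mC.aestronglyMeasurable (by positivity)
      (by positivity) bA bC).trans (ENNReal.ofReal_le_ofReal ?_)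
    have hnn : 0 ≤ x ^ (α + γ) := by positivity
    calc _ = Cη * KR * (x ^ α * x ^ γ) + Cc * C2 * (x ^ (2 * α) * x ^ γ') := by ring
      _ ≤ Cη * KR * x ^ (α + γ)
          + Cc * C2 * (T ^ (2 * α + γ' - (α + γ)) * x ^ (α + γ)) := by rw [xA, xC]; gcongr
      _ = (Cη * KR + Cc * C2 * T ^ (2 * α + γ' - (α + γ))) * x ^ (α + γ) := by ring
      _ ≤ B * x ^ (α + γ) := by
          refine mul_le_mul_of_nonneg_right ?_ hnn
          have p1 : 0 ≤ Cη * C3 := by positivity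
          have p2 : 0 ≤ Cc * C2 * T ^ (2 * α + γ' - (α + γ + γ')) := by positivity
          rw [hB]; linarith
  · have iR : Integrable (remainder η Z Z' s u) μ := MemLp.integrable one_le_two
      ⟨mR.aestronglyMeasurable, bR.trans_lt ENNReal.ofReal_lt_top⟩
    have iA : Integrable (fun ω => remainder η Z Z' s u ω (η.path t - η.path u)) μ :=
      MemLp.integrable one_le_two ⟨mA.aestronglyMeasurable, bA.trans_lt ENNReal.ofReal_lt_top⟩
    have iC : Integrable (fun ω => contract η u t (Z' u ω - Z' s ω)) μ :=
      MemLp.integrable one_le_two ⟨mC.aestronglyMeasurable, bC.trans_lt ENNReal.ofReal_lt_top⟩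
    have e1 := condExp_add iA iC (ℱ s)
    -- The increment of the rough path is deterministic and leaves the conditional expectation, so
    -- the conditional remainder bound applies.
    have e2 := (ContinuousLinearMap.apply ℝ V (η.path t - η.path u)).comp_condExp_comm
      (m := ℱ s) iR
    have b1 : eLpNorm (μ[fun ω => remainder η Z Z' s u ω (η.path t - η.path u) | ℱ s]) 2 μ
        ≤ ENNReal.ofReal (Cη * x ^ α * (C3 * x ^ (γ + γ'))) := by
      refine eLpNorm_le_ofReal_mul (g := μ[remainder η Z Z' s u | ℱ s]) (by positivity) ?_
        ((h3 s u hsu.le hsu.ne).trans (ENNReal.ofReal_le_ofReal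
          (mul_le_mul_of_nonneg_left (Real.rpow_le_rpow hsu' hle1 (by positivity)) hC3)))
      filter_upwards [e2] with ω hω
      have : μ[fun ω => remainder η Z Z' s u ω (η.path t - η.path u) | ℱ s] ω
          = μ[remainder η Z Z' s u | ℱ s] ω (η.path t - η.path u) := hω.symm
      rw [this, mul_comm]
      exact (ContinuousLinearMap.le_opNorm _ _).trans
        (mul_le_mul_of_nonneg_left bη2 (norm_nonneg _))
    -- Here no cancellation is needed: `2α + γ' ≥ α + γ + γ'` already.
    have b2 := (eLpNorm_condExp_le_eLpNorm (m := ℱ s)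
      (fun ω => contract η u t (Z' u ω - Z' s ω)) one_le_two).trans bC
    refine (eLpNorm_congr_ae e1).trans_le ((eLpNorm_add_le_ofReal
      integrable_condExp.aestronglyMeasurable integrable_condExp.aestronglyMeasurable
      (by positivity) (by positivity) b1 b2).trans (ENNReal.ofReal_le_ofReal ?_))
    have hnn : 0 ≤ x ^ (α + γ + γ') := by positivity
    calc _ = Cη * C3 * (x ^ α * x ^ (γ + γ')) + Cc * C2 * (x ^ (2 * α) * x ^ γ') := by ring
      _ ≤ Cη * C3 * x ^ (α + γ + γ')
          + Cc * C2 * (T ^ (2 * α + γ' - (α + γ + γ')) * x ^ (α + γ + γ')) := by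
          rw [xA', xC]; gcongr
      _ = (Cη * C3 + Cc * C2 * T ^ (2 * α + γ' - (α + γ + γ'))) * x ^ (α + γ + γ') := by ring
      _ ≤ B * x ^ (α + γ + γ') := by
          refine mul_le_mul_of_nonneg_right ?_ hnn
          have p1 : 0 ≤ Cη * KR := by positivity
          have p2 : 0 ≤ Cc * C2 * T ^ (2 * α + γ' - (α + γ)) := by positivity
          rw [hB]; linarith

end GermDefect

/-! ### Stochastic sewing along dyadic levels. -/

section StochasticSewing

variable {T : ℝ} {Ω : Type*} {mΩ : MeasurableSpace Ω} {μ : Measure Ω}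
  {V : Type*} [NormedAddCommGroup V] [InnerProductSpace ℝ V]
  {κ κ' B : ℝ} {ℱ : Filtration (Time T) mΩ}

/-- The midpoint defects of a random two-parameter function `f` have order `κ` in `L²` and their
conditional expectations have order `κ'`. -/
structure DefectBound (ℱ : Filtration (Time T) mΩ) (μ : Measure Ω) (κ κ' B : ℝ)
    (f : Time T → Time T → Ω → V) : Prop where
  measurable : ∀ s t, s ≤ t → StronglyMeasurable[ℱ s] (f s t)
  bound : ∀ s u t : Time T, s < u → u < t →
    eLpNorm (fun ω => f s u ω + f u t ω - f s t ω) 2 μ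
      ≤ ENNReal.ofReal (B * ((t : ℝ) - s) ^ κ)
  condExp_bound : ∀ s u t : Time T, s < u → u < t →
    eLpNorm (μ[fun ω => f s u ω + f u t ω - f s t ω | ℱ s]) 2 μ
      ≤ ENNReal.ofReal (B * ((t : ℝ) - s) ^ κ')

variable {f : Time T → Time T → Ω → V}

/-- The correction to `f` on a dyadic interval when it is refined `m` times. -/
def dyadicCorrection (f : Time T → Time T → Ω → V) (t : Time T) (n m i : ℕ) (ω : Ω) : V :=
  ∑ j ∈ Finset.range (2 ^ m), f (dyadicPoint t (n + m) (i * 2 ^ m + j))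
      (dyadicPoint t (n + m) (i * 2 ^ m + j + 1)) ω
    - f (dyadicPoint t n i) (dyadicPoint t n (i + 1)) ω

theorem dyadicCorrection_eq {V : Type*} [NormedAddCommGroup V] (f : Time T → Time T → Ω → V) (t : Time T) (n m i : ℕ) (ω : Ω) :
    dyadicCorrection f t n m i ω = ∑ l ∈ Finset.range m, ∑ j ∈ Finset.range (2 ^ l),
      midDefect (fun s t => f s t ω) t (n + l) (i * 2 ^ l + j) :=
  sum_dyadic_sub (fun s t => f s t ω) t n i m

theorem midpoint_lt {t : Time T} (ht : 0 < (t : ℝ)) {n q : ℕ} (hq : q < 2 ^ n) :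
    dyadicPoint t n q < dyadicPoint t (n + 1) (2 * q + 1) ∧
      dyadicPoint t (n + 1) (2 * q + 1) < dyadicPoint t n (q + 1) := by
  rw [← dyadicPoint_two_mul t n q, ← dyadicPoint_two_mul t n (q + 1)]
  have h : 2 ^ (n + 1) = 2 * 2 ^ n := pow_succ' 2 n
  exact ⟨dyadicPoint_lt ht (by omega), dyadicPoint_lt ht (by omega)⟩

/-- Weighted sums of midpoint defects at one dyadic level. -/
theorem DefectBound.eLpNorm_sum_midDefect_le [CompleteSpace V] [IsProbabilityMeasure μ]
    (h : DefectBound ℱ μ κ κ' B f) (hB : 0 ≤ B) {t : Time T} (ht : 0 < (t : ℝ)) {n i₀ N : ℕ}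
    (hN : i₀ + N ≤ 2 ^ n) {w : ℕ → Ω → (V →L[ℝ] V)} {K : ℝ} (hK : 0 ≤ K)
    (hw : ∀ q < N, StronglyMeasurable[ℱ (dyadicPoint t n (i₀ + q))] (w q))
    (hwK : ∀ q ω, ‖w q ω‖ ≤ K) :
    eLpNorm (fun ω => ∑ q ∈ Finset.range N,
      w q ω (midDefect (fun s t => f s t ω) t n (i₀ + q))) 2 μ
      ≤ ENNReal.ofReal (K * B * (N * (t / 2 ^ n) ^ κ'
        + √N * ((t / 2 ^ n) ^ κ' + (t / 2 ^ n) ^ κ))) := by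
  have ht2 : 0 < (t : ℝ) / 2 ^ n := by positivity
  have hmono := monotone_dyadicPoint t n
  have hm : ∀ q < N, StronglyMeasurable[ℱ (dyadicPoint t n (i₀ + (q + 1)))] fun ω =>
      midDefect (fun s t => f s t ω) t n (i₀ + q) := fun q hq => by
    obtain ⟨h1, h2⟩ := midpoint_lt ht (show i₀ + q < 2 ^ n by omega)
    have m1 := (h.measurable _ _ h1.le).mono (ℱ.mono (hmono (show i₀ + q ≤ i₀ + (q + 1) by omega)))
    have m2 := (h.measurable _ _ h2.le).mono (ℱ.mono h2.le)
    have m3 := (h.measurable _ _ (h1.trans h2).le).mono (ℱ.mono (h1.trans h2).le)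
    exact (m1.add m2).sub m3
  have hb : ∀ q < N, eLpNorm (fun ω => midDefect (fun s t => f s t ω) t n (i₀ + q)) 2 μ
      ≤ ENNReal.ofReal (B * (t / 2 ^ n) ^ κ) := fun q hq => by
    obtain ⟨h1, h2⟩ := midpoint_lt ht (show i₀ + q < 2 ^ n by omega)
    have := h.bound _ _ _ h1 h2
    rwa [dyadicPoint_sub t (show i₀ + q < 2 ^ n by omega)] at this
  have ha : ∀ q < N, eLpNorm (μ[fun ω => midDefect (fun s t => f s t ω) t n (i₀ + q) |
      ℱ (dyadicPoint t n (i₀ + q))]) 2 μ ≤ ENNReal.ofReal (B * (t / 2 ^ n) ^ κ') := fun q hq => by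
    obtain ⟨h1, h2⟩ := midpoint_lt ht (show i₀ + q < 2 ^ n by omega)
    have := h.condExp_bound _ _ _ h1 h2
    rwa [dyadicPoint_sub t (show i₀ + q < 2 ^ n by omega)] at this
  have hw' : ∀ (q : ℕ) ω (v : V), ‖w q ω v‖ ≤ K * ‖v‖ := fun q ω v =>
    ((w q ω).le_opNorm _).trans (mul_le_mul_of_nonneg_right (hwK q ω) (norm_nonneg _))
  have hwb : ∀ q < N, eLpNorm (fun ω => w q ω (midDefect (fun s t => f s t ω) t n (i₀ + q))) 2 μ
      ≤ ENNReal.ofReal (K * (B * (t / 2 ^ n) ^ κ)) := fun q hq =>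
    eLpNorm_le_ofReal_mul hK (Eventually.of_forall fun ω => hw' q ω _) (hb q hq)
  have hwm : ∀ q < N, StronglyMeasurable[ℱ (dyadicPoint t n (i₀ + (q + 1)))] fun ω =>
      w q ω (midDefect (fun s t => f s t ω) t n (i₀ + q)) := fun q hq =>
    stronglyMeasurable_clm_apply ((hw q hq).mono (ℱ.mono (hmono (by omega)))) (hm q hq)
  have hwa : ∀ q < N, eLpNorm (μ[fun ω => w q ω (midDefect (fun s t => f s t ω) t n (i₀ + q)) |
      ℱ (dyadicPoint t n (i₀ + q))]) 2 μ ≤ ENNReal.ofReal (K * (B * (t / 2 ^ n) ^ κ')) :=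
    fun q hq => by
      have i1 : Integrable (fun ω => midDefect (fun s t => f s t ω) t n (i₀ + q)) μ :=
        MemLp.integrable one_le_two ⟨((hm q hq).mono (ℱ.le _)).aestronglyMeasurable,
          (hb q hq).trans_lt ENNReal.ofReal_lt_top⟩
      have i2 : Integrable (fun ω => w q ω (midDefect (fun s t => f s t ω) t n (i₀ + q))) μ :=
        MemLp.integrable one_le_two ⟨((hwm q hq).mono (ℱ.le _)).aestronglyMeasurable,
          (hwb q hq).trans_lt ENNReal.ofReal_lt_top⟩
      -- The weight is known at the left end of the interval, so it factors out and the weighted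
      -- defect keeps the small conditional mean.
      have e := condExp_bilin_of_stronglyMeasurable_left (ContinuousLinearMap.id ℝ (V →L[ℝ] V))
        (hw q hq) i2 i1
      refine eLpNorm_le_ofReal_mul hK ?_ (ha q hq)
      filter_upwards [e] with ω hω
      exact (congrArg norm hω).trans_le (hw' q ω _)
  refine (eLpNorm_sum_le_of_condExp (G := fun q => ℱ (dyadicPoint t n (i₀ + q)))
    (fun a b hab => ℱ.mono (hmono (by omega))) (fun q => ℱ.le _) (by positivity) (by positivity)
    hwm hwb hwa).trans (le_of_eq ?_)
  congr 1; ring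

/-- Weighted sums of corrections, with weights that are adapted to the dyadic partition. -/
theorem DefectBound.eLpNorm_sum_correction_le [CompleteSpace V] [IsProbabilityMeasure μ]
    (h : DefectBound ℱ μ κ κ' B f) (hB : 0 ≤ B) {t : Time T} (ht : 0 < (t : ℝ)) {n i₀ r : ℕ}
    (hr : i₀ + r ≤ 2 ^ n) {w : ℕ → Ω → (V →L[ℝ] V)} {K : ℝ} (hK : 0 ≤ K)
    (hw : ∀ i < r, StronglyMeasurable[ℱ (dyadicPoint t n (i₀ + i))] (w i))
    (hwK : ∀ i ω, ‖w i ω‖ ≤ K) (m : ℕ) :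
    eLpNorm (fun ω => ∑ i ∈ Finset.range r, w i ω (dyadicCorrection f t n m (i₀ + i) ω)) 2 μ
      ≤ ENNReal.ofReal (∑ l ∈ Finset.range m, K * B * ((r * 2 ^ l : ℕ) * (t / 2 ^ (n + l)) ^ κ'
        + √(r * 2 ^ l : ℕ) * ((t / 2 ^ (n + l)) ^ κ' + (t / 2 ^ (n + l)) ^ κ))) := by
  -- Regrouped by level: the fine interval `q` at level `n + l` lies in the coarse interval `q / 2 ^
  -- l`, whose weight is known even earlier. The bound for one level thus applies to all `r * 2 ^ l`
  -- defects at once.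
  have e : (fun ω => ∑ i ∈ Finset.range r, w i ω (dyadicCorrection f t n m (i₀ + i) ω))
      = fun ω => ∑ l ∈ Finset.range m, ∑ q ∈ Finset.range (r * 2 ^ l),
        w (q / 2 ^ l) ω (midDefect (fun s t => f s t ω) t (n + l) (i₀ * 2 ^ l + q)) := by
    funext ω
    simp only [dyadicCorrection_eq, map_sum]
    rw [Finset.sum_comm]
    refine Finset.sum_congr rfl fun l _ => ?_
    rw [← sum_range_mul]
    refine Finset.sum_congr rfl fun i _ => Finset.sum_congr rfl fun j hj => ?_
    have hj := Finset.mem_range.1 hj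
    rw [Nat.add_comm (i * 2 ^ l) j, Nat.add_mul_div_right _ _ (by positivity),
      Nat.div_eq_of_lt hj, zero_add]
    congr 2
    ring
  have hlt : ∀ {l q : ℕ}, q < r * 2 ^ l → q / 2 ^ l < r := fun hq =>
    Nat.div_lt_of_lt_mul (by rwa [mul_comm])
  have hwm : ∀ l q, q < r * 2 ^ l →
      StronglyMeasurable[ℱ (dyadicPoint t (n + l) (i₀ * 2 ^ l + q))] (w (q / 2 ^ l)) :=
    fun l q hq => (hw _ (hlt hq)).mono (ℱ.mono (by
      rw [← dyadicPoint_refine t n l, add_mul]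
      exact monotone_dyadicPoint t _ (Nat.add_le_add_left (Nat.div_mul_le_self _ _) _)))
  have hN : ∀ l, i₀ * 2 ^ l + r * 2 ^ l ≤ 2 ^ (n + l) := fun l => by
    rw [← add_mul, pow_add]
    exact Nat.mul_le_mul_right _ hr
  rw [e]
  refine eLpNorm_sum_le_ofReal (fun l _ => ?_) (fun l _ => ?_) fun l _ =>
    h.eLpNorm_sum_midDefect_le hB ht (hN l) hK (hwm l) fun q ω => hwK _ ω
  · refine (Finset.stronglyMeasurable_fun_sum _ fun q hq => ?_).aestronglyMeasurable
    have hq := Finset.mem_range.1 hq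
    refine stronglyMeasurable_clm_apply ((hwm l q hq).mono (ℱ.le _)) ?_
    obtain ⟨h1, h2⟩ := midpoint_lt ht (show i₀ * 2 ^ l + q < 2 ^ (n + l) by
      have := hN l; omega)
    exact (((h.measurable _ _ h1.le).mono (ℱ.le _)).add
      ((h.measurable _ _ h2.le).mono (ℱ.le _))).sub
      ((h.measurable _ _ (h1.trans h2).le).mono (ℱ.le _))
  · have : 0 ≤ (t : ℝ) / 2 ^ (n + l) := by positivity
    positivity

/-- The geometric series behind the sewing lemma. -/
theorem exists_sum_levels_le (hκ : 1 / 2 < κ) (hκ' : 1 < κ') :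
    ∃ C : ℝ, 0 ≤ C ∧ ∀ (t : ℝ) (n m r : ℕ), 0 ≤ t →
      ∑ l ∈ Finset.range m, ((r * 2 ^ l : ℕ) * (t / 2 ^ (n + l)) ^ κ'
        + √(r * 2 ^ l : ℕ) * ((t / 2 ^ (n + l)) ^ κ' + (t / 2 ^ (n + l)) ^ κ))
      ≤ C * (r * (t / 2 ^ n) ^ κ' + √r * (t / 2 ^ n) ^ κ) := by
  -- The ratios of the two geometric series; `a < 1` is `κ' > 1` for the means, and `b < 1` is `κ >
  -- 1 / 2` for the martingale parts.
  set a : ℝ := 2 / 2 ^ κ' with ha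
  set b : ℝ := √2 / 2 ^ κ with hb
  have ha0 : 0 ≤ a := by positivity
  have hb0 : 0 ≤ b := by positivity
  have ha1 : a < 1 := by
    rw [ha, div_lt_one (by positivity)]
    calc (2 : ℝ) = 2 ^ (1 : ℝ) := (Real.rpow_one 2).symm
      _ < 2 ^ κ' := Real.rpow_lt_rpow_of_exponent_lt one_lt_two hκ'
  have hb1 : b < 1 := by
    rw [hb, div_lt_one (by positivity), Real.sqrt_eq_rpow]
    exact Real.rpow_lt_rpow_of_exponent_lt one_lt_two hκ
  have geo : ∀ {q : ℝ} (m : ℕ), 0 ≤ q → q < 1 → ∑ l ∈ Finset.range m, q ^ l ≤ (1 - q)⁻¹ :=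
    fun m h0 h1 => by
      rw [← tsum_geometric_of_lt_one h0 h1]
      exact (summable_geometric_of_lt_one h0 h1).sum_le_tsum _ fun i _ => pow_nonneg h0 i
  have hpow : ∀ {t : ℝ} (n l : ℕ) (c : ℝ), 0 ≤ t →
      (t / 2 ^ (n + l)) ^ c = (t / 2 ^ n) ^ c * ((2 ^ c)⁻¹) ^ l := fun n l c ht => by
    rw [pow_add, ← div_div, Real.div_rpow (by positivity) (by positivity), div_eq_mul_inv, inv_pow,
      Real.rpow_pow_comm zero_le_two]
  refine ⟨2 * (1 - a)⁻¹ + (1 - b)⁻¹, by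
    have := inv_nonneg.2 (sub_nonneg.2 ha1.le)
    have := inv_nonneg.2 (sub_nonneg.2 hb1.le)
    positivity, fun t n m r ht => ?_⟩
  set x := (r : ℝ) * (t / 2 ^ n) ^ κ' with hx
  set y := √(r : ℝ) * (t / 2 ^ n) ^ κ with hy
  have hx0 : 0 ≤ x := by positivity
  have hy0 : 0 ≤ y := by positivity
  have hterm : ∀ l ∈ Finset.range m, ((r * 2 ^ l : ℕ) * (t / 2 ^ (n + l)) ^ κ'
        + √(r * 2 ^ l : ℕ) * ((t / 2 ^ (n + l)) ^ κ' + (t / 2 ^ (n + l)) ^ κ))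
      ≤ 2 * x * a ^ l + y * b ^ l := fun l _ => by
    -- The mixed term, square root times order `κ'`, is absorbed into the linear one; hence the
    -- factor `2` in the constant.
    have hs : √((r * 2 ^ l : ℕ) : ℝ) ≤ (r * 2 ^ l : ℕ) := by
      rcases Nat.eq_zero_or_pos (r * 2 ^ l) with h | h
      · rw [h]; simp
      · have h1 : (1 : ℝ) ≤ (r * 2 ^ l : ℕ) := by exact_mod_cast h
        exact Real.sqrt_le_iff.2 ⟨by positivity, by nlinarith⟩
    have hs2 : √((r * 2 ^ l : ℕ) : ℝ) = √(r : ℝ) * √2 ^ l := by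
      have h2 : (2 : ℝ) ^ l = (√2 ^ l) ^ 2 := by
        rw [← pow_mul, mul_comm, pow_mul, Real.sq_sqrt zero_le_two]
      push_cast
      rw [Real.sqrt_mul (by positivity), h2, Real.sqrt_sq (by positivity)]
    have e1 : ((r * 2 ^ l : ℕ) : ℝ) * (t / 2 ^ (n + l)) ^ κ' = x * a ^ l := by
      rw [hpow n l κ' ht, hx, ha, div_eq_mul_inv 2, mul_pow]
      push_cast; ring
    have e2 : √((r * 2 ^ l : ℕ) : ℝ) * (t / 2 ^ (n + l)) ^ κ = y * b ^ l := by
      rw [hs2, hpow n l κ ht, hy, hb, div_eq_mul_inv (√2), mul_pow]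
      ring
    have e3 : √((r * 2 ^ l : ℕ) : ℝ) * (t / 2 ^ (n + l)) ^ κ' ≤ x * a ^ l := by
      rw [← e1]
      exact mul_le_mul_of_nonneg_right hs (by positivity)
    rw [mul_add, e1, e2]
    linarith
  refine (Finset.sum_le_sum hterm).trans ?_
  rw [Finset.sum_add_distrib, ← Finset.mul_sum, ← Finset.mul_sum]
  have g1 := geo m ha0 ha1
  have g2 := geo m hb0 hb1
  have p1 := inv_nonneg.2 (sub_nonneg.2 ha1.le)
  have p2 := inv_nonneg.2 (sub_nonneg.2 hb1.le)
  have h1 := mul_le_mul_of_nonneg_left g1 hx0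
  have h2 := mul_le_mul_of_nonneg_left g2 hy0
  nlinarith [mul_nonneg hx0 p2, mul_nonneg hy0 p1]

end StochasticSewing

/-! ### Riemann sums of the sewing error against the inverse flow. -/

section SewingLimit

variable {T : ℝ} {Ω : Type*} {mΩ : MeasurableSpace Ω} {μ : Measure Ω}
  {V : Type*} [NormedAddCommGroup V] [InnerProductSpace ℝ V]
  {ℱ : Filtration (Time T) mΩ} {κ κ' B : ℝ} {f : Time T → Time T → Ω → V}

theorem DefectBound.stronglyMeasurable_correction (h : DefectBound ℱ μ κ κ' B f) (t : Time T)
    (n m i : ℕ) : StronglyMeasurable (dyadicCorrection f t n m i) :=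
  (Finset.stronglyMeasurable_fun_sum _ fun _ _ =>
    (h.measurable _ _ (monotone_dyadicPoint t _ (Nat.le_succ _))).mono (ℱ.le _)).sub
    ((h.measurable _ _ (monotone_dyadicPoint t n i.le_succ)).mono (ℱ.le _))

theorem tendsto_pow_mul_mesh_rpow (t : ℝ) (ht : 0 ≤ t) {c : ℝ} (hc : 1 < c) :
    Tendsto (fun n : ℕ => (2 : ℝ) ^ n * (t / 2 ^ n) ^ c) atTop (𝓝 0) := by
  have h := (tendsto_mesh_rpow t (sub_pos.2 hc)).const_mul t
  rw [mul_zero] at h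
  refine h.congr fun n => ?_
  have h0 : 0 ≤ t / 2 ^ n := by positivity
  conv_rhs => rw [show c = 1 + (c - 1) by ring, Real.rpow_add_of_nonneg h0 zero_le_one
    (by linarith), Real.rpow_one]
  field_simp

theorem tendsto_sqrt_pow_mul_mesh_rpow (t : ℝ) (ht : 0 ≤ t) {c : ℝ} (hc : 1 / 2 < c) :
    Tendsto (fun n : ℕ => √((2 : ℝ) ^ n) * (t / 2 ^ n) ^ c) atTop (𝓝 0) := by
  have h := (tendsto_mesh_rpow t (sub_pos.2 hc)).const_mul √t
  rw [mul_zero] at h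
  refine h.congr fun n => ?_
  have h0 : 0 ≤ t / 2 ^ n := by positivity
  conv_rhs => rw [show c = 1 / 2 + (c - 1 / 2) by ring, Real.rpow_add_of_nonneg h0 (by norm_num)
    (by linarith), ← Real.sqrt_eq_rpow, Real.sqrt_div ht]
  have : √((2 : ℝ) ^ n) ≠ 0 := by positivity
  field_simp

/-- Riemann sums of the corrections against a bounded Hölder continuous adapted integrator are
small in `L²`, uniformly in the level of refinement. -/
theorem DefectBound.exists_weighted_bound [CompleteSpace V] [IsProbabilityMeasure μ]
    (h : DefectBound ℱ μ κ κ' B f) (hB : 0 ≤ B) (hκ : 1 / 2 < κ) (hκ' : 1 < κ') {a K : ℝ}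
    (ha : 0 ≤ a) (haκ : 1 < a + κ) (hK : 0 ≤ K) {w : Time T → Ω → (V →L[ℝ] V)}
    (hw : ∀ t, StronglyMeasurable[ℱ t] (w t)) (hwK : ∀ t ω, ‖w t ω‖ ≤ K)
    (hwa : ∀ s t ω, s ≤ t → ‖w t ω - w s ω‖ ≤ K * ((t : ℝ) - s) ^ a)
    {t : Time T} (ht : 0 < (t : ℝ)) :
    ∃ ρ : ℕ → ℝ, Tendsto ρ atTop (𝓝 0) ∧ ∀ n m,
      eLpNorm (fun ω => ∑ i ∈ Finset.range (2 ^ n), w (dyadicPoint t n (i + 1)) ω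
        (dyadicCorrection f t n m i ω)) 2 μ ≤ ENNReal.ofReal (ρ n) := by
  obtain ⟨C, hC, hgeo⟩ := exists_sum_levels_le hκ hκ'
  set x : ℕ → ℝ := fun n => t / 2 ^ n with hx
  have hx0 : ∀ n, 0 ≤ x n := fun n => by have := t.2.1; positivity
  refine ⟨fun n => K * B * (C * (2 ^ n * x n ^ κ' + √(2 ^ n) * x n ^ κ))
    + K * B * C * (2 ^ n * x n ^ (a + κ') + 2 ^ n * x n ^ (a + κ)), ?_, fun n m => ?_⟩
  · have l1 := tendsto_pow_mul_mesh_rpow t t.2.1 hκ'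
    have l2 := tendsto_sqrt_pow_mul_mesh_rpow t t.2.1 hκ
    have l3 := tendsto_pow_mul_mesh_rpow t t.2.1 (show 1 < a + κ' by linarith)
    have l4 := tendsto_pow_mul_mesh_rpow t t.2.1 haκ
    simpa using (((l1.add l2).const_mul C).const_mul (K * B)).add
      ((l3.add l4).const_mul (K * B * C))
  have mw : ∀ s, StronglyMeasurable (w s) := fun s => (hw s).mono (ℱ.le s)
  have mD := h.stronglyMeasurable_correction t n m
  have b1 : eLpNorm (fun ω => ∑ i ∈ Finset.range (2 ^ n), w (dyadicPoint t n i) ω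
      (dyadicCorrection f t n m i ω)) 2 μ
      ≤ ENNReal.ofReal (K * B * (C * (2 ^ n * x n ^ κ' + √(2 ^ n) * x n ^ κ))) := by
    have := h.eLpNorm_sum_correction_le hB ht (n := n) (i₀ := 0) (r := 2 ^ n) (by simp)
      (w := fun i => w (dyadicPoint t n i)) hK (fun i _ => by rw [zero_add]; exact hw _)
      (fun i ω => hwK _ ω) m
    simp only [zero_add] at this
    refine this.trans (ENNReal.ofReal_le_ofReal ?_)
    rw [← Finset.mul_sum]
    refine mul_le_mul_of_nonneg_left ((hgeo t n m (2 ^ n) t.2.1).trans (le_of_eq ?_))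
      (by positivity)
    push_cast; rfl
  have b2 : ∀ i < 2 ^ n, eLpNorm (dyadicCorrection f t n m i) 2 μ
      ≤ ENNReal.ofReal (B * (C * (x n ^ κ' + x n ^ κ))) := fun i hi => by
    have := h.eLpNorm_sum_correction_le hB ht (n := n) (i₀ := i) (r := 1) hi
      (w := fun _ _ => ContinuousLinearMap.id ℝ V) zero_le_one
      (fun _ _ => stronglyMeasurable_const) (fun _ _ => ContinuousLinearMap.norm_id_le) m
    simp only [Finset.range_one, Finset.sum_singleton, add_zero, ContinuousLinearMap.id_apply,
      one_mul] at this
    refine this.trans (ENNReal.ofReal_le_ofReal ?_)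
    rw [← Finset.mul_sum]
    refine mul_le_mul_of_nonneg_left (le_trans (le_of_eq ?_) ((hgeo t n m 1 t.2.1).trans
      (le_of_eq ?_))) hB
    · simp only [one_mul]
    · rw [Nat.cast_one, Real.sqrt_one, one_mul, one_mul]
  have b3 : eLpNorm (fun ω => ∑ i ∈ Finset.range (2 ^ n),
      (w (dyadicPoint t n (i + 1)) ω - w (dyadicPoint t n i) ω)
        (dyadicCorrection f t n m i ω)) 2 μ
      ≤ ENNReal.ofReal (∑ i ∈ Finset.range (2 ^ n), K * x n ^ a *
        (B * (C * (x n ^ κ' + x n ^ κ)))) := by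
    refine eLpNorm_sum_le_ofReal (fun i _ => (stronglyMeasurable_clm_apply ((mw _).sub (mw _))
      (mD i)).aestronglyMeasurable) (fun i _ => by have := hx0 n; positivity) fun i hi => ?_
    refine eLpNorm_le_ofReal_mul (by have := hx0 n; positivity) (Eventually.of_forall fun ω => ?_)
      (b2 i hi)
    refine (ContinuousLinearMap.le_opNorm _ _).trans (mul_le_mul_of_nonneg_right ?_
      (norm_nonneg _))
    have := hwa _ _ ω (monotone_dyadicPoint t n i.le_succ)
    rwa [dyadicPoint_sub t hi] at this
  -- The weight at the right end is not adapted to the interval. Its left value is treated by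
  -- orthogonality, its increment by the triangle inequality: `2 ^ n` terms whose slowest part has
  -- order `a + κ > 1`.
  have e : (fun ω => ∑ i ∈ Finset.range (2 ^ n), w (dyadicPoint t n (i + 1)) ω
        (dyadicCorrection f t n m i ω)) = fun ω => (∑ i ∈ Finset.range (2 ^ n),
        w (dyadicPoint t n i) ω (dyadicCorrection f t n m i ω))
        + ∑ i ∈ Finset.range (2 ^ n), (w (dyadicPoint t n (i + 1)) ω - w (dyadicPoint t n i) ω)
        (dyadicCorrection f t n m i ω) := by
    funext ω
    rw [← Finset.sum_add_distrib]
    refine Finset.sum_congr rfl fun i _ => ?_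
    rw [sub_apply, add_sub_cancel]
  rw [e]
  have hx1 := hx0 n
  refine (eLpNorm_add_le_ofReal
    (Finset.stronglyMeasurable_fun_sum _ fun i _ =>
      stronglyMeasurable_clm_apply (mw _) (mD i)).aestronglyMeasurable
    (Finset.stronglyMeasurable_fun_sum _ fun i _ =>
      stronglyMeasurable_clm_apply ((mw _).sub (mw _)) (mD i)).aestronglyMeasurable
    (by positivity) (Finset.sum_nonneg fun i _ => by positivity) b1 b3).trans
    (ENNReal.ofReal_le_ofReal (le_of_eq ?_))
  beta_reduce
  rw [Finset.sum_const, Finset.card_range, nsmul_eq_mul,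
    Real.rpow_add_of_nonneg hx1 ha (by linarith), Real.rpow_add_of_nonneg hx1 ha (by linarith)]
  push_cast; ring

/-- The increments of the sewing limit `I` differ from `f` by an error whose Riemann sums against
a bounded Hölder continuous adapted integrator vanish in the limit. -/
theorem DefectBound.exists_subseq_tendsto [CompleteSpace V] [IsProbabilityMeasure μ]
    (h : DefectBound ℱ μ κ κ' B f) (hB : 0 ≤ B) (hκ : 1 / 2 < κ) (hκ' : 1 < κ') {a K : ℝ}
    (ha : 0 ≤ a) (haκ : 1 < a + κ) (hK : 0 ≤ K) {w : Time T → Ω → (V →L[ℝ] V)}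
    (hw : ∀ t, StronglyMeasurable[ℱ t] (w t)) (hwK : ∀ t ω, ‖w t ω‖ ≤ K)
    (hwa : ∀ s t ω, s ≤ t → ‖w t ω - w s ω‖ ≤ K * ((t : ℝ) - s) ^ a)
    {t : Time T} (ht : 0 < (t : ℝ)) {I : Time T → Ω → V}
    (hI : ∀ n i, i ≤ 2 ^ n → TendstoInMeasure μ (fun m ω => ∑ q ∈ Finset.range (i * 2 ^ m),
      f (dyadicPoint t (n + m) q) (dyadicPoint t (n + m) (q + 1)) ω) atTop
      (I (dyadicPoint t n i))) :
    ∃ ns : ℕ → ℕ, StrictMono ns ∧ ∀ᵐ ω ∂μ, Tendsto (fun j =>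
      ∑ i ∈ Finset.range (2 ^ ns j), w (dyadicPoint t (ns j) (i + 1)) ω
        (I (dyadicPoint t (ns j) (i + 1)) ω - I (dyadicPoint t (ns j) i) ω
          - f (dyadicPoint t (ns j) i) (dyadicPoint t (ns j) (i + 1)) ω)) atTop (𝓝 0) := by
  obtain ⟨ρ, hρ, hb⟩ := h.exists_weighted_bound hB hκ hκ' ha haκ hK hw hwK hwa ht
  have mw : ∀ s, StronglyMeasurable (w s) := fun s => (hw s).mono (ℱ.le s)
  set S : ℕ → Ω → V := fun n ω => ∑ i ∈ Finset.range (2 ^ n), w (dyadicPoint t n (i + 1)) ω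
        (I (dyadicPoint t n (i + 1)) ω - I (dyadicPoint t n i) ω
          - f (dyadicPoint t n i) (dyadicPoint t n (i + 1)) ω) with hS
  have key : ∀ n, AEStronglyMeasurable (S n) μ ∧ eLpNorm (S n) 2 μ ≤ ENNReal.ofReal (ρ n) :=
    fun n => by
    have hcorr : ∀ i < 2 ^ n, TendstoInMeasure μ (fun m => dyadicCorrection f t n m i) atTop
        (fun ω => I (dyadicPoint t n (i + 1)) ω - I (dyadicPoint t n i) ω
          - f (dyadicPoint t n i) (dyadicPoint t n (i + 1)) ω) := fun i hi => by
      refine tendstoInMeasure_sum_of_le (r := 2) zero_le_one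
        (f := fun j m ω => ∑ q ∈ Finset.range ((i + j) * 2 ^ m),
          f (dyadicPoint t (n + m) q) (dyadicPoint t (n + m) (q + 1)) ω)
        (g := fun j => I (dyadicPoint t n (i + j))) (fun j hj => hI n (i + j) (by omega))
        fun m ω => ?_
      rw [Finset.sum_range_succ, Finset.sum_range_one, one_mul, add_zero, add_comm ‖_‖ ‖_‖]
      refine le_trans (le_of_eq ?_) (norm_sub_le _ _)
      congr 1
      rw [dyadicCorrection, add_mul i 1, one_mul, Finset.sum_range_add]
      simp only [add_assoc]
      abel
    have hlim : TendstoInMeasure μ (fun m ω => ∑ i ∈ Finset.range (2 ^ n),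
        w (dyadicPoint t n (i + 1)) ω (dyadicCorrection f t n m i ω)) atTop (S n) := by
      refine tendstoInMeasure_sum_of_le hK hcorr fun m ω => ?_
      rw [hS, ← Finset.sum_sub_distrib, Finset.mul_sum]
      refine norm_sum_le_of_le _ fun i _ => ?_
      rw [← map_sub]
      exact ((w _ ω).le_opNorm _).trans (mul_le_mul_of_nonneg_right (hwK _ _) (norm_nonneg _))
    have hm : ∀ m, AEStronglyMeasurable (fun ω => ∑ i ∈ Finset.range (2 ^ n),
        w (dyadicPoint t n (i + 1)) ω (dyadicCorrection f t n m i ω)) μ := fun m =>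
      (Finset.stronglyMeasurable_fun_sum _ fun i _ => stronglyMeasurable_clm_apply (mw _)
        (h.stronglyMeasurable_correction t n m i)).aestronglyMeasurable
    -- At fixed level `n` the refinement depth tends to infinity; Fatou's lemma along an almost
    -- surely convergent subsequence transfers the bound `ρ n`, which does not depend on the depth.
    obtain ⟨ms, -, hms⟩ := hlim.exists_seq_tendsto_ae
    exact ⟨aestronglyMeasurable_of_tendsto_ae atTop (fun j => hm (ms j)) hms,
      Lp.eLpNorm_le_of_ae_tendsto (Eventually.of_forall fun j => hb n (ms j))
        (fun j => hm (ms j)) hms⟩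
  have h0 : TendstoInMeasure μ S atTop (0 : Ω → V) := by
    refine tendstoInMeasure_of_tendsto_eLpNorm two_ne_zero (fun n => (key n).1)
      aestronglyMeasurable_zero ?_
    simp only [sub_zero]
    have := ENNReal.tendsto_ofReal hρ
    rw [ENNReal.ofReal_zero] at this
    exact tendsto_of_tendsto_of_tendsto_of_le_of_le tendsto_const_nhds this (fun _ => zero_le)
      fun n => (key n).2
  exact h0.exists_seq_tendsto_ae

end SewingLimit

/-! ### Consequences of the definition of the rough integral. -/

section RoughIntegral

variable {α T : ℝ} {d : ℕ} {Ω : Type*} {mΩ : MeasurableSpace Ω} {μ : Measure Ω}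
  {η : RoughPath α T d} {V : Type*} [NormedAddCommGroup V] [NormedSpace ℝ V]
  {Z : Time T → Ω → (EuclideanSpace ℝ (Fin d) →L[ℝ] V)}
  {Z' : Time T → Ω → (EuclideanSpace ℝ (Fin d) →L[ℝ] EuclideanSpace ℝ (Fin d) →L[ℝ] V)}
  {I : Time T → Ω → V}

/-- The dyadic points of `[0, t]` up to a coarse point form a partition of the interval ending
there. Hence one family of grids serves all coarse endpoints simultaneously. -/
theorem IsRoughIntegral.tendstoInMeasure (h : IsRoughIntegral μ η Z Z' I) {t : Time T}
    (ht : 0 < (t : ℝ)) {n i : ℕ} (hi : i ≤ 2 ^ n) :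
    TendstoInMeasure μ (fun m ω => ∑ q ∈ Finset.range (i * 2 ^ m),
      germ η Z Z' (dyadicPoint t (n + m) q) (dyadicPoint t (n + m) (q + 1)) ω) atTop
      (I (dyadicPoint t n i)) := by
  rw [tendstoInMeasure_iff_norm]
  intro ε hε
  rw [ENNReal.tendsto_nhds_zero]
  intro c hc
  obtain ⟨δ, hδ, H⟩ := h (dyadicPoint t n i) ε hε c hc
  have hmesh : Tendsto (fun m : ℕ => (t : ℝ) / 2 ^ (n + m)) atTop (𝓝 0) :=
    (Tendsto.div_atTop tendsto_const_nhds (tendsto_pow_atTop_atTop_of_one_lt one_lt_two)).comp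
      (tendsto_add_atTop_nat n |>.congr fun m => Nat.add_comm m n)
  filter_upwards [hmesh.eventually_lt_const hδ] with m hm
  have hN : i * 2 ^ m ≤ 2 ^ (n + m) := by
    rw [pow_add]; exact Nat.mul_le_mul_right _ hi
  have hp := isPartition_dyadicPoint ht hN
  rw [dyadicPoint_refine] at hp
  refine H _ _ hp fun q hq => ?_
  rw [dyadicPoint_sub t (hq.trans_le hN)]
  exact hm

/-- At time zero the empty partition is admissible for every mesh, and its sum is `0`. -/
theorem IsRoughIntegral.ae_eq_zero (h : IsRoughIntegral μ η Z Z' I) {t : Time T}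
    (ht : (t : ℝ) = 0) : I t =ᵐ[μ] 0 := by
  have h1 : ∀ n : ℕ, ∀ᵐ ω ∂μ, ‖I t ω‖ < ((n : ℝ) + 1)⁻¹ := fun n => by
    have h2 : μ {ω | ((n : ℝ) + 1)⁻¹ ≤ ‖I t ω‖} = 0 := by
      refine le_antisymm (ENNReal.le_of_forall_pos_le_add fun c hc _ => ?_) zero_le
      obtain ⟨δ, -, H⟩ := h t ((n : ℝ) + 1)⁻¹ (by positivity) c (by exact_mod_cast hc)
      have := H 0 (fun _ => t) ⟨ht, rfl, fun i hi => absurd hi (Nat.not_lt_zero i)⟩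
        fun i hi => absurd hi (Nat.not_lt_zero i)
      simpa using this
    filter_upwards [measure_eq_zero_iff_ae_notMem.1 h2] with ω hω
    simpa using hω
  filter_upwards [ae_all_iff.2 h1] with ω hω
  by_contra hne
  have hpos : 0 < ‖I t ω‖ := norm_pos_iff.2 hne
  obtain ⟨n, hn⟩ := exists_nat_one_div_lt hpos
  rw [one_div] at hn
  exact absurd (hω n) (not_lt.2 hn.le)

end RoughIntegral

/-! ### Transforming a solution by the inverse flow, and uniqueness. -/

section Uniqueness

variable {α T : ℝ} {d k : ℕ} {Ω : Type*} {mΩ : MeasurableSpace Ω} {μ : Measure Ω}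
  {η : RoughPath α T d} {ℱ : Filtration (Time T) mΩ}
  {F G : Time T → Ω → (EuclideanSpace ℝ (Fin k) →L[ℝ]
      EuclideanSpace ℝ (Fin d) →L[ℝ] EuclideanSpace ℝ (Fin k))}
  {F' G' : Time T → Ω → (EuclideanSpace ℝ (Fin d) →L[ℝ] EuclideanSpace ℝ (Fin k) →L[ℝ]
      EuclideanSpace ℝ (Fin d) →L[ℝ] EuclideanSpace ℝ (Fin k))}
  {U V : Time T → Ω → (EuclideanSpace ℝ (Fin k) →L[ℝ] EuclideanSpace ℝ (Fin k))}
  {b : Time T → Ω → EuclideanSpace ℝ (Fin k) → EuclideanSpace ℝ (Fin k)}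
  {ξ : Ω → EuclideanSpace ℝ (Fin k)} {Y : Time T → Ω → EuclideanSpace ℝ (Fin k)}
  {γ γ' θ K : ℝ} {p : ℝ≥0∞}

theorem IsSolution.exists_defectBound [IsProbabilityMeasure μ]
    (h : IsSolution ℱ μ η b F F' ξ γ γ' p Y) :
    ∃ B, 0 ≤ B ∧ DefectBound ℱ μ (α + γ) (α + γ + γ') B
      (germ η (integrand F Y) (integrand' F F' Y)) := by
  obtain ⟨B, hB, H⟩ := h.controlled.exists_germ_defect_bound h.two_le h.gamma_mem.2
    h.gamma_mem.1 h.gamma'_mem.1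
  exact ⟨B, hB, fun s t _ => stronglyMeasurable_germ (h.controlled.progressive.stronglyAdapted s)
    (h.controlled.progressive'.stronglyAdapted s) t, fun s u t h1 h2 => (H s u t h1 h2).1,
    fun s u t h1 h2 => (H s u t h1 h2).2⟩

theorem integrable_clm_apply {E : Type*} [NormedAddCommGroup E] [NormedSpace ℝ E]
    {v : Time T → E →L[ℝ] E} (hv : Continuous v) {g : Time T → E}
    (hg : Integrable g (timeMeasure T)) : Integrable (fun r => v r (g r)) (timeMeasure T) := by
  obtain ⟨K, hK, hvK⟩ := exists_bound_of_continuous hv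
  have hb : Continuous fun q : (E →L[ℝ] E) × E => q.1 q.2 :=
    (isBoundedBilinearMap_apply (𝕜 := ℝ)).continuous
  refine (hg.norm.const_mul K).mono'
    (hb.comp_aestronglyMeasurable ((hv.aestronglyMeasurable).prodMk hg.1))
    (Eventually.of_forall fun r => ?_)
  exact ((v r).le_opNorm _).trans (mul_le_mul_of_nonneg_right (hvK r) (norm_nonneg _))

theorem continuous_setIntegral_Iic {E : Type*} [NormedAddCommGroup E] [NormedSpace ℝ E]
    {g : Time T → E} (hg : Integrable g (timeMeasure T)) {M : ℝ} (hM : ∀ r, ‖g r‖ ≤ M) :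
    Continuous fun t => ∫ r in Set.Iic t, g r ∂timeMeasure T := by
  refine continuous_of_holder (C := M) one_pos fun s t hst => ?_
  rw [setIntegral_Iic_sub hg hst, Real.rpow_one]
  exact norm_setIntegral_Ioc_le hst fun r _ => hM r

/-- One step of the telescoping argument for the transformed solution. -/
theorem transformed_increment {E : Type*} [NormedAddCommGroup E] [NormedSpace ℝ E]
    [CompleteSpace E] {v : Time T → E →L[ℝ] E} (hv : Continuous v) {g : Time T → E}
    (hg : Integrable g (timeMeasure T)) {s t : Time T} {m : E →L[ℝ] E}
    {x y i j q : E} (hm : m x = x + q)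
    (hy : y - x = (∫ r in Set.Ioc s t, g r ∂timeMeasure T) + (j - i)) :
    v t y - v s x - ∫ r in Set.Ioc s t, v r (g r) ∂timeMeasure T
      = v t (j - i - q) + (v t * m - v s) x
        + ∫ r in Set.Ioc s t, (v t - v r) (g r) ∂timeMeasure T := by
  have h1 : ∫ r in Set.Ioc s t, (v t - v r) (g r) ∂timeMeasure T
      = v t (∫ r in Set.Ioc s t, g r ∂timeMeasure T)
        - ∫ r in Set.Ioc s t, v r (g r) ∂timeMeasure T := by
    rw [← (v t).integral_comp_comm hg.integrableOn,
      ← integral_sub ((v t).integrable_comp hg).integrableOn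
        (integrable_clm_apply hv hg).integrableOn]
    rfl
  have h2 : y = x + (∫ r in Set.Ioc s t, g r ∂timeMeasure T) + (j - i) := by
    rw [add_assoc, ← hy]; abel
  have h3 : (v t * m - v s) x = v t (x + q) - v s x := by
    rw [← hm]; rfl
  rw [h1, h2, h3]
  simp only [map_add, map_sub]
  abel

/-- The inverse flow transforms a solution of the rough equation into a solution of an integral
equation. -/
theorem IsSolution.transformed_eq [IsProbabilityMeasure μ] (hK : 0 ≤ K) (hα : 0 < α) (hθ : 1 < θ)
    (hflow : IsLinearFlow ℱ η θ K G G' U V) (hGF : ∀ t, G t =ᵐ[μ] F t)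
    (hGF' : ∀ t, G' t =ᵐ[μ] F' t)
    (hgrow : ∃ C : ℝ, ∀ᵐ ω ∂μ, ∀ t x, ‖b t ω x‖ ≤ C * (1 + ‖x‖))
    (h : IsSolution ℱ μ η b F F' ξ γ γ' p Y) :
    ∀ᵐ ω ∂μ, ∀ t, V t ω (Y t ω) = ξ ω + ∫ r in Set.Iic t, V r ω (b r ω (Y r ω)) ∂timeMeasure T := by
  obtain ⟨L, hL⟩ := hgrow
  obtain ⟨I, hI, hIeq⟩ := h.equation
  obtain ⟨B, hB, hdef⟩ := h.exists_defectBound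
  have hVc : ∀ ω, Continuous fun t => V t ω := fun ω =>
    continuous_of_holder hα fun s t hst => hflow.holder_inv s t ω hst
  have hdrift : ∀ᵐ ω ∂μ, ∃ M, 0 ≤ M ∧ ∀ r, ‖b r ω (Y r ω)‖ ≤ M := by
    filter_upwards [hL] with ω hω
    obtain ⟨BY, hBY0, hBY⟩ := exists_bound_of_continuous (h.continuous ω)
    refine ⟨|L| * (1 + BY), by positivity, fun r => (hω r _).trans ?_⟩
    exact mul_le_mul (le_abs_self L) (by linarith [hBY r]) (by positivity) (abs_nonneg L)
  have hfix : ∀ t, ∀ᵐ ω ∂μ,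
      V t ω (Y t ω) = ξ ω + ∫ r in Set.Iic t, V r ω (b r ω (Y r ω)) ∂timeMeasure T := fun t => by
    rcases t.2.1.eq_or_lt with ht | ht
    · filter_upwards [hIeq, hI.ae_eq_zero ht.symm] with ω h1 h2
      rw [hflow.zero_inv t ω ht.symm, h1 t, h2,
        setIntegral_measure_zero _ (timeMeasure_Iic_zero ht.symm),
        setIntegral_measure_zero _ (timeMeasure_Iic_zero ht.symm)]
      simp
    have hm := h.gamma_mem
    have hm' := h.gamma'_mem
    have hone := h.one_lt
    -- The integrator is `V`, of Hölder order `α`; the exponent condition is `2α + γ ≥ α + γ + γ' >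
    -- 1`.
    obtain ⟨ns, hns, hlim⟩ := hdef.exists_subseq_tendsto hB h.half_lt h.one_lt hα.le
      (by linarith [hm.2, hm'.2]) hK hflow.adapted_inv hflow.bound_inv hflow.holder_inv ht
      fun n i hi => hI.tendstoInMeasure ht hi
    -- The flow is built from the modified coefficients and the integral from the original ones;
    -- countably many dyadic times suffice to identify the germs.
    have hgerm : ∀ᵐ ω ∂μ, ∀ n i, germ η (integrand G Y) (integrand' G G' Y)
        (dyadicPoint t n i) (dyadicPoint t n (i + 1)) ω = germ η (integrand F Y)
        (integrand' F F' Y) (dyadicPoint t n i) (dyadicPoint t n (i + 1)) ω :=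
      ae_all_iff.2 fun n => ae_all_iff.2 fun i => germ_ae_eq (hGF _) (hGF' _)
    filter_upwards [hIeq, hI.ae_eq_zero (dyadicPoint_zero t 0), hlim, hgerm, hdrift,
      h.integrable_drift] with ω h1 h2 h3 h4 ⟨M, hM0, hM⟩ h5
    obtain ⟨BY, hBY0, hBY⟩ := exists_bound_of_continuous (h.continuous ω)
    have hVi := integrable_clm_apply (hVc ω) h5
    have hzero : ∀ n, dyadicPoint t n 0 = dyadicPoint t 0 0 := fun n =>
      Subtype.ext (by rw [dyadicPoint_zero, dyadicPoint_zero])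
    set S2 : ℕ → EuclideanSpace ℝ (Fin k) := fun n => ∑ i ∈ Finset.range (2 ^ n),
      (V (dyadicPoint t n (i + 1)) ω
        * flowStep η G G' ω (dyadicPoint t n i) (dyadicPoint t n (i + 1))
        - V (dyadicPoint t n i) ω) (Y (dyadicPoint t n i) ω) with hS2
    set S3 : ℕ → EuclideanSpace ℝ (Fin k) := fun n => ∑ i ∈ Finset.range (2 ^ n),
      ∫ r in Set.Ioc (dyadicPoint t n i) (dyadicPoint t n (i + 1)),
        (V (dyadicPoint t n (i + 1)) ω - V r ω) (b r ω (Y r ω)) ∂timeMeasure T with hS3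
    -- The left side does not depend on `n`. On the right, the sewing error tends to zero along the
    -- subsequence, while the flow error `S2` and the drift error `S3` tend to zero with the mesh,
    -- with total orders `θ - 1` and `α`.
    have hdecomp : ∀ n, V t ω (Y t ω) - ξ ω - ∫ r in Set.Iic t, V r ω (b r ω (Y r ω)) ∂timeMeasure T
        = ∑ i ∈ Finset.range (2 ^ n), V (dyadicPoint t n (i + 1)) ω
          (I (dyadicPoint t n (i + 1)) ω - I (dyadicPoint t n i) ω
            - germ η (integrand F Y) (integrand' F F' Y) (dyadicPoint t n i)
              (dyadicPoint t n (i + 1)) ω) + S2 n + S3 n := fun n => by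
      rw [hS2, hS3]
      beta_reduce
      rw [← Finset.sum_add_distrib, ← Finset.sum_add_distrib]
      have hstep : ∀ i ∈ Finset.range (2 ^ n), _ = _ := fun i _ =>
        transformed_increment (hVc ω) h5 (s := dyadicPoint t n i) (t := dyadicPoint t n (i + 1))
        (x := Y (dyadicPoint t n i) ω) (y := Y (dyadicPoint t n (i + 1)) ω)
        (i := I (dyadicPoint t n i) ω) (j := I (dyadicPoint t n (i + 1)) ω)
        (flowStep_apply η G G' Y (dyadicPoint t n i) (dyadicPoint t n (i + 1)) ω) (by
          rw [h1, h1, ← setIntegral_Iic_sub h5 (monotone_dyadicPoint t n i.le_succ)]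
          abel)
      simp only [h4] at hstep
      rw [← Finset.sum_congr rfl hstep, Finset.sum_sub_distrib,
        Finset.sum_range_sub (fun i => V (dyadicPoint t n i) ω (Y (dyadicPoint t n i) ω)),
        Finset.sum_congr rfl fun i _ =>
          (setIntegral_Iic_sub hVi (monotone_dyadicPoint t n i.le_succ)).symm,
        Finset.sum_range_sub (fun i => ∫ r in Set.Iic (dyadicPoint t n i),
          V r ω (b r ω (Y r ω)) ∂timeMeasure T), dyadicPoint_last, hzero,
        hflow.zero_inv _ ω (dyadicPoint_zero t 0),
        setIntegral_measure_zero _ (timeMeasure_Iic_zero (dyadicPoint_zero t 0)), sub_zero,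
        h1 (dyadicPoint t 0 0), h2,
        setIntegral_measure_zero _ (timeMeasure_Iic_zero (dyadicPoint_zero t 0))]
      simp
    have hmesh : ∀ (n : ℕ) {e : ℝ}, 1 ≤ e → ∑ i ∈ Finset.range (2 ^ n),
        ((dyadicPoint t n (i + 1) : ℝ) - dyadicPoint t n i) ^ e ≤ T * (t / 2 ^ n) ^ (e - 1) :=
      fun n e he => sum_rpow_le (fun i _ => monotone_dyadicPoint t n i.le_succ) he
        (fun i hi => (dyadicPoint_sub t hi).le) (by positivity)
    have l2 : Tendsto S2 atTop (𝓝 0) := by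
      refine squeeze_zero_norm (a := fun n => K * BY * (T * (t / 2 ^ n) ^ (θ - 1))) (fun n => ?_) ?_
      · rw [hS2]
        beta_reduce
        refine (norm_sum_le_of_le _ (n := fun i => K * BY *
          ((dyadicPoint t n (i + 1) : ℝ) - dyadicPoint t n i) ^ θ) fun i _ => ?_).trans ?_
        · refine (ContinuousLinearMap.le_opNorm _ _).trans ?_
          rw [mul_right_comm]
          have hle := monotone_dyadicPoint t n i.le_succ
          exact mul_le_mul (hflow.step_inv _ _ ω hle) (hBY _) (norm_nonneg _)
            (mul_nonneg hK (Real.rpow_nonneg (time_sub_nonneg hle) _))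
        · rw [← Finset.mul_sum]
          exact mul_le_mul_of_nonneg_left (hmesh n hθ.le) (by positivity)
      · simpa using ((tendsto_mesh_rpow t (sub_pos.2 hθ)).const_mul T).const_mul (K * BY)
    have l3 : Tendsto S3 atTop (𝓝 0) := by
      refine squeeze_zero_norm (a := fun n => K * M * (T * (t / 2 ^ n) ^ (1 + α - 1)))
        (fun n => ?_) ?_
      · rw [hS3]
        beta_reduce
        refine (norm_sum_le_of_le _ (n := fun i => K * M *
          ((dyadicPoint t n (i + 1) : ℝ) - dyadicPoint t n i) ^ (1 + α)) fun i _ => ?_).trans ?_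
        · have hle := monotone_dyadicPoint t n i.le_succ
          have h0 := time_sub_nonneg hle
          refine (norm_setIntegral_Ioc_le (B := K * ((dyadicPoint t n (i + 1) : ℝ)
            - dyadicPoint t n i) ^ α * M) hle fun r hr => ?_).trans (le_of_eq ?_)
          · refine (ContinuousLinearMap.le_opNorm _ _).trans (mul_le_mul ?_ (hM r) (norm_nonneg _)
              (by positivity))
            refine (hflow.holder_inv r _ ω hr.2).trans (mul_le_mul_of_nonneg_left
              (Real.rpow_le_rpow (time_sub_nonneg hr.2) ?_ hα.le) hK)
            have : (dyadicPoint t n i : ℝ) ≤ r := hr.1.le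
            linarith
          · rw [Real.rpow_add_of_nonneg h0 zero_le_one hα.le, Real.rpow_one]
            ring
        · rw [← Finset.mul_sum]
          exact mul_le_mul_of_nonneg_left (hmesh n (by linarith)) (by positivity)
      · simpa using ((tendsto_mesh_rpow t (by linarith : 0 < 1 + α - 1)).const_mul T).const_mul
          (K * M)
    have l := (h3.add (l2.comp hns.tendsto_atTop)).add (l3.comp hns.tendsto_atTop)
    simp only [Function.comp_apply, ← hdecomp, add_zero] at l
    have := tendsto_nhds_unique tendsto_const_nhds l
    rw [sub_sub] at this
    exact sub_eq_zero.1 this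
  -- The identity holds almost surely at each fixed time; continuity of both sides and a countable
  -- dense set make the null set independent of time.
  obtain ⟨D, hDc, hDd⟩ := TopologicalSpace.exists_countable_dense (Time T)
  filter_upwards [(ae_ball_iff hDc).2 fun t _ => hfix t, hdrift, h.integrable_drift]
    with ω h1 ⟨M, hM0, hM⟩ h5 t
  have c1 : Continuous fun t => V t ω (Y t ω) := (hVc ω).clm_apply (h.continuous ω)
  have c2 : Continuous fun t => ξ ω + ∫ r in Set.Iic t, V r ω (b r ω (Y r ω)) ∂timeMeasure T :=
    continuous_const.add (continuous_setIntegral_Iic (integrable_clm_apply (hVc ω) h5)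
      (M := K * M) fun r => ((V r ω).le_opNorm _).trans
        (mul_le_mul (hflow.bound_inv r ω) (hM r) (norm_nonneg _) hK))
  exact congrFun (c1.ext_on hDd c2 fun t ht => h1 t ht) t

/-- Solutions of the rough equation are unique up to indistinguishability. -/
theorem IsSolution.indistinguishable [IsProbabilityMeasure μ] (hT : 0 ≤ T) (hK : 0 ≤ K)
    (hα : 0 < α) (hθ : 1 < θ)
    (hflow : IsLinearFlow ℱ η θ K G G' U V) (hGF : ∀ t, G t =ᵐ[μ] F t)
    (hGF' : ∀ t, G' t =ᵐ[μ] F' t)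
    (hgrow : ∃ C : ℝ, ∀ᵐ ω ∂μ, ∀ t x, ‖b t ω x‖ ≤ C * (1 + ‖x‖))
    (hlip : ∃ C : ℝ, ∀ᵐ ω ∂μ, ∀ t x y, ‖b t ω x - b t ω y‖ ≤ C * ‖x - y‖)
    {δ δ' : ℝ} {q : ℝ≥0∞} {X : Time T → Ω → EuclideanSpace ℝ (Fin k)}
    (hY : IsSolution ℱ μ η b F F' ξ γ γ' p Y) (hX : IsSolution ℱ μ η b F F' ξ δ δ' q X) :
    ∀ᵐ ω ∂μ, ∀ t, Y t ω = X t ω := by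
  obtain ⟨L, hL⟩ := hlip
  filter_upwards [hY.transformed_eq hK hα hθ hflow hGF hGF' hgrow,
    hX.transformed_eq hK hα hθ hflow hGF hGF' hgrow, hL, hY.integrable_drift,
    hX.integrable_drift] with ω h1 h2 hL iY iX t
  have hVc : Continuous fun t => V t ω :=
    continuous_of_holder hα fun s t hst => hflow.holder_inv s t ω hst
  have hUV : ∀ t x, U t ω (V t ω x) = x := fun t x => congrArg (fun f => f x) (hflow.mul_inv t ω)
  set D : Time T → EuclideanSpace ℝ (Fin k) := fun t => V t ω (Y t ω) - V t ω (X t ω) with hD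
  have hDc : Continuous D :=
    (hVc.clm_apply (hY.continuous ω)).sub (hVc.clm_apply (hX.continuous ω))
  have hDi : Integrable (fun r => ‖D r‖) (timeMeasure T) :=
    hDc.norm.integrable_of_hasCompactSupport (HasCompactSupport.of_compactSpace _)
  have hsub : ∀ t, Y t ω - X t ω = U t ω (D t) := fun t => by
    rw [hD, map_sub, hUV, hUV]
  -- One factor `K` bounds `V`, the other bounds `U` in `Y - X = U D`; the `1` only ensures
  -- positivity. Grönwall with zero initial term gives `D = 0`.
  set A := K * (|L| * K) + 1 with hA
  have hbound : ∀ t, ‖D t‖ ≤ 0 + A * ∫ r in Set.Iic t, ‖D r‖ ∂timeMeasure T := fun t => by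
    have e : D t = ∫ r in Set.Iic t, V r ω (b r ω (Y r ω) - b r ω (X r ω)) ∂timeMeasure T := by
      rw [hD]
      beta_reduce
      rw [h1, h2, add_sub_add_left_eq_sub,
        ← integral_sub (integrable_clm_apply hVc iY).integrableOn
        (integrable_clm_apply hVc iX).integrableOn]
      simp only [map_sub]
    rw [e, zero_add, ← integral_const_mul]
    refine norm_integral_le_of_norm_le (hDi.const_mul A).integrableOn
      (Eventually.of_forall fun r => ?_)
    refine ((V r ω).le_opNorm _).trans ?_
    have a1 : ‖b r ω (Y r ω) - b r ω (X r ω)‖ ≤ |L| * (K * ‖D r‖) := by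
      refine (hL r _ _).trans (mul_le_mul (le_abs_self L) ?_ (norm_nonneg _) (abs_nonneg L))
      rw [hsub]
      exact ((U r ω).le_opNorm _).trans
        (mul_le_mul_of_nonneg_right (hflow.bound r ω) (norm_nonneg _))
    refine (mul_le_mul (hflow.bound_inv r ω) a1 (norm_nonneg _) hK).trans ?_
    have := norm_nonneg (D r)
    rw [hA]
    nlinarith
  have h0 := gronwall_integral hT hDc.norm (fun _ => norm_nonneg _) le_rfl
    (by positivity : 0 < A) hbound t
  rw [mul_zero, zero_mul] at h0
  have h3 : D t = 0 := norm_le_zero_iff.1 h0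
  rw [← sub_eq_zero, hsub, h3, map_zero]

end Uniqueness

/-! ### Modifying the data and assembling the theorem. -/

section WellPosedness

variable {T : ℝ} {k : ℕ} {Ω : Type*} {mΩ : MeasurableSpace Ω} {μ : Measure Ω}
  {ℱ : Filtration (Time T) mΩ}

/-- In a complete filtration a drift can be modified on a null set so that its growth and
Lipschitz bounds hold everywhere. -/
theorem exists_drift_modification
    (hℱ : ∀ (t : Time T) (N : Set Ω), μ N = 0 → MeasurableSet[ℱ t] N)
    {b : Time T → Ω → EuclideanSpace ℝ (Fin k) → EuclideanSpace ℝ (Fin k)}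
    (hb : ProgressiveField ℱ b)
    (hgrow : ∃ C : ℝ, ∀ᵐ ω ∂μ, ∀ t x, ‖b t ω x‖ ≤ C * (1 + ‖x‖))
    (hlip : ∃ C : ℝ, ∀ᵐ ω ∂μ, ∀ t x y, ‖b t ω x - b t ω y‖ ≤ C * ‖x - y‖) :
    ∃ (c : Time T → Ω → EuclideanSpace ℝ (Fin k) → EuclideanSpace ℝ (Fin k)) (L : ℝ), 0 < L ∧
      ProgressiveField ℱ c ∧ (∀ t ω x, ‖c t ω x‖ ≤ L * (1 + ‖x‖)) ∧
      (∀ t ω x y, ‖c t ω x - c t ω y‖ ≤ L * ‖x - y‖) ∧ ∀ᵐ ω ∂μ, ∀ t x, c t ω x = b t ω x := by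
  classical
  obtain ⟨C1, h1⟩ := hgrow
  obtain ⟨C2, h2⟩ := hlip
  set S : Set Ω := {ω | (∀ t x, ‖b t ω x‖ ≤ C1 * (1 + ‖x‖)) ∧
    ∀ t x y, ‖b t ω x - b t ω y‖ ≤ C2 * ‖x - y‖} with hS
  have hSae : ∀ᵐ ω ∂μ, ω ∈ S := by filter_upwards [h1, h2] with ω a1 a2 using ⟨a1, a2⟩
  -- The event is defined by uncountably many conditions; it is measurable, already at time zero,
  -- only because its complement is null and the filtration is complete.
  have hSm : ∀ t, MeasurableSet[ℱ t] S := fun t => by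
    have := (hℱ t Sᶜ hSae).compl
    rwa [compl_compl] at this
  have hL : ∀ ω ∈ S, ∀ t x, ‖b t ω x‖ ≤ (|C1| + |C2| + 1) * (1 + ‖x‖) := fun ω hω t x =>
    (hω.1 t x).trans (mul_le_mul_of_nonneg_right
      (by linarith [le_abs_self C1, abs_nonneg C2]) (by positivity))
  have hL' : ∀ ω ∈ S, ∀ t x y, ‖b t ω x - b t ω y‖ ≤ (|C1| + |C2| + 1) * ‖x - y‖ :=
    fun ω hω t x y => (hω.2 t x y).trans (mul_le_mul_of_nonneg_right
      (by linarith [le_abs_self C2, abs_nonneg C1]) (norm_nonneg _))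
  refine ⟨fun t ω x => if ω ∈ S then b t ω x else 0, |C1| + |C2| + 1, by positivity, fun t => ?_,
    fun t ω x => ?_, fun t ω x y => ?_, ?_⟩
  · have hp : Measurable[(inferInstance : MeasurableSpace (Set.Iic t)).prod
        ((ℱ t).prod (inferInstance : MeasurableSpace (EuclideanSpace ℝ (Fin k)))), ℱ t]
        (fun q : Set.Iic t × Ω × EuclideanSpace ℝ (Fin k) => q.2.1) :=
      measurable_fst.comp measurable_snd
    exact Measurable.ite (hp (hSm t)) (hb t) measurable_const
  · by_cases hω : ω ∈ S
    · simp only [hω, if_true]; exact hL ω hω t x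
    · simp only [hω, if_false, norm_zero]; positivity
  · by_cases hω : ω ∈ S
    · simp only [hω, if_true]; exact hL' ω hω t x y
    · simp only [hω, if_false, sub_zero, norm_zero]; positivity
  · filter_upwards [hSae] with ω hω t x
    simp only [hω, if_true]

/-- An essentially bounded random variable has a bounded modification. -/
theorem exists_bounded_modification {V : Type*} [NormedAddCommGroup V] {m : MeasurableSpace Ω}
    {f : Ω → V} (hm : StronglyMeasurable[m] f) (hf : MemLp f ∞ μ) :
    ∃ (g : Ω → V) (R : ℝ), StronglyMeasurable[m] g ∧ (∀ ω, ‖g ω‖ ≤ R) ∧ g =ᵐ[μ] f := by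
  obtain ⟨R, hR0, hR⟩ := MemLp.ae_bound hf
  have hS : MeasurableSet[m] {ω | ‖f ω‖ ≤ R} := hm.norm.measurable measurableSet_Iic
  refine ⟨{ω | ‖f ω‖ ≤ R}.indicator f, R, hm.indicator hS, fun ω => ?_, ?_⟩
  · by_cases h : ω ∈ {ω | ‖f ω‖ ≤ R}
    · rw [Set.indicator_of_mem h]; exact h
    · rw [Set.indicator_of_notMem h, norm_zero]; exact hR0
  · filter_upwards [hR] with ω h
    exact Set.indicator_of_mem (s := {ω | ‖f ω‖ ≤ R}) h f

theorem completeSpace_bilinear {A B E : Type*} [NormedAddCommGroup A] [NormedSpace ℝ A]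
    [NormedAddCommGroup B] [NormedSpace ℝ B] [NormedAddCommGroup E] [NormedSpace ℝ E]
    [CompleteSpace E] : CompleteSpace (A →L[ℝ] B →L[ℝ] E) := inferInstance

/-- Well-posedness of the rough equation with linear rough part. -/
theorem exists_unique_solution [IsProbabilityMeasure μ] (hT : 0 < T)
    (hℱ : ∀ (t : Time T) (N : Set Ω), μ N = 0 → MeasurableSet[ℱ t] N)
    {d : ℕ} {α β β' : ℝ} (hα : α ∈ Set.Ioo (1 / 3 : ℝ) (1 / 2))
    (hβ : β ∈ Set.Ioc (1 / 4 : ℝ) α) (hβ' : β' ∈ Set.Ioc 0 β) (hsum : 1 < α + β + β')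
    {η : RoughPath α T d}
    {F : Time T → Ω → (EuclideanSpace ℝ (Fin k) →L[ℝ]
      EuclideanSpace ℝ (Fin d) →L[ℝ] EuclideanSpace ℝ (Fin k))}
    {F' : Time T → Ω → (EuclideanSpace ℝ (Fin d) →L[ℝ] EuclideanSpace ℝ (Fin k) →L[ℝ]
      EuclideanSpace ℝ (Fin d) →L[ℝ] EuclideanSpace ℝ (Fin k))}
    (hF : IsStrongControlled ℱ μ η β β' ∞ F F')
    {b : Time T → Ω → EuclideanSpace ℝ (Fin k) → EuclideanSpace ℝ (Fin k)}
    (hb : ProgressiveField ℱ b)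
    (hgrow : ∃ C : ℝ, ∀ᵐ ω ∂μ, ∀ t x, ‖b t ω x‖ ≤ C * (1 + ‖x‖))
    (hlip : ∃ C : ℝ, ∀ᵐ ω ∂μ, ∀ t x y, ‖b t ω x - b t ω y‖ ≤ C * ‖x - y‖)
    {ξ : Ω → EuclideanSpace ℝ (Fin k)}
    (hξm : StronglyMeasurable[ℱ ⟨0, Set.left_mem_Icc.2 hT.le⟩] ξ) (hξ : MemLp ξ ∞ μ) :
    ∃ X : Time T → Ω → EuclideanSpace ℝ (Fin k),
      IsSolution ℱ μ η b F F' ξ β β' ∞ X ∧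
      IsStrongControlled ℱ μ η α β ∞ X (integrand F X) ∧
      (∃ C : ℝ, ∀ᵐ ω ∂μ, ∀ t, ‖X t ω‖ ≤ C) ∧
      ∀ (γ γ' : ℝ) (p : ℝ≥0∞) (Y : Time T → Ω → EuclideanSpace ℝ (Fin k)),
        IsSolution ℱ μ η b F F' ξ γ γ' p Y → ∀ᵐ ω ∂μ, ∀ t, Y t ω = X t ω := by
  have hα0 : 0 < α := by linarith [hα.1]
  have : CompleteSpace (EuclideanSpace ℝ (Fin k) →L[ℝ] EuclideanSpace ℝ (Fin d) →L[ℝ]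
      EuclideanSpace ℝ (Fin k)) := completeSpace_bilinear
  obtain ⟨G, G', C, hC, hG, hGm, hGm', hGF, hGF'⟩ :=
    exists_uniformControlled_modification hT hℱ (by linarith [hβ.1]) hβ'.1 hF
  obtain ⟨U, V, K, hK, hflow⟩ := exists_linearFlow hT ℱ hα hβ hβ' hsum hC hG hGm hGm'
  obtain ⟨c, L, hL, hc, hcgrow, hclip, hcb⟩ := exists_drift_modification hℱ hb hgrow hlip
  obtain ⟨ζ, R, hζm, hζR, hζξ⟩ := exists_bounded_modification hξm hξ
  -- The exponent condition `θ ≤ 1 + α` holds since `β + β' ≤ 2α < 1`.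
  obtain ⟨X, B, hB, hX, hX0⟩ := exists_pathwise_solution hT hα0
    (by linarith [hα.2, hβ.2, hβ'.2]) (by linarith) hK hflow hc hL hcgrow hclip
    (fun t => hζm.mono (ℱ.mono (Subtype.coe_le_coe.1 t.2.1))) hζR
  obtain ⟨hsol, hctrl⟩ := hX.isSolution hα hβ hβ' hsum hC hB hG hF.progressive hF.progressive'
    hGF hGF' hcb hX0 hζξ
  exact ⟨X, hsol, hctrl, ⟨B, Eventually.of_forall fun ω t => hX.bound t ω⟩,
    fun γ γ' p Y hY => hY.indistinguishable hT.le hK hα0 hsum hflow hGF hGF' hgrow hlip hsol⟩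

end WellPosedness

end RoughRDE

end

theorem corollary3p1
    {Ω : Type*} {mΩ : MeasurableSpace Ω} (μ : Measure Ω) [IsProbabilityMeasure μ]
    (T : ℝ) (hT : 0 < T)
    -- the complete filtered probability space
    (ℱ : Filtration (RoughRDE.Time T) mΩ)
    (hℱ : ∀ (t : RoughRDE.Time T) (N : Set Ω), μ N = 0 → MeasurableSet[ℱ t] N)
    (d k : ℕ) (α β β' : ℝ) (hα : α ∈ Set.Ioo (1 / 3 : ℝ) (1 / 2))
    (hβ : β ∈ Set.Ioc (1 / 4 : ℝ) α) (hβ' : β' ∈ Set.Ioc 0 β) (hsum : 1 < α + β + β')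
    (η : RoughRDE.RoughPath α T d)
    (F : RoughRDE.Time T → Ω → (EuclideanSpace ℝ (Fin k) →L[ℝ]
      EuclideanSpace ℝ (Fin d) →L[ℝ] EuclideanSpace ℝ (Fin k)))
    (F' : RoughRDE.Time T → Ω → (EuclideanSpace ℝ (Fin d) →L[ℝ] EuclideanSpace ℝ (Fin k) →L[ℝ]
      EuclideanSpace ℝ (Fin d) →L[ℝ] EuclideanSpace ℝ (Fin k)))
    (hF : RoughRDE.IsStrongControlled ℱ μ η β β' ∞ F F')
    (b : RoughRDE.Time T → Ω → EuclideanSpace ℝ (Fin k) → EuclideanSpace ℝ (Fin k))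
    (hb : RoughRDE.ProgressiveField ℱ b)
    (hb_growth : ∃ C : ℝ, ∀ᵐ ω ∂μ, ∀ t x, ‖b t ω x‖ ≤ C * (1 + ‖x‖))
    (hb_lip : ∃ C : ℝ, ∀ᵐ ω ∂μ, ∀ t x y, ‖b t ω x - b t ω y‖ ≤ C * ‖x - y‖)
    (ξ : Ω → EuclideanSpace ℝ (Fin k))
    (hξ_meas : StronglyMeasurable[ℱ ⟨0, Set.left_mem_Icc.2 hT.le⟩] ξ)
    (hξ : MemLp ξ ∞ μ) :
    ∃ X : RoughRDE.Time T → Ω → EuclideanSpace ℝ (Fin k),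
      RoughRDE.IsSolution ℱ μ η b F F' ξ β β' ∞ X ∧
      RoughRDE.IsStrongControlled ℱ μ η α β ∞ X (RoughRDE.integrand F X) ∧
      (∃ C : ℝ, ∀ᵐ ω ∂μ, ∀ t, ‖X t ω‖ ≤ C) ∧
      -- uniqueness up to indistinguishability among all solutions
      ∀ (γ γ' : ℝ) (p : ℝ≥0∞) (Y : RoughRDE.Time T → Ω → EuclideanSpace ℝ (Fin k)),
        RoughRDE.IsSolution ℱ μ η b F F' ξ γ γ' p Y →
        ∀ᵐ ω ∂μ, ∀ t, Y t ω = X t ω :=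
  RoughRDE.exists_unique_solution hT hℱ hα hβ hβ' hsum hF hb hb_growth hb_lip hξ_meas hξ
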